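/- Let $T>0$ and let $I=[0,1]$. Let $\lambda\in C^{1,1}([0,1]\times[0,1])$ be a strictly positive function with continuous partial derivatives, and let $\phi\in C[0,1]$ be nonnegative. For $N\ge 1$ let $\{X^N_t\}_{t\ge 0}$ be the càdlàg Markov process on $\{0,1,2,\dots\}^N$ with generator $$\mathcal L_N f(x)=\sum_{i=1}^N\sum_{j=1}^N \frac{x(i)\,\lambda(\frac iN,\frac jN)}{N}\bigl(f(x^{i,j})-f(x)\bigr),$$ where $x^{i,j}=x$ if $i=j$, and otherwise $x^{i,j}$ is obtained from $x$ by decreasing $x(i)$ by $1$ and increasing $x(j)$ by $1$. Let $\mathcal S$ be the dual of $C[0,1]$ with the topology of pointwise convergence on $C[0,1]$, let $D([0,T],\mathcal S)$ be the Skorokhod space of càdlàg functions $[0,T]\to\mathcal S$ (with the Skorokhod $J_1$ topology), and let $\mu^N=\{\mu^N_t\}_{0\le t\le T}\in D([0,T],\mathcal S)$ be given by $\mu^N_t(f)=\frac1N\sum_{i=1}^N X^N_t(i)f(\frac iN)$ for $f\in C[0,1]$. For $\nu\in\mathcal S$ put $$I_{ini}(\nu)=\sup_{H\in C[0,1]}\Bigl\{\nu(H)-\int_0^1\phi(x)\bigl(e^{H(x)}-1\bigr)dx\Bigr\}.$$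 For $f\in C[0,1]$ put $\mathcal Bf(x)=\int_0^1\lambda(x,y)\bigl(e^{f(y)-f(x)}-1\bigr)dy$, and for $\mu\in D([0,T],\mathcal S)$ put $$I_{dyn}(\mu)=\sup_{G\in C^{1,0}([0,T]\times[0,1])}\Bigl\{\mu_T(G_T)-\mu_0(G_0)-\int_0^T\mu_s\bigl((\partial_s+\mathcal B)G_s\bigr)ds\Bigr\},$$ where $C^{1,0}([0,T]\times[0,1])$ is the set of continuous functions $G(s,x)$ with a continuous partial derivative $\partial_sG$ on $[0,T]\times[0,1]$. Let $D_0$ be the set of all $\mu\in D([0,T],\mathcal S)$ for which there is a nonnegative $\psi\in C^{1,0}([0,T]\times[0,1])$ with $\mu_t(dx)=\psi(t,x)\,dx$ and $\int_0^1\partial_s\psi(s,x)\,dx=0$ for all $t,s\in[0,T]$. **Theorem 2.3.** Assume (A) for every $N\ge1$ the variables $X_0^N(1),\dots,X_0^N(N)$ are independent and $X_0^N(i)$ is Poisson distributed with mean $\phi(\frac iN)$; (B) there are $\lambda_1,\lambda_2\in C[0,1]$ with $\lambda(x,y)=\lambda_1(x)\lambda_2(y)$ for all $x,y\in[0,1]$.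 Then for every closed set $C\subseteq D([0,T],\mathcal S)$ $$\limsup_{N\to\infty}\frac1N\log P(\mu^N\in C)\le-\inf_{\mu\in C}\bigl(I_{ini}(\mu_0)+I_{dyn}(\mu)\bigr),$$ and for every open set $O\subseteq D([0,T],\mathcal S)$ $$\liminf_{N\to\infty}\frac1N\log P(\mu^N\in O)\ge-\inf_{\mu\in D_0\cap O}\bigl(I_{ini}(\mu_0)+I_{dyn}(\mu)\bigr),$$ with $\log 0=-\infty$ and $\inf\emptyset=+\infty$. -/

import Mathlib

open MeasureTheory ProbabilityTheory Set Filter Topology unitInterval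
open scoped NNReal ENNReal

noncomputable section

namespace Urn

/-! ### The path space -/

/-- The dual of `C[0,1]`, with the topology of pointwise convergence on `C[0,1]`. -/
abbrev S : Type := WeakDual ℝ C(I, ℝ)

/-- Right-continuous with left limits, at every time (at an end point of the time set where one of
the two one-sided neighbourhoods is trivial, the corresponding requirement is void). -/
def IsCadlag {ι E : Type*} [TopologicalSpace ι] [Preorder ι] [TopologicalSpace E]
    (F : ι → E) : Prop :=
  ∀ t, ContinuousWithinAt F (Ioi t) t ∧ ∃ l, Tendsto F (𝓝[<] t) (𝓝 l)

/-- The set of càdlàg functions `[0,T] → S`. -/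
def D (T : ℝ) : Type := {F : Icc (0 : ℝ) T → S // IsCadlag F}

instance (T : ℝ) : CoeFun (D T) (fun _ => Icc (0 : ℝ) T → S) := ⟨Subtype.val⟩

/-- The basic Skorokhod neighbourhood of `F` given by a finite set `s` of test functions and
`ε`: the paths `G` that, after an increasing change of time which moves no time by `ε` or more,
are `ε`-close to `F` uniformly in time when tested against each function of `s`. -/
def skorokhodBall {T : ℝ} (F : D T) (s : Finset C(I, ℝ)) (ε : ℝ) : Set (D T) :=
  {G | ∃ κ : Icc (0 : ℝ) T ≃o Icc (0 : ℝ) T,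
    (∀ t, |(κ t : ℝ) - t| < ε) ∧ ∀ t, ∀ f ∈ s, |G (κ t) f - F t f| < ε}

/-- The Skorokhod (J1) topology of `D([0,T], S)`, for the uniform structure of `S` given by the
seminorms `A ↦ |A f|`. -/
instance skorokhod (T : ℝ) : TopologicalSpace (D T) where
  IsOpen U := ∀ F ∈ U, ∃ s : Finset C(I, ℝ), ∃ ε > 0, skorokhodBall F s ε ⊆ U
  isOpen_univ := fun _ _ => ⟨∅, 1, one_pos, subset_univ _⟩
  isOpen_inter := by
    classical
    rintro U V hU hV F ⟨hFU, hFV⟩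
    obtain ⟨s, ε, hε, h⟩ := hU F hFU
    obtain ⟨s', ε', hε', h'⟩ := hV F hFV
    refine ⟨s ∪ s', min ε ε', lt_min hε hε', ?_⟩
    rintro G ⟨κ, h1, h2⟩
    refine ⟨h ⟨κ, fun t => (h1 t).trans_le (min_le_left _ _), fun t f hf => ?_⟩,
      h' ⟨κ, fun t => (h1 t).trans_le (min_le_right _ _), fun t f hf => ?_⟩⟩
    · exact (h2 t f (Finset.mem_union_left _ hf)).trans_le (min_le_left _ _)
    · exact (h2 t f (Finset.mem_union_right _ hf)).trans_le (min_le_right _ _)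
  isOpen_sUnion := by
    rintro 𝒰 h F ⟨U, hU, hF⟩
    obtain ⟨s, ε, hε, hs⟩ := h U hU F hF
    exact ⟨s, ε, hε, hs.trans (subset_sUnion_of_mem hU)⟩

/-- The initial time in `[0,T]`. -/
def t0 {T : ℝ} (hT : 0 < T) : Icc (0 : ℝ) T := ⟨0, le_rfl, hT.le⟩

/-- The final time in `[0,T]`. -/
def tT {T : ℝ} (hT : 0 < T) : Icc (0 : ℝ) T := ⟨T, hT.le, le_rfl⟩

/-! ### The urn process -/

/-- The position `i / N` of the `i`-th box, the boxes being numbered `1, …, N`. -/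
def node {N : ℕ} (i : Fin N) : I :=
  ⟨((i : ℝ) + 1) / N, by
    have h : ((i : ℕ) : ℝ) + 1 ≤ N := by exact_mod_cast i.isLt
    have hN : (0 : ℝ) < N := lt_of_lt_of_le (by positivity) h
    exact ⟨by positivity, (div_le_one hN).2 h⟩⟩

/-- The configuration after one ball has moved from box `i` to box `j`. -/
def move {N : ℕ} (x : Fin N → ℕ) (i j : Fin N) : Fin N → ℕ :=
  if i = j then x else Function.update (Function.update x i (x i - 1)) j (x j + 1)

/-- The generator `L_N` of the urn process. -/
def gen (lam : C(I × I, ℝ)) {N : ℕ} (f : (Fin N → ℕ) → ℝ) (x : Fin N → ℕ) : ℝ :=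
  ∑ i, ∑ j, (x i : ℝ) * lam (node i, node j) / N * (f (move x i j) - f x)

/-- `X` is an `N`-urn process with rate function `lam`: a càdlàg process in `ℕ^N` which solves the
martingale problem for `L_N`. Every `L_N`-transition conserves the number of balls, so the functions
of finite support are a core and determine the transition probabilities. -/
structure IsUrnProcess (lam : C(I × I, ℝ)) (N : ℕ) {Ω : Type*} [m : MeasurableSpace Ω]
    (P : Measure Ω) (X : ℝ≥0 → Ω → Fin N → ℕ) : Prop where
  measurable : ∀ t, Measurable (X t)
  cadlag : ∀ ω, IsCadlag fun t => X t ω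
  martingale : ∃ ℱ : Filtration ℝ≥0 m, (∀ t, Measurable[ℱ t] (X t)) ∧
    ∀ f : (Fin N → ℕ) → ℝ, f.support.Finite →
      Martingale (fun (t : ℝ≥0) ω =>
        f (X t ω) - f (X 0 ω) - ∫ s in (0 : ℝ)..t, gen lam f (X s.toNNReal ω)) ℱ P

/-- The box contents are independent and Poisson, with mean `φ (i / N)` in the `i`-th box. -/
def IsPoissonInitial (φ : C(I, ℝ)) (N : ℕ) {Ω : Type*} [MeasurableSpace Ω]
    (P : Measure Ω) (X0 : Ω → Fin N → ℕ) : Prop :=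
  iIndepFun (fun (i : Fin N) ω => X0 ω i) P ∧
    ∀ i : Fin N, P.map (fun ω => X0 ω i) = poissonMeasure (φ (node i)).toNNReal

/-- The empirical measure `(1/N) ∑ x(i) δ_{i/N}` of a configuration, as an element of `S`. -/
def empirical {N : ℕ} (x : Fin N → ℕ) : S :=
  StrongDual.toWeakDual ((1 / (N : ℝ)) • ∑ i, (x i : ℝ) • ContinuousMap.evalCLM ℝ (node i))

theorem empirical_apply {N : ℕ} (x : Fin N → ℕ) (f : C(I, ℝ)) :
    empirical x f = 1 / (N : ℝ) * ∑ i, (x i : ℝ) * f (node i) := by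
  change ((1 / (N : ℝ)) • ∑ i, (x i : ℝ) • ContinuousMap.evalCLM ℝ (node i) : StrongDual ℝ C(I, ℝ)) f = _
  simp [ContinuousMap.evalCLM_apply]

theorem continuous_empirical (N : ℕ) : Continuous (empirical : (Fin N → ℕ) → S) :=
  continuous_of_discreteTopology

/-- The path `(μ^N_t)` for `0 ≤ t ≤ T` of the empirical measures of a càdlàg trajectory in `ℕ^N`. -/
def empiricalPath (T : ℝ) {N : ℕ} (x : ℝ≥0 → Fin N → ℕ) (hx : IsCadlag x) : D T :=
  ⟨fun t => empirical (x (t : ℝ).toNNReal), by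
    intro t
    have hc : Continuous fun t : Icc (0 : ℝ) T => (t : ℝ).toNNReal := by fun_prop
    have hlt : ∀ a b : Icc (0 : ℝ) T, a < b → (a : ℝ).toNNReal < (b : ℝ).toNNReal :=
      fun a b hab => (Real.toNNReal_lt_toNNReal_iff (lt_of_le_of_lt a.2.1 hab)).2 hab
    obtain ⟨h1, l, hl⟩ := hx (t : ℝ).toNNReal
    refine ⟨?_, empirical l, ?_⟩
    · exact ((continuous_empirical N).tendsto _).comp (h1.tendsto.comp
        (hc.continuousWithinAt.tendsto_nhdsWithin fun s hs => hlt _ _ hs))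
    · exact ((continuous_empirical N).tendsto _).comp (hl.comp
        (hc.continuousWithinAt.tendsto_nhdsWithin fun s hs => hlt _ _ hs))⟩

/-! ### The rate function -/

/-- `C^{1,0}([0,T] × [0,1])`: continuous functions with a continuous partial derivative `dt` in time
(one-sided at the times `0` and `T`). -/
structure C10 {T : ℝ} (hT : 0 < T) where
  val : C(Icc (0 : ℝ) T × I, ℝ)
  dt : C(Icc (0 : ℝ) T × I, ℝ)
  hasDeriv : ∀ (t : Icc (0 : ℝ) T) (x : I),
    HasDerivWithinAt (IccExtend hT.le fun s => val (s, x)) (dt (t, x)) (Icc 0 T) t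

/-- `C^{1,1}([0,1] × [0,1])`: continuous partial derivatives on the closed square. -/
def IsC11 (lam : C(I × I, ℝ)) : Prop :=
  ∃ L : ℝ × ℝ → ℝ, ContDiffOn ℝ 1 L (Icc 0 1 ×ˢ Icc 0 1) ∧
    ∀ x y : I, lam (x, y) = L (x, y)

/-- The nonlinear operator `(B f)(x) = ∫ lam(x,y) (exp (f y - f x) - 1) dy` on `C[0,1]`. -/
def B (lam : C(I × I, ℝ)) (f : C(I, ℝ)) : C(I, ℝ) where
  toFun x := ∫ y : I, lam (x, y) * (Real.exp (f y - f x) - 1)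
  continuous_toFun := by
    have h := continuous_parametric_integral_of_continuous (μ := (volume : Measure I))
      (f := fun x y : I => lam (x, y) * (Real.exp (f y - f x) - 1))
      (by unfold Function.uncurry; fun_prop) isCompact_univ
    simpa using h

/-- The rate of the initial state. -/
def Iini (φ : C(I, ℝ)) (ν : S) : EReal :=
  ⨆ H : C(I, ℝ), ((ν H - ∫ x : I, φ x * (Real.exp (H x) - 1) : ℝ) : EReal)

/-- The rate of the dynamics. -/
def Idyn (lam : C(I × I, ℝ)) {T : ℝ} (hT : 0 < T) (μ : D T) : EReal :=
  ⨆ G : C10 hT,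
    ((μ (tT hT) (G.val.curry (tT hT)) - μ (t0 hT) (G.val.curry (t0 hT))
      - ∫ s in (0 : ℝ)..T, IccExtend hT.le
          (fun r => μ r (G.dt.curry r + B lam (G.val.curry r))) s : ℝ) : EReal)

/-- The paths with a nonnegative `C^{1,0}` density of conserved mass. -/
def D0 {T : ℝ} (hT : 0 < T) : Set (D T) :=
  {μ | ∃ ψ : C10 hT, (∀ p, 0 ≤ ψ.val p) ∧
    (∀ (t : Icc (0 : ℝ) T) (f : C(I, ℝ)), μ t f = ∫ x : I, f x * ψ.val (t, x)) ∧
    ∀ s : Icc (0 : ℝ) T, ∫ x : I, ψ.dt (s, x) = 0}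

end Urn

end

/-!
# Large deviations of the empirical measures of an urn process

The rate at which a ball jumps depends on its own position only, so the balls move independently of
each other: for `h > 0` the generator maps the multiplicative function `mult h x = ∏ h(i) ^ x(i)` to
its derivative in the direction `jumpOp h`, where `jumpOp` generates the motion of a single ball.
Hence `mult (semi (t - s) h) (X s)` is a positive martingale, `semi` being the semigroup of a single
ball (`lintegral_mul_mult`). The martingale problem is only used to derive this: the forward equation
on the configurations of at most `n` balls is a finite linear system. Together with the generating
function of the Poisson distribution (`lintegral_mult_initial`) it gives all exponential moments of
the process along a grid of times, and every change of measure is made along such a grid. For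
functions `H` and `G(t,x)` the density `tilt` of the tilted law is `exp N (⟨μ_0, H⟩ + ∑ …)`, and
`log (semi d (exp G)) = G + d B G + O(d²)` (`exists_log_semi_sub_le`) shows that its exponent is a
Riemann sum for the functionals `Jini`, `Jdyn` whose suprema are the rates `Iini`, `Idyn`.

*Upper bound.* The exponential Chebyshev inequality for `tilt` bounds the probability to stay close
to a continuous path (`exists_measure_near_le`). Applied to `mult` of an exponential with entries
`exp (± θ)`, the martingale and a maximal inequality show that it is superexponentially unlikely that
a positive fraction of the balls moves in a short time (`exists_measure_osc_le`). The paths whose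
oscillations are controlled at finitely many scales are covered by finitely many uniform
neighbourhoods of continuous paths (`exists_finite_cover`), by compactness in the product topology.
Uniform neighbourhoods are contained in Skorokhod neighbourhoods, and the bound follows for all closed
sets (`limsup_log_measure_le`).

*Lower bound.* Let `ψ` be a density of finite cost. The functionals are affine in the density, and the
relaxation of `φ` to the uniform distribution has a finite cost. A mixture with a little of it is
positive, or increasing, everywhere. For such a density the product form of the rates reduces
the equation "the dynamics with rates `λ(x,y) exp (G(y) - G(x))` has the density `ψ`" to a quadratic
equation for `exp G` at each point and one scalar equation at each time (`exists_flux_eq`).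
Smoothing `G` in time, and choosing `H` such that `φ exp H` is close to the initial density, one gets
controls that generate nearly `ψ` at nearly its cost (`exists_control`). Under the law tilted by `H`
and `G` the balls are still independent, with the kernels `kern`; their mean profile stays close to
`ψ` since the kernels are contractions (`exists_mean_control`), the empirical measures concentrate at
the mean by a Chernoff bound (`exists_setLIntegral_tilt_abs_le`), and the oscillation estimate carries
over. On the typical event of the tilted law the tilt is at most the exponential of `N` times the
cost, which bounds the probability of this event from below (`eventually_le_measure_near`).
-/

noncomputable section

namespace Urn

/-! ### Exponentials of positive operators -/

theorem norm_exp_sub_one_sub_le {𝔸 : Type*} [NormedRing 𝔸] [NormOneClass 𝔸] [NormedAlgebra ℝ 𝔸]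
    [CompleteSpace 𝔸] (X : 𝔸) :
    ‖NormedSpace.exp X - 1 - X‖ ≤ ‖X‖ ^ 2 * Real.exp ‖X‖ := by
  have h1 := (hasSum_nat_add_iff' 2).2 (NormedSpace.exp_series_hasSum_exp' (𝕂 := ℝ) X)
  have h2 := (NormedSpace.expSeries_div_hasSum_exp (𝔸 := ℝ) ‖X‖).mul_left (‖X‖ ^ 2)
  rw [← congrFun Real.exp_eq_exp_ℝ] at h2
  have h3 := h1.norm_le_of_bounded h2 (fun n => by
    rw [norm_smul]
    have hn : ‖X ^ (n + 2)‖ ≤ ‖X‖ ^ (n + 2) := norm_pow_le _ _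
    have hf : ((n + 2).factorial : ℝ)⁻¹ ≤ ((n.factorial : ℝ))⁻¹ := by
      apply inv_anti₀ (by positivity)
      exact_mod_cast Nat.factorial_le (by omega)
    have : ‖((n + 2).factorial : ℝ)⁻¹‖ = ((n + 2).factorial : ℝ)⁻¹ := by
      rw [Real.norm_of_nonneg]; positivity
    rw [this]
    calc ((n + 2).factorial : ℝ)⁻¹ * ‖X ^ (n + 2)‖ ≤ (n.factorial : ℝ)⁻¹ * ‖X‖ ^ (n + 2) := by
          gcongr
      _ = ‖X‖ ^ 2 * (‖X‖ ^ n / n.factorial) := by ring)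
  have e : NormedSpace.exp X - 1 - X
      = NormedSpace.exp X - ∑ i ∈ Finset.range 2, ((i.factorial : ℝ)⁻¹) • X ^ i := by
    simp [Finset.sum_range_succ, sub_sub]
  rw [e]
  exact h3

theorem le_exp_apply_of_nonneg {N : ℕ} (R : (Fin N → ℝ) →L[ℝ] (Fin N → ℝ))
    (hR : ∀ h, 0 ≤ h → 0 ≤ R h) (h : Fin N → ℝ) (hh : 0 ≤ h) : h ≤ NormedSpace.exp R h := by
  intro i
  have h1 := NormedSpace.exp_series_hasSum_exp' (𝕂 := ℝ) R
  have h2 := h1.mapL (ContinuousLinearMap.apply ℝ (Fin N → ℝ) h)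
  have h3 := (Pi.hasSum.1 h2) i
  have hpow : ∀ n : ℕ, 0 ≤ (R ^ n) h := by
    intro n
    induction n with
    | zero => simpa using hh
    | succ n ih => rw [pow_succ']; exact hR _ ih
  have h4 := le_hasSum h3 0 (fun n _ => by
    have := hpow n i
    simp only [ContinuousLinearMap.apply_apply, smul_apply, Pi.smul_apply,
      smul_eq_mul]
    exact mul_nonneg (by positivity) this)
  simpa using h4

/-! ### The semigroup of a single ball -/

/-- The generator of the motion of a single ball among the `N` boxes. -/
def jumpOp (lam : C(I × I, ℝ)) (N : ℕ) : (Fin N → ℝ) →L[ℝ] (Fin N → ℝ) :=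
  LinearMap.toContinuousLinearMap
    { toFun := fun h i => 1 / (N : ℝ) * ∑ j, lam (node i, node j) * (h j - h i)
      map_add' := fun f g => by
        ext i
        simp only [Pi.add_apply, ← mul_add, ← Finset.sum_add_distrib]
        congr 1; apply Finset.sum_congr rfl; intros; ring
      map_smul' := fun c g => by
        ext i
        simp only [Pi.smul_apply, smul_eq_mul, RingHom.id_apply]
        rw [mul_left_comm, Finset.mul_sum (a := c)]
        congr 1; apply Finset.sum_congr rfl; intros; ring }

theorem jumpOp_apply (lam : C(I × I, ℝ)) {N : ℕ} (h : Fin N → ℝ) (i : Fin N) :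
    jumpOp lam N h i = 1 / (N : ℝ) * ∑ j, lam (node i, node j) * (h j - h i) := rfl

/-- The transition semigroup of a single ball. -/
def semi (lam : C(I × I, ℝ)) (N : ℕ) (t : ℝ) : (Fin N → ℝ) →L[ℝ] (Fin N → ℝ) :=
  NormedSpace.exp (t • jumpOp lam N)

theorem avg_le {N : ℕ} (f : Fin N → ℝ) {c : ℝ} (hc : 0 ≤ c) (h : ∀ i, f i ≤ c) :
    1 / (N : ℝ) * ∑ i, f i ≤ c := by
  rcases N.eq_zero_or_pos with rfl | hN
  · simpa using hc
  have h1 : ∑ i, f i ≤ N * c := by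
    simpa using Finset.sum_le_card_nsmul Finset.univ f c (fun i _ => h i)
  have hN' : (0 : ℝ) < N := by exact_mod_cast hN
  rw [one_div, inv_mul_le_iff₀ hN']
  exact h1

theorem abs_avg_le {N : ℕ} (f : Fin N → ℝ) {c : ℝ} (hc : 0 ≤ c) (h : ∀ i, |f i| ≤ c) :
    |1 / (N : ℝ) * ∑ i, f i| ≤ c := by
  rw [abs_mul, abs_of_nonneg (by positivity : (0 : ℝ) ≤ 1 / N)]
  refine le_trans ?_ (avg_le (fun i => |f i|) hc h)
  gcongr
  exact Finset.abs_sum_le_sum_abs _ _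

section Semigroup

variable {lam : C(I × I, ℝ)} {N : ℕ}

theorem norm_jumpOp_le : ‖jumpOp lam N‖ ≤ 2 * ‖lam‖ := by
  refine ContinuousLinearMap.opNorm_le_bound _ (by positivity) fun h => ?_
  rw [pi_norm_le_iff_of_nonneg (by positivity)]
  intro i
  rw [jumpOp_apply, Real.norm_eq_abs]
  refine abs_avg_le _ (by positivity) fun j => ?_
  rw [abs_mul]
  have h1 : |lam (node i, node j)| ≤ ‖lam‖ := lam.norm_coe_le_norm _
  have h2 : |h j - h i| ≤ 2 * ‖h‖ := by
    have := norm_le_pi_norm h j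
    have := norm_le_pi_norm h i
    simp only [Real.norm_eq_abs] at *
    exact (abs_sub _ _).trans (by linarith)
  calc _ ≤ ‖lam‖ * (2 * ‖h‖) := by gcongr
    _ = _ := by ring

theorem semi_zero (h : Fin N → ℝ) : semi lam N 0 h = h := by
  simp [semi]

theorem norm_semi_sub_sub_le {t : ℝ} (ht : 0 ≤ t) (h : Fin N → ℝ) :
    ‖semi lam N t h - h - t • jumpOp lam N h‖
      ≤ t ^ 2 * (2 * ‖lam‖) ^ 2 * Real.exp (t * (2 * ‖lam‖)) * ‖h‖ := by
  rcases N.eq_zero_or_pos with rfl | hN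
  · rw [Subsingleton.elim (semi lam 0 t h - h - t • jumpOp lam 0 h) 0, norm_zero]; positivity
  have : Nonempty (Fin N) := ⟨⟨0, hN⟩⟩
  have hX : ‖t • jumpOp lam N‖ ≤ t * (2 * ‖lam‖) := by
    rw [norm_smul, Real.norm_of_nonneg ht]
    gcongr; exact norm_jumpOp_le
  have h1 := norm_exp_sub_one_sub_le (t • jumpOp lam N)
  have h2 := (NormedSpace.exp (t • jumpOp lam N) - 1 - t • jumpOp lam N).le_opNorm h
  have h3 : ‖t • jumpOp lam N‖ ^ 2 * Real.exp ‖t • jumpOp lam N‖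
      ≤ (t * (2 * ‖lam‖)) ^ 2 * Real.exp (t * (2 * ‖lam‖)) := by gcongr
  refine (le_of_eq ?_).trans (h2.trans (mul_le_mul_of_nonneg_right (h1.trans (h3.trans
    (le_of_eq ?_))) (norm_nonneg _)))
  · simp [semi]
  · ring

/-- Started from nonnegative values the semigroup does not decrease faster than a ball leaves its
box. -/
theorem exp_smul_le_semi (hpos : ∀ p, 0 < lam p) {t : ℝ} (ht : 0 ≤ t) (h : Fin N → ℝ)
    (hh : 0 ≤ h) : Real.exp (-(t * ‖lam‖)) • h ≤ semi lam N t h := by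
  set R : (Fin N → ℝ) →L[ℝ] (Fin N → ℝ) := t • jumpOp lam N + (t * ‖lam‖) • 1 with hR
  have hRpos : ∀ f, 0 ≤ f → 0 ≤ R f := by
    intro f hf i
    have h1 : R f i = t * (1 / (N : ℝ) * ∑ j, lam (node i, node j) * (f j - f i)) +
      t * ‖lam‖ * f i := by simp [hR, jumpOp_apply]
    have h2 : -(‖lam‖ * f i) ≤ 1 / (N : ℝ) * ∑ j, lam (node i, node j) * (f j - f i) := by
      have := avg_le (fun j => -(lam (node i, node j) * (f j - f i)))
        (mul_nonneg (norm_nonneg lam) (hf i)) (fun j => by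
          have ha := (hpos (node i, node j)).le
          have hb : lam (node i, node j) ≤ ‖lam‖ := lam.apply_le_norm _
          have hc : 0 ≤ f j := hf j
          have hd : 0 ≤ f i := hf i
          nlinarith [mul_nonneg ha hc, mul_nonneg (sub_nonneg.2 hb) hd])
      rw [Finset.sum_neg_distrib] at this
      linarith
    rw [h1, Pi.zero_apply]
    nlinarith [mul_le_mul_of_nonneg_left h2 ht]
  -- splitting off the maximal exit rate leaves the positive operator `R`, whose exponential is at
  -- least the identity on nonnegative vectors
  have e1 : t • jumpOp lam N = (-(t * ‖lam‖)) • 1 + R := by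
    ext h i
    simp [hR]
  have e2 : semi lam N t = Real.exp (-(t * ‖lam‖)) • NormedSpace.exp R := by
    let _ : NormedAlgebra ℚ ((Fin N → ℝ) →L[ℝ] (Fin N → ℝ)) :=
      NormedAlgebra.restrictScalars ℚ ℝ _
    rw [semi, e1, NormedSpace.exp_add_of_commute ((Commute.one_left R).smul_left _)]
    have e3 := NormedSpace.algebraMap_exp_comm (𝔸 := (Fin N → ℝ) →L[ℝ] (Fin N → ℝ))
      (-(t * ‖lam‖))
    rw [Algebra.algebraMap_eq_smul_one, Algebra.algebraMap_eq_smul_one,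
      ← congrFun Real.exp_eq_exp_ℝ] at e3
    rw [← e3, smul_mul_assoc, one_mul]
  rw [e2]
  intro i
  exact mul_le_mul_of_nonneg_left (le_exp_apply_of_nonneg R hRpos h hh i) (Real.exp_pos _).le

theorem semi_nonneg (hpos : ∀ p, 0 < lam p) {t : ℝ} (ht : 0 ≤ t) {h : Fin N → ℝ}
    (hh : 0 ≤ h) : 0 ≤ semi lam N t h :=
  (smul_nonneg (Real.exp_pos _).le hh).trans (exp_smul_le_semi hpos ht h hh)

theorem hasDerivAt_semi (t : ℝ) (h : Fin N → ℝ) :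
    HasDerivAt (fun s => semi lam N s h) (jumpOp lam N (semi lam N t h)) t := by
  have h1 := hasDerivAt_exp_smul_const' (𝕂 := ℝ) (jumpOp lam N) t
  exact h1.clm_apply (hasDerivAt_const t h) |>.congr_deriv (by simp [semi])

theorem semi_pos (hpos : ∀ p, 0 < lam p) {t : ℝ} (ht : 0 ≤ t) {h : Fin N → ℝ}
    (hh : ∀ i, 0 < h i) (i : Fin N) : 0 < semi lam N t h i :=
  (mul_pos (Real.exp_pos _) (hh i)).trans_le (exp_smul_le_semi hpos ht h (fun j => (hh j).le) i)

end Semigroup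

/-! ### Configurations and multiplicative functions -/

/-- The total number of balls. -/
def mass {N : ℕ} (x : Fin N → ℕ) : ℕ := ∑ i, x i

/-- The multiplicative function `∏ b(i)^x(i)` of the configuration `x`. -/
def mult {N : ℕ} (b : Fin N → ℝ) (x : Fin N → ℕ) : ℝ := ∏ i, b i ^ x i

/-- The configurations of at most `n` balls. -/
def atMost (N n : ℕ) : Finset (Fin N → ℕ) :=
  (Fintype.piFinset fun _ => Finset.range (n + 1)).filter fun x => mass x ≤ n

theorem mem_atMost {N n : ℕ} {x : Fin N → ℕ} : x ∈ atMost N n ↔ mass x ≤ n := by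
  simp only [atMost, Finset.mem_filter, Fintype.mem_piFinset, Finset.mem_range, and_iff_right_iff_imp]
  intro h i
  exact Nat.lt_succ_of_le ((Finset.single_le_sum (f := x) (fun _ _ => Nat.zero_le _)
    (Finset.mem_univ i)).trans h)

theorem mult_move {N : ℕ} (b : Fin N → ℝ) (x : Fin N → ℕ) (i j : Fin N) (hi : 0 < x i) :
    mult b (move x i j) = (∏ k ∈ Finset.univ.erase i, b k ^ x k) * b i ^ (x i - 1) * b j := by
  unfold mult move
  split_ifs with h
  · subst h
    rw [← Finset.mul_prod_erase _ _ (Finset.mem_univ i)]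
    obtain ⟨n, hn⟩ := Nat.exists_eq_succ_of_ne_zero hi.ne'
    rw [hn, Nat.succ_sub_one, pow_succ]; ring
  · have hj : j ∈ Finset.univ.erase i := Finset.mem_erase.2 ⟨fun e => h e.symm, Finset.mem_univ _⟩
    rw [← Finset.mul_prod_erase _ _ (Finset.mem_univ i), ← Finset.mul_prod_erase _ _ hj,
      ← Finset.mul_prod_erase (Finset.univ.erase i) (fun k => b k ^ x k) hj]
    have e : ∏ k ∈ (Finset.univ.erase i).erase j,
        b k ^ (Function.update (Function.update x i (x i - 1)) j (x j + 1) k)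
        = ∏ k ∈ (Finset.univ.erase i).erase j, b k ^ x k := by
      refine Finset.prod_congr rfl fun k hk => ?_
      have h1 : k ≠ j := Finset.ne_of_mem_erase hk
      have h2 : k ≠ i := Finset.ne_of_mem_erase (Finset.mem_of_mem_erase hk)
      rw [Function.update_of_ne h1, Function.update_of_ne h2]
    rw [e, Function.update_self, Function.update_of_ne h, Function.update_self, pow_succ]
    ring

theorem mass_move {N : ℕ} (x : Fin N → ℕ) (i j : Fin N) (hi : 0 < x i) :
    mass (move x i j) = mass x := by
  unfold mass move
  split_ifs with h
  · rfl
  · have hj : j ∈ Finset.univ.erase i := Finset.mem_erase.2 ⟨fun e => h e.symm, Finset.mem_univ _⟩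
    rw [← Finset.add_sum_erase _ _ (Finset.mem_univ i), ← Finset.add_sum_erase _ _ hj,
      ← Finset.add_sum_erase Finset.univ x (Finset.mem_univ i),
      ← Finset.add_sum_erase (Finset.univ.erase i) x hj]
    have e : ∑ k ∈ (Finset.univ.erase i).erase j,
        (Function.update (Function.update x i (x i - 1)) j (x j + 1) k)
        = ∑ k ∈ (Finset.univ.erase i).erase j, x k := by
      refine Finset.sum_congr rfl fun k hk => ?_
      have h1 : k ≠ j := Finset.ne_of_mem_erase hk
      have h2 : k ≠ i := Finset.ne_of_mem_erase (Finset.mem_of_mem_erase hk)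
      rw [Function.update_of_ne h1, Function.update_of_ne h2]
    rw [e, Function.update_self, Function.update_of_ne h, Function.update_self]
    omega

/-- The matrix of the generator: the rate of the jump from `x` to `y` if `x ≠ y`, and minus the rate
of leaving `x` if `x = y`. -/
def rate (lam : C(I × I, ℝ)) {N : ℕ} (x y : Fin N → ℕ) : ℝ := gen lam (Pi.single y 1) x

theorem rate_eq_zero (lam : C(I × I, ℝ)) {N n : ℕ} {x y : Fin N → ℕ} (hx : x ∉ atMost N n)
    (hy : y ∈ atMost N n) : rate lam x y = 0 := by
  rw [mem_atMost] at hx hy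
  unfold rate gen
  refine Finset.sum_eq_zero fun i _ => Finset.sum_eq_zero fun j _ => ?_
  rcases (x i).eq_zero_or_pos with h | h
  · simp [h]
  · have h1 : x ≠ y := by rintro rfl; exact hx hy
    have h2 : move x i j ≠ y := by rintro rfl; rw [mass_move x i j h] at hy; exact hx hy
    simp [Pi.single_eq_of_ne h1, Pi.single_eq_of_ne h2]

theorem sum_rate_mul (lam : C(I × I, ℝ)) {N n : ℕ} {x : Fin N → ℕ} (hx : x ∈ atMost N n)
    (F : (Fin N → ℕ) → ℝ) : ∑ y ∈ atMost N n, rate lam x y * F y = gen lam F x := by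
  simp only [rate, gen, Finset.sum_mul]
  rw [Finset.sum_comm]
  refine Finset.sum_congr rfl fun i _ => ?_
  rw [Finset.sum_comm]
  refine Finset.sum_congr rfl fun j _ => ?_
  rcases (x i).eq_zero_or_pos with h | h
  · simp [h]
  have h1 : move x i j ∈ atMost N n := by
    rw [mem_atMost, mass_move x i j h]; exact mem_atMost.1 hx
  simp only [mul_assoc]
  rw [← Finset.mul_sum]
  congr 1
  simp [sub_mul, Finset.sum_sub_distrib, Pi.single_apply, h1, hx]

/-- `L_N` maps `∏ b(i)^x(i)` to its derivative in `b` in the direction `jumpOp b`. This expresses that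
the balls move independently of each other. -/
theorem gen_mult (lam : C(I × I, ℝ)) {N : ℕ} (b : Fin N → ℝ) (x : Fin N → ℕ) :
    gen lam (mult b) x = ∑ i, (∏ k ∈ Finset.univ.erase i, b k ^ x k) *
      ((x i : ℝ) * b i ^ (x i - 1) * jumpOp lam N b i) := by
  refine Finset.sum_congr rfl fun i _ => ?_
  rw [jumpOp_apply, Finset.mul_sum, Finset.mul_sum, Finset.mul_sum]
  refine Finset.sum_congr rfl fun j _ => ?_
  rcases (x i).eq_zero_or_pos with h | h
  · simp [h]
  have h1 : mult b x = (∏ k ∈ Finset.univ.erase i, b k ^ x k) * b i ^ (x i - 1) * b i := by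
    have := mult_move b x i i h
    simpa [move] using this
  rw [mult_move b x i j h, h1]
  ring

theorem hasDerivAt_mult {N : ℕ} {b : ℝ → Fin N → ℝ} {b' : Fin N → ℝ} {t : ℝ}
    (hb : HasDerivAt b b' t) (x : Fin N → ℕ) :
    HasDerivAt (fun s => mult (b s) x) (∑ i, (∏ k ∈ Finset.univ.erase i, b t k ^ x k) *
      ((x i : ℝ) * b t i ^ (x i - 1) * b' i)) t := by
  have h := HasDerivAt.fun_finsetProd (u := Finset.univ) (f := fun i s => b s i ^ x i)
    (fun i _ => ((hasDerivAt_pi.1 hb) i).fun_pow (x i))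
  simpa [mult] using h

/-- The function `(r, x) ↦ ∏ (semi (t - r) h i)^x(i)` is harmonic in space-time. -/
theorem hasDerivAt_mult_semi (lam : C(I × I, ℝ)) {N : ℕ} (h : Fin N → ℝ) (t r : ℝ)
    (x : Fin N → ℕ) :
    HasDerivAt (fun s => mult (semi lam N (t - s) h) x)
      (-gen lam (mult (semi lam N (t - r) h)) x) r := by
  have h1 : HasDerivAt (fun s => semi lam N (t - s) h)
      (-jumpOp lam N (semi lam N (t - r) h)) r := by
    have := (hasDerivAt_semi (lam := lam) (N := N) (t - r) h).scomp r
      ((hasDerivAt_id r).const_sub t)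
    refine this.congr_deriv ?_
    simp
  refine (hasDerivAt_mult h1 x).congr_deriv ?_
  rw [gen_mult, ← Finset.sum_neg_distrib]
  refine Finset.sum_congr rfl fun i _ => ?_
  simp

theorem mult_pos {N : ℕ} {b : Fin N → ℝ} (hb : ∀ i, 0 < b i) (x : Fin N → ℕ) : 0 < mult b x :=
  Finset.prod_pos fun i _ => pow_pos (hb i) _

theorem mult_nonneg {N : ℕ} {b : Fin N → ℝ} (hb : 0 ≤ b) (x : Fin N → ℕ) : 0 ≤ mult b x :=
  Finset.prod_nonneg fun i _ => pow_nonneg (hb i) _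

theorem mult_mul {N : ℕ} (b c : Fin N → ℝ) (x : Fin N → ℕ) :
    mult (b * c) x = mult b x * mult c x := by
  simp [mult, mul_pow, Finset.prod_mul_distrib]

theorem mult_div {N : ℕ} (b c : Fin N → ℝ) (x : Fin N → ℕ) :
    mult (b / c) x = mult b x / mult c x := by
  simp [mult, div_pow, Finset.prod_div_distrib]

theorem mult_exp {N : ℕ} (g : Fin N → ℝ) (x : Fin N → ℕ) :
    mult (fun i => Real.exp (g i)) x = Real.exp (∑ i, x i * g i) := by
  simp [mult, Real.exp_sum, Real.exp_nat_mul]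

theorem mult_mono {N : ℕ} {b c : Fin N → ℝ} (hb : 0 ≤ b) (h : b ≤ c) (x : Fin N → ℕ) :
    mult b x ≤ mult c x :=
  Finset.prod_le_prod (fun i _ => pow_nonneg (hb i) _) fun i _ => pow_le_pow_left₀ (hb i) (h i) _

/-! ### The martingale problem and the law of the process -/

section UrnLaw

variable {lam : C(I × I, ℝ)} {N : ℕ} {Ω : Type*} [m : MeasurableSpace Ω] {P : Measure Ω}
  {X : ℝ≥0 → Ω → Fin N → ℕ}

theorem IsCadlag.eventually_eq {E : Type*} [TopologicalSpace E] [DiscreteTopology E]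
    {F : ℝ≥0 → E} (hF : IsCadlag F) (t : ℝ≥0) : ∀ᶠ s in 𝓝[>] t, F s = F t := by
  have h := (hF t).1
  rw [ContinuousWithinAt, nhds_discrete, tendsto_pure] at h
  exact h

/-- The time `(⌊k r⌋ + 1) / k`, a discretization of `r` from the right. -/
theorem tendsto_discretize (r : ℝ≥0) :
    Tendsto (fun k : ℕ => ((⌊((k : ℝ≥0) + 1) * r⌋₊ : ℝ≥0) + 1) / ((k : ℝ≥0) + 1)) atTop
      (𝓝[>] r) := by
  rw [tendsto_nhdsWithin_iff]
  constructor
  · rw [tendsto_iff_dist_tendsto_zero]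
    refine squeeze_zero (fun _ => dist_nonneg) (fun k => ?_) tendsto_one_div_add_atTop_nhds_zero_nat
    rw [NNReal.dist_eq, abs_le]
    have hk : (0 : ℝ) < (k : ℝ) + 1 := by positivity
    have h1 := Nat.floor_le (a := ((k : ℝ≥0) + 1) * r) (by positivity)
    have h2 := Nat.lt_floor_add_one (((k : ℝ≥0) + 1) * r)
    have h1' : (⌊((k : ℝ≥0) + 1) * r⌋₊ : ℝ) ≤ ((k : ℝ) + 1) * r := by exact_mod_cast h1
    have h2' : ((k : ℝ) + 1) * r < (⌊((k : ℝ≥0) + 1) * r⌋₊ : ℝ) + 1 := by exact_mod_cast h2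
    push_cast
    constructor
    · have : (r : ℝ) ≤ ((⌊((k : ℝ≥0) + 1) * r⌋₊ : ℝ) + 1) / (k + 1) := by
        rw [le_div_iff₀ hk]; linarith
      have h3 : 0 ≤ 1 / ((k : ℝ) + 1) := by positivity
      linarith
    · rw [sub_le_iff_le_add, div_le_iff₀ hk]
      have h4 : (1 / ((k : ℝ) + 1) + r) * (k + 1) = 1 + (k + 1) * r := by field_simp
      linarith
  · refine Eventually.of_forall fun k => ?_
    have hk : (0 : ℝ≥0) < (k : ℝ≥0) + 1 := by positivity
    have h2 := Nat.lt_floor_add_one (((k : ℝ≥0) + 1) * r)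
    rw [mem_Ioi, lt_div_iff₀ hk, mul_comm]
    exact h2

theorem measurable_uncurry_of_cadlag (hm : ∀ t, Measurable (X t))
    (hc : ∀ ω, IsCadlag fun t => X t ω) {E : Type*} [MeasurableSpace E] [TopologicalSpace E]
    [TopologicalSpace.PseudoMetrizableSpace E] [BorelSpace E]
    (f : (Fin N → ℕ) → E) : Measurable fun p : ℝ × Ω => f (X p.1.toNNReal p.2) := by
  refine measurable_of_tendsto_metrizable (f := fun (k : ℕ) (p : ℝ × Ω) =>
    f (X (((⌊((k : ℝ≥0) + 1) * p.1.toNNReal⌋₊ : ℝ≥0) + 1) / ((k : ℝ≥0) + 1)) p.2)) ?_ ?_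
  · intro k
    have h1 : Measurable fun q : ℕ × Ω => f (X (((q.1 : ℝ≥0) + 1) / ((k : ℝ≥0) + 1)) q.2) :=
      measurable_from_prod_countable_right fun n => (measurable_of_countable f).comp (hm (((n : ℝ≥0) + 1) / ((k : ℝ≥0) + 1)))
    have h2 : Measurable fun p : ℝ × Ω => (⌊((k : ℝ≥0) + 1) * p.1.toNNReal⌋₊, p.2) := by
      fun_prop
    generalize hF : (fun q : ℕ × Ω => f (X (((q.1 : ℝ≥0) + 1) / ((k : ℝ≥0) + 1)) q.2)) = F at h1
    have h3 := h1.comp h2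
    rw [← hF] at h3
    exact h3
  · rw [tendsto_pi_nhds]
    intro p
    refine tendsto_nhds_of_eventually_eq ?_
    filter_upwards [(tendsto_discretize p.1.toNNReal).eventually ((hc p.2).eventually_eq _)]
      with k hk
    rw [hk]

theorem gen_single_eq {n : ℕ} {y : Fin N → ℕ} (hy : y ∈ atMost N n) (z : Fin N → ℕ) :
    gen lam (Pi.single y 1 : (Fin N → ℕ) → ℝ) z = ∑ x ∈ atMost N n, rate lam x y * (Pi.single x 1 : (Fin N → ℕ) → ℝ) z := by
  by_cases hz : z ∈ atMost N n
  · rw [Finset.sum_eq_single z]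
    · simp [rate]
    · intro b _ hb; rw [Pi.single_eq_of_ne hb.symm, mul_zero]
    · exact fun h => absurd hz h
  · rw [Finset.sum_eq_zero]
    · exact rate_eq_zero lam hz hy
    · intro x hx
      rw [Pi.single_eq_of_ne (by rintro rfl; exact hz hx), mul_zero]

theorem setIntegral_single [IsProbabilityMeasure P] (hX : IsUrnProcess lam N P X) (A : Set Ω)
    (t : ℝ≥0) (y : Fin N → ℕ) :
    ∫ ω in A, (Pi.single y 1 : (Fin N → ℕ) → ℝ) (X t ω) ∂P = P.real (A ∩ X t ⁻¹' {y}) := by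
  have e : (fun ω => (Pi.single y 1 : (Fin N → ℕ) → ℝ) (X t ω)) = (X t ⁻¹' {y}).indicator 1 := by
    ext ω
    by_cases h : X t ω = y
    · rw [h]; simp [h]
    · rw [Pi.single_eq_of_ne h, indicator_of_notMem]; exact h
  have hm : MeasurableSet (X t ⁻¹' {y}) := hX.measurable t (measurableSet_singleton y)
  rw [e, integral_indicator_one hm, measureReal_restrict_apply hm, inter_comm]

/-- The forward equation, for the law of the process on an event of the past. -/
theorem forward_equation [IsProbabilityMeasure P] (hX : IsUrnProcess lam N P X)
    {ℱ : Filtration ℝ≥0 m}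
    (hmart : ∀ f : (Fin N → ℕ) → ℝ, f.support.Finite →
      Martingale (fun (t : ℝ≥0) ω =>
        f (X t ω) - f (X 0 ω) - ∫ s in (0 : ℝ)..t, gen lam f (X s.toNNReal ω)) ℱ P)
    {s t : ℝ≥0} (hst : s ≤ t) {A : Set Ω} (hA : MeasurableSet[ℱ s] A) {n : ℕ} {y : Fin N → ℕ}
    (hy : y ∈ atMost N n) :
    P.real (A ∩ X t ⁻¹' {y}) = P.real (A ∩ X s ⁻¹' {y}) + ∫ r in (s : ℝ)..t,
      ∑ x ∈ atMost N n, rate lam x y * P.real (A ∩ X r.toNNReal ⁻¹' {x}) := by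
  set f : (Fin N → ℕ) → ℝ := Pi.single y 1 with hf
  have hM := hmart f ((Set.finite_singleton y).subset Pi.support_single_subset)
  set C : ℝ := ∑ x ∈ atMost N n, |rate lam x y| with hC
  have hbound : ∀ z, |gen lam f z| ≤ C := by
    intro z
    rw [hf, gen_single_eq hy]
    refine (Finset.abs_sum_le_sum_abs _ _).trans (Finset.sum_le_sum fun x _ => ?_)
    rw [abs_mul]
    refine mul_le_of_le_one_right (abs_nonneg _) ?_
    rw [Pi.single_apply]; split_ifs <;> simp
  have hmeas : Measurable fun p : ℝ × Ω => gen lam f (X p.1.toNNReal p.2) :=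
    measurable_uncurry_of_cadlag hX.measurable hX.cadlag _
  have hint : ∀ ω (a b : ℝ), IntervalIntegrable (fun r => gen lam f (X r.toNNReal ω)) volume a b := by
    intro ω a b
    refine (intervalIntegrable_const (c := C)).mono_fun
      (hmeas.comp measurable_prodMk_right).aestronglyMeasurable ?_
    refine Eventually.of_forall fun r => ?_
    simp only [Real.norm_eq_abs]
    exact (hbound _).trans (le_abs_self _)
  have hfint : ∀ t, Integrable (fun ω => f (X t ω)) P := fun t =>
    Integrable.of_bound (((measurable_of_countable f).comp (hX.measurable t)).aestronglyMeasurable)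
      1 (Eventually.of_forall fun ω => by
        rw [hf, Pi.single_apply]; split_ifs <;> simp)
  have h1 := hM.setIntegral_eq hst hA
  have hi : ∀ t : ℝ≥0, Integrable (fun ω => ∫ s in (0 : ℝ)..t, gen lam f (X s.toNNReal ω)) P := by
    intro t
    have h3 := ((hfint t).sub (hfint 0)).sub (hM.integrable t)
    refine h3.congr (Eventually.of_forall fun ω => ?_)
    simp
  have h0 : ∀ t : ℝ≥0, ∫ ω in A, (f (X t ω) - f (X 0 ω)
      - ∫ s in (0 : ℝ)..t, gen lam f (X s.toNNReal ω)) ∂P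
      = P.real (A ∩ X t ⁻¹' {y}) - P.real (A ∩ X 0 ⁻¹' {y})
        - ∫ ω in A, (∫ r in (0 : ℝ)..t, gen lam f (X r.toNNReal ω)) ∂P := by
    intro t
    rw [integral_sub (f := fun ω => f (X t ω) - f (X 0 ω))
      ((hfint t).sub (hfint 0)).integrableOn (hi t).integrableOn,
      integral_sub (hfint t).integrableOn (hfint 0).integrableOn,
      setIntegral_single hX, setIntegral_single hX]
  rw [h0, h0] at h1
  have h2 : ∫ ω in A, (∫ r in (0 : ℝ)..t, gen lam f (X r.toNNReal ω)) ∂P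
      - ∫ ω in A, (∫ r in (0 : ℝ)..s, gen lam f (X r.toNNReal ω)) ∂P
      = ∫ r in (s : ℝ)..t, ∫ ω in A, gen lam f (X r.toNNReal ω) ∂P := by
    rw [← integral_sub (hi t).integrableOn (hi s).integrableOn,
      intervalIntegral.integral_of_le (by exact_mod_cast hst), integral_integral_swap]
    · refine integral_congr_ae (Eventually.of_forall fun ω => ?_)
      simp only
      rw [intervalIntegral.integral_interval_sub_left (hint _ _ _) (hint _ _ _),
        intervalIntegral.integral_of_le (by exact_mod_cast hst)]
    · exact Integrable.of_bound hmeas.aestronglyMeasurable C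
        (Eventually.of_forall fun p => hbound _)
  have h3 : ∀ r : ℝ, ∫ ω in A, gen lam f (X r.toNNReal ω) ∂P
      = ∑ x ∈ atMost N n, rate lam x y * P.real (A ∩ X r.toNNReal ⁻¹' {x}) := by
    intro r
    simp_rw [hf, gen_single_eq hy]
    rw [integral_finsetSum]
    · refine Finset.sum_congr rfl fun x _ => ?_
      rw [integral_const_mul, setIntegral_single hX]
    · intro x _
      refine Integrable.const_mul ?_ _
      exact Integrable.of_bound (((measurable_of_countable _).comp
        (hX.measurable _)).aestronglyMeasurable) 1 (Eventually.of_forall fun ω => by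
        rw [Pi.single_apply]; split_ifs <;> simp)
  simp_rw [h3] at h2
  linarith

/-- Functions that are harmonic in space-time have constant expectation on events of the past. The
restriction to at most `n` balls is harmless as no jump changes the number of balls, and it turns
the forward equation into a finite linear system. -/
theorem sum_harmonic_eq [IsProbabilityMeasure P] (hX : IsUrnProcess lam N P X)
    {ℱ : Filtration ℝ≥0 m}
    (hmart : ∀ f : (Fin N → ℕ) → ℝ, f.support.Finite →
      Martingale (fun (t : ℝ≥0) ω =>
        f (X t ω) - f (X 0 ω) - ∫ s in (0 : ℝ)..t, gen lam f (X s.toNNReal ω)) ℱ P)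
    {s t : ℝ≥0} (hst : s ≤ t) {A : Set Ω} (hA : MeasurableSet[ℱ s] A) (n : ℕ)
    (F : ℝ → (Fin N → ℕ) → ℝ)
    (hF : ∀ r x, HasDerivAt (fun r => F r x) (-gen lam (F r) x) r) :
    ∑ y ∈ atMost N n, F t y * P.real (A ∩ X t ⁻¹' {y})
      = ∑ y ∈ atMost N n, F s y * P.real (A ∩ X s ⁻¹' {y}) := by
  set p : (Fin N → ℕ) → ℝ → ℝ := fun y r => P.real (A ∩ X r.toNNReal ⁻¹' {y}) with hp
  have hmeas : ∀ y, Measurable (p y) := by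
    intro y
    have h1 : StronglyMeasurable fun q : ℝ × Ω =>
        (Pi.single y 1 : (Fin N → ℕ) → ℝ) (X q.1.toNNReal q.2) :=
      (measurable_uncurry_of_cadlag hX.measurable hX.cadlag _).stronglyMeasurable
    have h2 := (h1.integral_prod_right' (ν := P.restrict A)).measurable
    have h3 : p y = fun r : ℝ => ∫ ω in A, (Pi.single y 1 : (Fin N → ℕ) → ℝ)
        (X r.toNNReal ω) ∂P := by
      ext r
      exact (setIntegral_single hX A r.toNNReal y).symm
    rw [h3]
    exact h2
  have hb : ∀ y r, |p y r| ≤ 1 := fun y r => by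
    rw [abs_of_nonneg measureReal_nonneg]; exact measureReal_le_one
  have hpi : ∀ y a b, IntervalIntegrable (p y) volume a b := fun y a b =>
    (intervalIntegrable_const (c := (1 : ℝ))).mono_fun (hmeas y).aestronglyMeasurable
      (Eventually.of_forall fun r => by simpa using hb y r)
  have hsi : ∀ y a b, IntervalIntegrable (fun u => ∑ x ∈ atMost N n, rate lam x y * p x u)
      volume a b := fun y a b => by
    simpa [Finset.sum_fn] using IntervalIntegrable.sum (atMost N n)
      fun x _ => (hpi x a b).const_mul (rate lam x y)
  have heq : ∀ y ∈ atMost N n, ∀ r : ℝ, s ≤ r → p y r = p y s + ∫ u in (s : ℝ)..r,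
      ∑ x ∈ atMost N n, rate lam x y * p x u := by
    intro y hy r hr
    have hr0 : 0 ≤ r := s.2.trans hr
    have := forward_equation hX hmart (t := r.toNNReal) (NNReal.le_toNNReal_of_coe_le hr) hA hy
    rw [Real.coe_toNNReal _ hr0] at this
    simpa [hp] using this
  have hcont : ∀ y ∈ atMost N n, ContinuousOn (p y) (Ici (s : ℝ)) := by
    intro y hy
    have : Continuous fun r => p y s + ∫ u in (s : ℝ)..r,
        ∑ x ∈ atMost N n, rate lam x y * p x u :=
      continuous_const.add (intervalIntegral.continuous_primitive (hsi y) _)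
    exact this.continuousOn.congr fun r hr => heq y hy r hr
  have hder : ∀ y ∈ atMost N n, ∀ r : ℝ, s ≤ r →
      HasDerivWithinAt (p y) (∑ x ∈ atMost N n, rate lam x y * p x r) (Ici r) r := by
    intro y hy r hr
    set g : ℝ → ℝ := fun u => ∑ x ∈ atMost N n, rate lam x y * p x u with hg
    have hgc : ContinuousOn g (Ici (s : ℝ)) :=
      continuousOn_finsetSum _ fun x hx => (hcont x hx).const_smul (rate lam x y)
    have h1 : HasDerivWithinAt (fun r => ∫ u in (s : ℝ)..r, g u) (g r) (Ici r) r := by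
      refine intervalIntegral.integral_hasDerivWithinAt_right
        (hsi y _ _) (t := Ioi r) ?_ ?_
      · exact (Measurable.stronglyMeasurable (by fun_prop)).stronglyMeasurableAtFilter
      · exact (hgc r hr).mono fun u hu => hr.trans (le_of_lt hu)
    refine (h1.const_add (p y s)).congr (fun u hu => heq y hy u (hr.trans hu)) (heq y hy r hr)
  have hconst := constant_of_has_deriv_right_zero (a := (s : ℝ)) (b := t)
    (f := fun r => ∑ y ∈ atMost N n, F r y * p y r) ?_ ?_ t
    (right_mem_Icc.2 (by exact_mod_cast hst))
  · simpa [hp] using hconst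
  · exact continuousOn_finsetSum _ fun y hy => ContinuousOn.mul
      (fun r _ => (hF r y).continuousAt.continuousWithinAt)
      ((hcont y hy).mono Icc_subset_Ici_self)
  · intro r hr
    have h1 := HasDerivWithinAt.fun_sum (u := atMost N n) fun y hy =>
      (hF r y).hasDerivWithinAt.mul (hder y hy r hr.1)
    refine h1.congr_deriv ?_
    rw [Finset.sum_add_distrib]
    have h2 : ∑ y ∈ atMost N n, F r y * ∑ x ∈ atMost N n, rate lam x y * p x r
        = ∑ x ∈ atMost N n, gen lam (F r) x * p x r := by
      simp_rw [Finset.mul_sum]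
      rw [Finset.sum_comm]
      refine Finset.sum_congr rfl fun x hx => ?_
      rw [← sum_rate_mul lam hx, Finset.sum_mul]
      exact Finset.sum_congr rfl fun y _ => by ring
    rw [h2, ← Finset.sum_add_distrib]
    exact Finset.sum_eq_zero fun y _ => by ring

end UrnLaw

/-! ### Multiplicative functionals of the process -/

section UrnLaw

theorem setLIntegral_ofReal_comp {E Ω : Type*} [MeasurableSpace E] [MeasurableSingletonClass E]
    [MeasurableSpace Ω] {P : Measure Ω} [IsFiniteMeasure P] {Y : Ω → E} (hY : Measurable Y)
    (A : Set Ω) (s : Finset E) (hs : ∀ᵐ ω ∂P.restrict A, Y ω ∈ s) {F : E → ℝ}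
    (hF : ∀ y, 0 ≤ F y) :
    ∫⁻ ω in A, ENNReal.ofReal (F (Y ω)) ∂P
      = ENNReal.ofReal (∑ y ∈ s, F y * P.real (A ∩ Y ⁻¹' {y})) := by
  classical
  have h1 : ∀ᵐ ω ∂P.restrict A, ENNReal.ofReal (F (Y ω))
      = ∑ y ∈ s, ENNReal.ofReal (F y) * (Y ⁻¹' {y}).indicator 1 ω := by
    filter_upwards [hs] with ω hω
    rw [Finset.sum_eq_single (Y ω)]
    · simp
    · intro b _ hb
      rw [indicator_of_notMem, mul_zero]
      exact fun h => hb h.symm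
    · exact fun h => absurd hω h
  rw [lintegral_congr_ae h1, lintegral_finsetSum']
  · rw [ENNReal.ofReal_sum_of_nonneg (fun y _ => mul_nonneg (hF y) measureReal_nonneg)]
    refine Finset.sum_congr rfl fun y _ => ?_
    have hm : MeasurableSet (Y ⁻¹' {y}) := hY (measurableSet_singleton y)
    rw [lintegral_const_mul _ (measurable_one.indicator hm), lintegral_indicator_one hm,
      Measure.restrict_apply hm, ENNReal.ofReal_mul (hF y), inter_comm, ofReal_measureReal]
  · intro y _
    exact ((measurable_one.indicator (hY (measurableSet_singleton y))).const_mul _).aemeasurable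

variable {lam : C(I × I, ℝ)} {N : ℕ} {Ω : Type*} [m : MeasurableSpace Ω] {P : Measure Ω}
  {X : ℝ≥0 → Ω → Fin N → ℕ} {ℱ : Filtration ℝ≥0 m}

/-- The martingale problem, relative to a given filtration. -/
def SolvesMartingaleProblem (lam : C(I × I, ℝ)) {N : ℕ} (P : Measure Ω)
    (X : ℝ≥0 → Ω → Fin N → ℕ) (ℱ : Filtration ℝ≥0 m) : Prop :=
  (∀ t, Measurable[ℱ t] (X t)) ∧ ∀ f : (Fin N → ℕ) → ℝ, f.support.Finite →
    Martingale (fun (t : ℝ≥0) ω =>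
      f (X t ω) - f (X 0 ω) - ∫ s in (0 : ℝ)..t, gen lam f (X s.toNNReal ω)) ℱ P

/-- The constant function `1` is harmonic, so the law of the process loses no mass on the
configurations of at most `n` balls. -/
theorem ae_mass_le [IsProbabilityMeasure P] (hX : IsUrnProcess lam N P X)
    (hM : SolvesMartingaleProblem lam P X ℱ) {s t : ℝ≥0} (hst : s ≤ t) :
    ∀ᵐ ω ∂P, mass (X t ω) ≤ mass (X s ω) := by
  have key : ∀ n : ℕ, ∀ᵐ ω ∂P, mass (X s ω) ≤ n → mass (X t ω) ≤ n := by
    intro n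
    set A : Set Ω := {ω | mass (X s ω) ≤ n} with hA
    have hAm : MeasurableSet[ℱ s] A :=
      hM.1 s (Set.to_countable {x : Fin N → ℕ | mass x ≤ n}).measurableSet
    have hAm' : MeasurableSet A := ℱ.le s _ hAm
    have h1 := sum_harmonic_eq hX hM.2 hst hAm n (fun _ _ => 1) (fun r x => by
      have : gen lam (fun _ => (1 : ℝ)) x = 0 := by simp [gen]
      rw [this, neg_zero]; exact hasDerivAt_const r 1)
    have h2 : ∀ u : ℝ≥0, ∑ y ∈ atMost N n, (1 : ℝ) * P.real (A ∩ X u ⁻¹' {y})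
        = P.real (A ∩ {ω | mass (X u ω) ≤ n}) := by
      intro u
      simp_rw [one_mul]
      rw [← measureReal_biUnion_finset]
      · congr 1
        ext ω
        simp [mem_atMost]
      · intro a _ b _ hab
        refine Disjoint.mono inter_subset_right inter_subset_right ?_
        exact Disjoint.preimage _ (by simpa using hab)
      · exact fun y _ => hAm'.inter (hX.measurable u (measurableSet_singleton y))
    rw [h2, h2, inter_eq_left.2 (fun ω h => h : A ⊆ {ω | mass (X s ω) ≤ n})] at h1
    have hBm : MeasurableSet {ω | mass (X t ω) ≤ n} :=
      hX.measurable t (Set.to_countable {x : Fin N → ℕ | mass x ≤ n}).measurableSet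
    have h3 : P.real (A \ {ω | mass (X t ω) ≤ n}) = 0 := by
      have := measureReal_inter_add_sdiff (μ := P) (s := A) hBm
      linarith
    rw [measureReal_eq_zero_iff] at h3
    rw [ae_iff]
    convert h3 using 2
    ext ω; simp [hA]
  filter_upwards [ae_all_iff.2 key] with ω h
  exact h _ le_rfl

/-- Multiplicative functions are transported by the semigroup of a single ball, since the balls
move independently of each other. -/
theorem setLIntegral_mult [IsProbabilityMeasure P] (hX : IsUrnProcess lam N P X)
    (hM : SolvesMartingaleProblem lam P X ℱ) (hpos : ∀ p, 0 < lam p) {s t : ℝ≥0} (hst : s ≤ t)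
    {h : Fin N → ℝ} (hh : 0 ≤ h) {A : Set Ω} (hA : MeasurableSet[ℱ s] A) :
    ∫⁻ ω in A, ENNReal.ofReal (mult h (X t ω)) ∂P
      = ∫⁻ ω in A, ENNReal.ofReal (mult (semi lam N (t - s) h) (X s ω)) ∂P := by
  have hst' : (0 : ℝ) ≤ t - s := sub_nonneg.2 (by exact_mod_cast hst)
  set An : ℕ → Set Ω := fun n => A ∩ {ω | mass (X s ω) ≤ n} with hAn
  have hU : A = ⋃ n, An n := by
    ext ω
    simp only [hAn, mem_iUnion, mem_inter_iff, mem_ofPred_eq, exists_and_left, iff_self_and]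
    exact fun _ => ⟨_, le_rfl⟩
  have hdir : Directed (· ⊆ ·) An := by
    refine directed_of_isDirected_le fun i j hij => ?_
    exact inter_subset_inter_right _ fun ω hω => le_trans hω hij
  rw [hU, setLIntegral_iUnion_of_directed _ hdir, setLIntegral_iUnion_of_directed _ hdir]
  refine iSup_congr fun n => ?_
  have hAm : MeasurableSet[ℱ s] (An n) := MeasurableSet.inter hA
    (hM.1 s (Set.to_countable {x : Fin N → ℕ | mass x ≤ n}).measurableSet)
  have hAm' : MeasurableSet (An n) := ℱ.le s _ hAm
  have h1 : ∀ᵐ ω ∂P.restrict (An n), X t ω ∈ atMost N n := by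
    rw [ae_restrict_iff' hAm']
    filter_upwards [ae_mass_le hX hM hst] with ω h1 h2
    exact mem_atMost.2 (h1.trans h2.2)
  have h2 : ∀ᵐ ω ∂P.restrict (An n), X s ω ∈ atMost N n := by
    rw [ae_restrict_iff' hAm']
    exact Eventually.of_forall fun ω h2 => mem_atMost.2 h2.2
  rw [setLIntegral_ofReal_comp (hX.measurable t) _ _ h1 (mult_nonneg hh),
    setLIntegral_ofReal_comp (hX.measurable s) _ _ h2 (mult_nonneg (semi_nonneg hpos hst' hh))]
  congr 1
  have := sum_harmonic_eq hX hM.2 hst hAm n (fun r x => mult (semi lam N (t - r) h) x)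
    (fun r x => hasDerivAt_mult_semi lam h t r x)
  simpa [semi_zero] using this

theorem measurable_ofReal_mult {t : ℝ≥0} (hX : Measurable (X t)) (h : Fin N → ℝ) :
    Measurable fun ω => ENNReal.ofReal (mult h (X t ω)) :=
  (measurable_of_countable (fun x : Fin N → ℕ => ENNReal.ofReal (mult h x))).comp hX

/-- The Markov property for multiplicative functions, with a weight that depends on the past. -/
theorem lintegral_mul_mult [IsProbabilityMeasure P] (hX : IsUrnProcess lam N P X)
    (hM : SolvesMartingaleProblem lam P X ℱ) (hpos : ∀ p, 0 < lam p) {s t : ℝ≥0} (hst : s ≤ t)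
    {h : Fin N → ℝ} (hh : 0 ≤ h) {Y : Ω → ℝ≥0∞} (hY : Measurable[ℱ s] Y) :
    ∫⁻ ω, Y ω * ENNReal.ofReal (mult h (X t ω)) ∂P
      = ∫⁻ ω, Y ω * ENNReal.ofReal (mult (semi lam N (t - s) h) (X s ω)) ∂P := by
  have hY' : Measurable Y := hY.mono (ℱ.le s) le_rfl
  have hm1 := measurable_ofReal_mult (hX.measurable t) h
  have hm2 := measurable_ofReal_mult (hX.measurable s) (semi lam N (t - s) h)
  have key : (P.withDensity fun ω => ENNReal.ofReal (mult h (X t ω))).trim (ℱ.le s)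
      = (P.withDensity fun ω => ENNReal.ofReal (mult (semi lam N (t - s) h) (X s ω))).trim
        (ℱ.le s) := by
    refine @Measure.ext _ (ℱ s) _ _ fun A hA => ?_
    rw [trim_measurableSet_eq _ hA, trim_measurableSet_eq _ hA,
      withDensity_apply _ (ℱ.le s _ hA), withDensity_apply _ (ℱ.le s _ hA)]
    exact setLIntegral_mult hX hM hpos hst hh hA
  have e1 := lintegral_withDensity_eq_lintegral_mul P hm1 hY'
  have e2 := lintegral_withDensity_eq_lintegral_mul P hm2 hY'
  simp only [Pi.mul_apply, mul_comm _ (Y _)] at e1 e2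
  rw [← e1, ← e2, ← lintegral_trim (ℱ.le s) hY, key, lintegral_trim (ℱ.le s) hY]

end UrnLaw

/-! ### Exponential tilting along a time grid -/

/-- The transition kernel of a single ball over a time step `t`, tilted by `b`: Doob's transform
`semi (b f) / semi b`, a Markov kernel. -/
def kern (lam : C(I × I, ℝ)) (N : ℕ) (t : ℝ) (b f : Fin N → ℝ) : Fin N → ℝ :=
  semi lam N t (b * f) / semi lam N t b

section Tilt

variable {lam : C(I × I, ℝ)} {N : ℕ} {Ω : Type*} {X : ℝ≥0 → Ω → Fin N → ℕ}

theorem kern_nonneg (hpos : ∀ p, 0 < lam p) {t : ℝ} (ht : 0 ≤ t) {b f : Fin N → ℝ}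
    (hb : 0 ≤ b) (hf : 0 ≤ f) : 0 ≤ kern lam N t b f := fun i =>
  div_nonneg (semi_nonneg hpos ht (mul_nonneg hb hf) i) (semi_nonneg hpos ht hb i)

theorem kern_const (hpos : ∀ p, 0 < lam p) {t : ℝ} (ht : 0 ≤ t) {b : Fin N → ℝ}
    (hb : ∀ i, 0 < b i) (c : ℝ) : kern lam N t b (fun _ => c) = fun _ => c := by
  have e : b * (fun _ => c) = c • b := by ext i; simp [mul_comm]
  ext i
  rw [kern, e, map_smul, Pi.div_apply, Pi.smul_apply, smul_eq_mul,
    mul_div_cancel_right₀ _ (semi_pos hpos ht hb i).ne']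

theorem kern_sub (t : ℝ) (b f g : Fin N → ℝ) :
    kern lam N t b (f - g) = kern lam N t b f - kern lam N t b g := by
  ext i
  simp [kern, mul_sub, sub_div]

theorem kern_mono (hpos : ∀ p, 0 < lam p) {t : ℝ} (ht : 0 ≤ t) {b f g : Fin N → ℝ}
    (hb : 0 ≤ b) (h : f ≤ g) : kern lam N t b f ≤ kern lam N t b g := by
  rw [← sub_nonneg, ← kern_sub]
  exact kern_nonneg hpos ht hb (sub_nonneg.2 h)

theorem norm_kern_le (hpos : ∀ p, 0 < lam p) {t : ℝ} (ht : 0 ≤ t) {b : Fin N → ℝ}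
    (hb : ∀ i, 0 < b i) (f : Fin N → ℝ) : ‖kern lam N t b f‖ ≤ ‖f‖ := by
  rw [pi_norm_le_iff_of_nonneg (norm_nonneg f)]
  intro i
  have hb' : ∀ j, |f j| ≤ ‖f‖ := fun j => norm_le_pi_norm f j
  have h1 : f ≤ fun _ => ‖f‖ := fun j => (abs_le.1 (hb' j)).2
  have h2 : (fun _ => -‖f‖) ≤ f := fun j => (abs_le.1 (hb' j)).1
  have h3 := kern_mono hpos ht (fun j => (hb j).le) h1 i
  have h4 := kern_mono hpos ht (fun j => (hb j).le) h2 i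
  rw [kern_const hpos ht hb] at h3 h4
  exact abs_le.2 ⟨h4, h3⟩

/-- The likelihood ratio of the tilted transition over one step of the time grid. -/
def ratio (lam : C(I × I, ℝ)) {N : ℕ} {Ω : Type*} (X : ℝ≥0 → Ω → Fin N → ℕ) (τ : ℕ → ℝ≥0)
    (b : ℕ → Fin N → ℝ) (k : ℕ) (ω : Ω) : ℝ :=
  mult (b (k + 1)) (X (τ (k + 1)) ω) /
    mult (semi lam N (τ (k + 1) - τ k) (b (k + 1))) (X (τ k) ω)

/-- The (unnormalized) likelihood ratio of the law tilted by `a` at the initial time and by `b k` at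
the `k`-th time of the grid, up to the `n`-th time. -/
def tilt (lam : C(I × I, ℝ)) {N : ℕ} {Ω : Type*} (X : ℝ≥0 → Ω → Fin N → ℕ) (τ : ℕ → ℝ≥0)
    (a : Fin N → ℝ) (b : ℕ → Fin N → ℝ) (n : ℕ) (ω : Ω) : ℝ :=
  mult a (X (τ 0) ω) * ∏ k ∈ Finset.range n, ratio lam X τ b k ω

/-- The composition of the tilted kernels of the first `n` steps. -/
def kernIter (lam : C(I × I, ℝ)) (N : ℕ) (τ : ℕ → ℝ≥0) (b : ℕ → Fin N → ℝ) :
    ℕ → (Fin N → ℝ) → Fin N → ℝ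
  | 0, f => f
  | n + 1, f => kernIter lam N τ b n (kern lam N (τ (n + 1) - τ n) (b (n + 1)) f)

variable {τ : ℕ → ℝ≥0} {a : Fin N → ℝ} {b : ℕ → Fin N → ℝ}

theorem tilt_succ (n : ℕ) (ω : Ω) :
    tilt lam X τ a b (n + 1) ω = tilt lam X τ a b n ω * ratio lam X τ b n ω := by
  rw [tilt, Finset.prod_range_succ, ← mul_assoc]; rfl

theorem step_nonneg (hτ : Monotone τ) (k : ℕ) : (0 : ℝ) ≤ τ (k + 1) - τ k :=
  sub_nonneg.2 (by exact_mod_cast hτ (Nat.le_succ k))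

theorem ratio_pos (hpos : ∀ p, 0 < lam p) (hτ : Monotone τ) (hb : ∀ k i, 0 < b k i) (k : ℕ)
    (ω : Ω) : 0 < ratio lam X τ b k ω :=
  div_pos (mult_pos (hb _) _) (mult_pos (semi_pos hpos (step_nonneg hτ k) (hb _)) _)

theorem tilt_pos (hpos : ∀ p, 0 < lam p) (hτ : Monotone τ) (ha : ∀ i, 0 < a i)
    (hb : ∀ k i, 0 < b k i) (n : ℕ) (ω : Ω) : 0 < tilt lam X τ a b n ω :=
  mul_pos (mult_pos ha _) (Finset.prod_pos fun k _ => ratio_pos hpos hτ hb k ω)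

theorem measurable_mult_comp {mΩ : MeasurableSpace Ω} {Y : Ω → Fin N → ℕ} (hY : Measurable[mΩ] Y)
    (c : Fin N → ℝ) : Measurable[mΩ] fun ω => mult c (Y ω) :=
  (measurable_of_countable (mult c)).comp hY

variable [m : MeasurableSpace Ω] {P : Measure Ω} {ℱ : Filtration ℝ≥0 m}

theorem measurable_tilt (hM : SolvesMartingaleProblem lam P X ℱ) (hτ : Monotone τ) (n : ℕ) :
    Measurable[ℱ (τ n)] (tilt lam X τ a b n) := by
  induction n with
  | zero =>
    have e : tilt lam X τ a b 0 = fun ω => mult a (X (τ 0) ω) := by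
      ext ω; simp [tilt]
    rw [e]
    exact measurable_mult_comp (hM.1 _) a
  | succ n ih =>
    have e : tilt lam X τ a b (n + 1) = fun ω => tilt lam X τ a b n ω * ratio lam X τ b n ω := by
      ext ω; exact tilt_succ n ω
    rw [e]
    have hle := ℱ.mono (hτ (Nat.le_succ n))
    exact (ih.mono hle le_rfl).mul ((measurable_mult_comp (hM.1 _) _).div
      ((measurable_mult_comp (hM.1 _) _).mono hle le_rfl))

theorem lintegral_ratio_mul [IsProbabilityMeasure P] (hX : IsUrnProcess lam N P X)
    (hM : SolvesMartingaleProblem lam P X ℱ) (hpos : ∀ p, 0 < lam p) (hτ : Monotone τ)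
    (hb : ∀ k i, 0 < b k i) (n : ℕ) {f : Fin N → ℝ} (hf : 0 ≤ f) {V : Ω → ℝ≥0∞}
    (hV : Measurable[ℱ (τ n)] V) :
    ∫⁻ ω, V ω * ENNReal.ofReal (ratio lam X τ b n ω * mult f (X (τ (n + 1)) ω)) ∂P
      = ∫⁻ ω, V ω * ENNReal.ofReal
        (mult (kern lam N (τ (n + 1) - τ n) (b (n + 1)) f) (X (τ n) ω)) ∂P := by
  set d : ℝ := (τ (n + 1) : ℝ) - τ n with hd
  have hd0 : 0 ≤ d := step_nonneg hτ n
  have hs := semi_pos (N := N) hpos hd0 (hb (n + 1))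
  have hW : Measurable[ℱ (τ n)] fun ω => V ω *
      ENNReal.ofReal (mult (semi lam N d (b (n + 1))) (X (τ n) ω))⁻¹ :=
    hV.mul (ENNReal.measurable_ofReal.comp (measurable_mult_comp (hM.1 _) _).inv)
  have hbf : 0 ≤ b (n + 1) * f := mul_nonneg (fun i => (hb (n + 1) i).le) hf
  have h := lintegral_mul_mult hX hM hpos (hτ (Nat.le_succ n)) hbf hW
  calc _ = _ := lintegral_congr fun ω => ?_
    _ = _ := h
    _ = _ := lintegral_congr fun ω => ?_
  · rw [mul_assoc, ← ENNReal.ofReal_mul (inv_nonneg.2 (mult_pos hs _).le), ratio, mult_mul]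
    congr 2
    field_simp
    rfl
  · rw [mul_assoc, ← ENNReal.ofReal_mul (inv_nonneg.2 (mult_pos hs _).le), kern, mult_div]
    congr 2
    field_simp
    rfl

/-- The tilts are a martingale: for quantities of the past a later tilt may be replaced by an earlier
one. -/
theorem lintegral_tilt_mul [IsProbabilityMeasure P] (hX : IsUrnProcess lam N P X)
    (hM : SolvesMartingaleProblem lam P X ℱ) (hpos : ∀ p, 0 < lam p) (hτ : Monotone τ)
    (ha : ∀ i, 0 < a i) (hb : ∀ k i, 0 < b k i) {k n : ℕ} (hkn : k ≤ n) {V : Ω → ℝ≥0∞}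
    (hV : Measurable[ℱ (τ k)] V) :
    ∫⁻ ω, V ω * ENNReal.ofReal (tilt lam X τ a b n ω) ∂P
      = ∫⁻ ω, V ω * ENNReal.ofReal (tilt lam X τ a b k ω) ∂P := by
  induction n, hkn using Nat.le_induction with
  | base => rfl
  | succ n hn ih =>
    rw [← ih]
    have hW : Measurable[ℱ (τ n)] fun ω => V ω * ENNReal.ofReal (tilt lam X τ a b n ω) :=
      (hV.mono (ℱ.mono (hτ hn)) le_rfl).mul
        (ENNReal.measurable_ofReal.comp (measurable_tilt hM hτ n))
    have h := lintegral_ratio_mul hX hM hpos hτ hb n (f := fun _ => 1) (fun _ => zero_le_one) hW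
    rw [kern_const hpos (step_nonneg hτ n) (hb _)] at h
    simp only [mult, one_pow, Finset.prod_const_one, mul_one, ENNReal.ofReal_one] at h
    rw [← h]
    refine lintegral_congr fun ω => ?_
    rw [tilt_succ, ENNReal.ofReal_mul (tilt_pos hpos hτ ha hb n ω).le, mul_assoc]

/-- Under the tilted law the balls still move independently, with the kernels `kern`. -/
theorem lintegral_tilt_mul_mult [IsProbabilityMeasure P] (hX : IsUrnProcess lam N P X)
    (hM : SolvesMartingaleProblem lam P X ℱ) (hpos : ∀ p, 0 < lam p) (hτ : Monotone τ)
    (ha : ∀ i, 0 < a i) (hb : ∀ k i, 0 < b k i) (n : ℕ) {f : Fin N → ℝ} (hf : 0 ≤ f) :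
    ∫⁻ ω, ENNReal.ofReal (tilt lam X τ a b n ω * mult f (X (τ n) ω)) ∂P
      = ∫⁻ ω, ENNReal.ofReal (mult (a * kernIter lam N τ b n f) (X (τ 0) ω)) ∂P := by
  induction n generalizing f with
  | zero =>
    refine lintegral_congr fun ω => ?_
    simp [tilt, kernIter, mult_mul]
  | succ n ih =>
    rw [kernIter, ← ih (kern_nonneg hpos (step_nonneg hτ n) (fun i => (hb _ i).le) hf)]
    have h := lintegral_ratio_mul hX hM hpos hτ hb n hf
      (ENNReal.measurable_ofReal.comp (measurable_tilt (a := a) (b := b) hM hτ n))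
    calc _ = _ := lintegral_congr fun ω => ?_
      _ = _ := h
      _ = _ := lintegral_congr fun ω => ?_
    · rw [tilt_succ, mul_assoc, ENNReal.ofReal_mul (tilt_pos hpos hτ ha hb n ω).le]; rfl
    · rw [ENNReal.ofReal_mul (tilt_pos hpos hτ ha hb n ω).le]; rfl

/-! ### Poisson initial condition -/

theorem lintegral_pow_poissonMeasure (r : ℝ≥0) {c : ℝ} (hc : 0 ≤ c) :
    ∫⁻ k, ENNReal.ofReal (c ^ k) ∂poissonMeasure r = ENNReal.ofReal (Real.exp (r * (c - 1))) := by
  rw [poissonMeasure, lintegral_sum_measure]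
  have h1 : ∀ k : ℕ, ∫⁻ x, ENNReal.ofReal (c ^ x)
      ∂(ENNReal.ofReal (Real.exp (-r) * r ^ k / k.factorial) • Measure.dirac k)
      = ENNReal.ofReal (Real.exp (-r) * ((r * c) ^ k / k.factorial)) := by
    intro k
    rw [lintegral_smul_measure, lintegral_dirac, smul_eq_mul, ← ENNReal.ofReal_mul (by positivity)]
    congr 1
    rw [mul_pow]; ring
  simp_rw [h1]
  have h2 := (NormedSpace.expSeries_div_hasSum_exp ((r : ℝ) * c)).mul_left (Real.exp (-r))
  rw [← ENNReal.ofReal_tsum_of_nonneg (fun k => by positivity) h2.summable, h2.tsum_eq,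
    ← congrFun Real.exp_eq_exp_ℝ, ← Real.exp_add]
  congr 2; ring

/-- The joint generating function of the independent Poisson variables. -/
theorem lintegral_mult_initial {φ : C(I, ℝ)} (hφ : ∀ x, 0 ≤ φ x) {Y : Ω → Fin N → ℕ}
    (hY : Measurable Y) (h : IsPoissonInitial φ N P Y) {c : Fin N → ℝ} (hc : 0 ≤ c) :
    ∫⁻ ω, ENNReal.ofReal (mult c (Y ω)) ∂P
      = ENNReal.ofReal (Real.exp (∑ i, φ (node i) * (c i - 1))) := by
  have hYi : ∀ i, Measurable fun ω => Y ω i := fun i => (measurable_pi_apply i).comp hY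
  have h1 := lintegral_prod_eq_prod_lintegral_of_indepFun Finset.univ
    (fun i ω => ENNReal.ofReal (c i ^ Y ω i))
    (h.1.comp (fun i k => ENNReal.ofReal (c i ^ k)) (fun i => measurable_of_countable _))
    (fun i => (measurable_of_countable fun k : ℕ => ENNReal.ofReal (c i ^ k)).comp (hYi i))
  have h2 : ∀ i, ∫⁻ ω, ENNReal.ofReal (c i ^ Y ω i) ∂P
      = ENNReal.ofReal (Real.exp (φ (node i) * (c i - 1))) := by
    intro i
    have h3 := lintegral_map (μ := P) (f := fun k : ℕ => ENNReal.ofReal (c i ^ k))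
      (measurable_of_countable _) (hYi i)
    rw [← h3, h.2 i, lintegral_pow_poissonMeasure _ (hc i), Real.coe_toNNReal _ (hφ _)]
  simp_rw [h2] at h1
  rw [Real.exp_sum, ENNReal.ofReal_prod_of_nonneg (fun i _ => (Real.exp_pos _).le), ← h1]
  refine lintegral_congr fun ω => ?_
  rw [mult, ENNReal.ofReal_prod_of_nonneg (fun i _ => pow_nonneg (hc i) _)]

end Tilt

/-! ### Oscillations of the process -/

/-- The exponential cost per ball of comparing `exp (θ f)` with its image under the semigroup over a
time `d`, when `|f| ≤ 1`. -/
def oscRate (lam : C(I × I, ℝ)) (θ d : ℝ) : ℝ :=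
  d * ‖lam‖ + Real.exp (2 * θ) *
    (d * (2 * ‖lam‖) + d ^ 2 * (2 * ‖lam‖) ^ 2 * Real.exp (d * (2 * ‖lam‖)))

theorem tendsto_oscRate (lam : C(I × I, ℝ)) (θ : ℝ) :
    Tendsto (oscRate lam θ) (𝓝 0) (𝓝 0) := by
  have h : Continuous (oscRate lam θ) := by unfold oscRate; fun_prop
  simpa [oscRate] using h.tendsto 0

theorem semi_exp_le {lam : C(I × I, ℝ)} {N : ℕ} {f : Fin N → ℝ} (hf : ∀ i, |f i| ≤ 1) {θ d : ℝ}
    (hθ : 0 ≤ θ) (hd : 0 ≤ d) (i : Fin N) :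
    semi lam N d (fun j => Real.exp (θ * f j)) i
      ≤ Real.exp (θ * f i + (oscRate lam θ d - d * ‖lam‖)) := by
  set b : Fin N → ℝ := fun j => Real.exp (θ * f j) with hb
  have hbn : ‖b‖ ≤ Real.exp θ := by
    rw [pi_norm_le_iff_of_nonneg (Real.exp_pos _).le]
    intro j
    rw [Real.norm_of_nonneg (Real.exp_pos _).le]
    exact Real.exp_le_exp.2 (mul_le_of_le_one_right hθ (abs_le.1 (hf j)).2)
  have hbi : Real.exp (-θ) ≤ b i := by
    refine Real.exp_le_exp.2 ?_
    nlinarith [(abs_le.1 (hf i)).1]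
  set w : ℝ := d * (2 * ‖lam‖) + d ^ 2 * (2 * ‖lam‖) ^ 2 * Real.exp (d * (2 * ‖lam‖)) with hw
  have hw0 : 0 ≤ w := by positivity
  have h1 : ‖semi lam N d b - b‖ ≤ w * Real.exp θ := by
    have e : semi lam N d b - b = (semi lam N d b - b - d • jumpOp lam N b) + d • jumpOp lam N b := by
      abel
    rw [e]
    refine (norm_add_le _ _).trans ?_
    have h2 := norm_semi_sub_sub_le (lam := lam) hd b
    have h3 : ‖d • jumpOp lam N b‖ ≤ d * (2 * ‖lam‖) * ‖b‖ := by
      rw [norm_smul, Real.norm_of_nonneg hd, mul_assoc]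
      gcongr
      exact (jumpOp lam N).le_of_opNorm_le norm_jumpOp_le b
    calc _ ≤ w * ‖b‖ := by rw [hw, add_mul]; linarith
      _ ≤ _ := by gcongr
  have h2 : semi lam N d b i ≤ b i + w * Real.exp θ := by
    have := (norm_le_pi_norm (semi lam N d b - b) i).trans h1
    rw [Real.norm_eq_abs, Pi.sub_apply] at this
    linarith [(abs_le.1 this).2]
  have h3 : w * Real.exp θ ≤ b i * (Real.exp (2 * θ) * w) := by
    have : Real.exp θ = Real.exp (-θ) * Real.exp (2 * θ) := by rw [← Real.exp_add]; ring_nf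
    rw [this]
    have h4 := mul_le_mul_of_nonneg_right hbi (mul_nonneg (Real.exp_pos (2 * θ)).le hw0)
    linarith
  have e : oscRate lam θ d - d * ‖lam‖ = Real.exp (2 * θ) * w := by rw [oscRate]; ring
  rw [e, Real.exp_add]
  have h5 := Real.add_one_le_exp (Real.exp (2 * θ) * w)
  have h6 : 0 < b i := Real.exp_pos _
  have h7 := mul_le_mul_of_nonneg_left h5 h6.le
  have h8 : b i = Real.exp (θ * f i) := rfl
  rw [← h8]
  linarith

section Oscillation

variable {lam : C(I × I, ℝ)} {N : ℕ} {Ω : Type*} [m : MeasurableSpace Ω] {P : Measure Ω}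
  {X : ℝ≥0 → Ω → Fin N → ℕ} {ℱ : Filtration ℝ≥0 m}

/-- The total number of balls never exceeds its initial value. -/
theorem ae_forall_mass_le [IsProbabilityMeasure P] (hX : IsUrnProcess lam N P X)
    (hM : SolvesMartingaleProblem lam P X ℱ) :
    ∀ᵐ ω ∂P, ∀ t, mass (X t ω) ≤ mass (X 0 ω) := by
  have h : ∀ p : ℕ × ℕ, ∀ᵐ ω ∂P,
      mass (X (((p.1 : ℝ≥0) + 1) / ((p.2 : ℝ≥0) + 1)) ω) ≤ mass (X 0 ω) :=
    fun p => ae_mass_le hX hM zero_le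
  filter_upwards [ae_all_iff.2 h] with ω hω t
  obtain ⟨k, hk⟩ := ((tendsto_discretize t).eventually ((hX.cadlag ω).eventually_eq t)).exists
  rw [← hk]
  exact hω (_, k)

/-- Doob's maximal inequality for the positive martingale `s ↦ mult (semi (v - s) h) (X s)`. -/
theorem measure_exists_le_mult_le [IsProbabilityMeasure P] (hX : IsUrnProcess lam N P X)
    (hM : SolvesMartingaleProblem lam P X ℱ) (hpos : ∀ p, 0 < lam p) {h : Fin N → ℝ}
    (hh : ∀ i, 0 < h i) {u v : ℝ≥0} (huv : u ≤ v) {τ : ℕ → ℝ≥0} (hτ : Monotone τ)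
    (hτu : ∀ l, u ≤ τ l) (hτv : ∀ l, τ l ≤ v) {c : ℝ} (hc : 0 < c) :
    P {ω | ∃ l, c * mult (semi lam N (v - u) h) (X u ω)
      ≤ mult (semi lam N (v - τ l) h) (X (τ l) ω)} ≤ ENNReal.ofReal c⁻¹ := by
  have hnn : ∀ {s : ℝ≥0}, s ≤ v → (0 : ℝ) ≤ v - s := fun hs =>
    sub_nonneg.2 (by exact_mod_cast hs)
  set Z : ℝ≥0 → Ω → ℝ := fun s ω => mult (semi lam N (v - s) h) (X s ω) with hZ
  have hZpos : ∀ s ≤ v, ∀ ω, 0 < Z s ω := fun s hs ω =>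
    mult_pos (semi_pos hpos (hnn hs) hh) _
  have hZm : ∀ s, Measurable[ℱ s] (Z s) := fun s => measurable_mult_comp (hM.1 s) _
  set A : ℕ → Set Ω := fun l => {ω | c * Z u ω ≤ Z (τ l) ω} with hA
  have hAm : ∀ l, MeasurableSet[ℱ (τ l)] (A l) := fun l =>
    @measurableSet_le _ _ _ _ _ (ℱ (τ l)) _ _ _ _ _
      (((hZm u).mono (ℱ.mono (hτu l)) le_rfl).const_mul c) (hZm _)
  -- the events of a first passage at the `l`-th time
  set B : ℕ → Set Ω := fun l => A l \ ⋃ k ∈ Finset.range l, A k with hB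
  have hBm : ∀ l, MeasurableSet[ℱ (τ l)] (B l) := fun l =>
    MeasurableSet.diff (hAm l) (Finset.measurableSet_biUnion _ fun k hk =>
      ℱ.mono (hτ (Finset.mem_range.1 hk).le) _ (hAm k))
  have hBm' : ∀ l, MeasurableSet (B l) := fun l => ℱ.le _ _ (hBm l)
  have hUB : {ω | ∃ l, c * Z u ω ≤ Z (τ l) ω} = ⋃ l, B l := by
    classical
    ext ω
    constructor
    · intro hω
      refine mem_iUnion.2 ⟨Nat.find hω, Nat.find_spec hω, ?_⟩
      simp only [mem_iUnion, not_exists]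
      exact fun k hk => Nat.find_min hω (Finset.mem_range.1 hk)
    · intro hω
      obtain ⟨l, hl⟩ := mem_iUnion.1 hω
      exact ⟨l, hl.1⟩
  have hdisj : Pairwise (Function.onFun Disjoint B) := by
    intro i j hij
    rw [Function.onFun, Set.disjoint_left]
    rintro ω ⟨h1, h2⟩ ⟨h3, h4⟩
    simp only [mem_iUnion, not_exists] at h2 h4
    rcases lt_or_gt_of_ne hij with hlt | hlt
    · exact h4 i (Finset.mem_range.2 hlt) h1
    · exact h2 j (Finset.mem_range.2 hlt) h3
  have hY : ∀ l, Measurable[ℱ (τ l)] fun ω =>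
      (B l).indicator (fun _ => (1 : ℝ≥0∞)) ω * ENNReal.ofReal (Z u ω)⁻¹ := fun l =>
    ((measurable_const).indicator (hBm l)).mul (ENNReal.measurable_ofReal.comp
      ((hZm u).mono (ℱ.mono (hτu l)) le_rfl).inv)
  have hstep : ∀ l, ENNReal.ofReal c * P (B l)
      ≤ ∫⁻ ω in B l, ENNReal.ofReal (Z u ω)⁻¹ * ENNReal.ofReal (mult h (X v ω)) ∂P := by
    intro l
    have h1 := lintegral_mul_mult hX hM hpos (hτv l) (fun i => (hh i).le) (hY l)
    calc ENNReal.ofReal c * P (B l) = ∫⁻ ω in B l, ENNReal.ofReal c ∂P := by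
          rw [setLIntegral_const]
      _ ≤ ∫⁻ ω in B l, ENNReal.ofReal (Z u ω)⁻¹ * ENNReal.ofReal (Z (τ l) ω) ∂P := by
          refine setLIntegral_mono' (hBm' l) fun ω hω => ?_
          rw [← ENNReal.ofReal_mul (inv_nonneg.2 (hZpos u huv ω).le)]
          refine ENNReal.ofReal_le_ofReal ?_
          rw [le_inv_mul_iff₀ (hZpos u huv ω), mul_comm]
          exact hω.1
      _ = _ := by
          rw [← lintegral_indicator (hBm' l), ← lintegral_indicator (hBm' l)]
          calc _ = _ := lintegral_congr fun ω => ?_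
            _ = _ := h1.symm
            _ = _ := lintegral_congr fun ω => ?_
          · by_cases hω : ω ∈ B l <;> simp [hω, hZ]
          · by_cases hω : ω ∈ B l <;> simp [hω]
  have htot : ∫⁻ ω, ENNReal.ofReal (Z u ω)⁻¹ * ENNReal.ofReal (mult h (X v ω)) ∂P = 1 := by
    rw [lintegral_mul_mult hX hM hpos huv (fun i => (hh i).le)
      (Y := fun ω => ENNReal.ofReal (Z u ω)⁻¹) (ENNReal.measurable_ofReal.comp (hZm u).inv)]
    calc _ = ∫⁻ _, 1 ∂P := lintegral_congr fun ω => ?_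
      _ = 1 := by simp
    rw [← ENNReal.ofReal_mul (inv_nonneg.2 (hZpos u huv ω).le),
      inv_mul_cancel₀ (hZpos u huv ω).ne', ENNReal.ofReal_one]
  have hsum : ENNReal.ofReal c * P (⋃ l, B l) ≤ 1 := by
    rw [measure_iUnion hdisj hBm', ← ENNReal.tsum_mul_left, ← htot]
    refine (ENNReal.tsum_le_tsum hstep).trans ?_
    rw [← lintegral_iUnion hBm' hdisj]
    exact setLIntegral_le_lintegral _ _
  rw [hUB, ENNReal.ofReal_inv_of_pos hc]
  rw [ENNReal.le_inv_iff_mul_le, mul_comm]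
  exact hsum

/-- An exponential bound for the displacement in a fixed direction `f`. On the event the positive
martingale `s ↦ mult (semi (v - s) (exp (θ f))) (X s)` grows by the factor `exp (θ r)`, up to the
errors collected in `oscRate`. -/
theorem measure_osc_direction_le [IsProbabilityMeasure P] (hX : IsUrnProcess lam N P X)
    (hM : SolvesMartingaleProblem lam P X ℱ) (hpos : ∀ p, 0 < lam p) {f : Fin N → ℝ}
    (hf : ∀ i, |f i| ≤ 1) {θ : ℝ} (hθ : 0 ≤ θ) {u v : ℝ≥0} (huv : u ≤ v) (n : ℕ) (r : ℝ) :
    P {ω | mass (X u ω) ≤ n ∧ ∃ s ∈ Icc u v, mass (X s ω) ≤ n ∧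
        r ≤ ∑ i, f i * ((X s ω i : ℝ) - X u ω i)}
      ≤ ENNReal.ofReal (Real.exp (n * oscRate lam θ (v - u) - θ * r)) := by
  set d : ℝ := (v : ℝ) - u with hd
  have hd0 : 0 ≤ d := sub_nonneg.2 (by exact_mod_cast huv)
  set h : Fin N → ℝ := fun i => Real.exp (θ * f i) with hh
  set c : ℝ := Real.exp (θ * r - n * oscRate lam θ d) with hc
  have hmass : ∀ x : Fin N → ℕ, mass x ≤ n → ∀ κ : ℝ, 0 ≤ κ → ∑ i, (x i : ℝ) * κ ≤ n * κ := by
    intro x hx κ hκ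
    rw [← Finset.sum_mul]
    refine mul_le_mul_of_nonneg_right ?_ hκ
    exact_mod_cast hx
  have key : ∀ ω, mass (X u ω) ≤ n → ∀ s ∈ Icc u v, mass (X s ω) ≤ n →
      r ≤ ∑ i, f i * ((X s ω i : ℝ) - X u ω i) →
      c * mult (semi lam N (v - u) h) (X u ω) ≤ mult (semi lam N (v - s) h) (X s ω) := by
    intro ω hu s hs hms hr
    have hvs : (0 : ℝ) ≤ v - s := sub_nonneg.2 (by exact_mod_cast hs.2)
    have hκ0 : 0 ≤ oscRate lam θ d - d * ‖lam‖ := by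
      rw [oscRate, add_sub_cancel_left]; positivity
    have h1 : mult (semi lam N (v - u) h) (X u ω)
        ≤ Real.exp (∑ i, X u ω i * (θ * f i + (oscRate lam θ d - d * ‖lam‖))) := by
      rw [← mult_exp]
      exact mult_mono (semi_nonneg hpos hd0 fun i => (Real.exp_pos _).le)
        (fun i => semi_exp_le hf hθ hd0 i) _
    have h2 : Real.exp (∑ i, X s ω i * (θ * f i - d * ‖lam‖))
        ≤ mult (semi lam N (v - s) h) (X s ω) := by
      rw [← mult_exp]
      refine mult_mono (fun i => (Real.exp_pos _).le) (fun i => ?_) _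
      refine le_trans ?_ (exp_smul_le_semi hpos hvs h (fun i => (Real.exp_pos _).le) i)
      rw [Pi.smul_apply, smul_eq_mul, hh, ← Real.exp_add]
      refine Real.exp_le_exp.2 ?_
      have : (v - s : ℝ) * ‖lam‖ ≤ d * ‖lam‖ := by
        have : (u : ℝ) ≤ s := by exact_mod_cast hs.1
        gcongr
        linarith
      linarith
    refine (mul_le_mul_of_nonneg_left h1 (Real.exp_pos _).le).trans (le_trans ?_ h2)
    rw [← Real.exp_add]
    refine Real.exp_le_exp.2 ?_
    have h3 := hmass _ hu _ hκ0
    have h4 := hmass _ hms (d * ‖lam‖) (by positivity)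
    simp only [mul_add, mul_sub, Finset.sum_add_distrib, Finset.sum_sub_distrib] at h3 h4 hr ⊢
    have e1 : ∀ x : Fin N → ℕ, ∑ i, (x i : ℝ) * (θ * f i) = θ * ∑ i, f i * x i := by
      intro x
      rw [Finset.mul_sum]
      exact Finset.sum_congr rfl fun i _ => by ring
    rw [e1, e1]
    nlinarith [mul_le_mul_of_nonneg_left hr hθ]
  -- by right-continuity it suffices to look at the times of fine lattices
  set τ : ℕ → ℕ → ℝ≥0 := fun p l => max u (min v (((l : ℝ≥0) + 1) / ((p : ℝ≥0) + 1))) with hτ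
  set D : ℕ → Set Ω := fun p => {ω | ∃ l, c * mult (semi lam N (v - u) h) (X u ω)
      ≤ mult (semi lam N (v - τ p l) h) (X (τ p l) ω)} with hD
  have hDle : ∀ p, P (D p) ≤ ENNReal.ofReal c⁻¹ := by
    intro p
    refine measure_exists_le_mult_le hX hM hpos (fun i => Real.exp_pos _) huv ?_
      (fun l => le_max_left _ _) (fun l => max_le huv (min_le_left _ _)) (Real.exp_pos _)
    intro i j hij
    change max u (min v _) ≤ max u (min v _)
    gcongr
  have hsub : {ω | mass (X u ω) ≤ n ∧ ∃ s ∈ Icc u v, mass (X s ω) ≤ n ∧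
      r ≤ ∑ i, f i * ((X s ω i : ℝ) - X u ω i)} ⊆ ⋃ q, ⋂ p ≥ q, D p := by
    rintro ω ⟨hu, s, hs, hms, hr⟩
    suffices h : ∀ᶠ p in atTop, ω ∈ D p by
      obtain ⟨q, hq⟩ := eventually_atTop.1 h
      exact mem_iUnion.2 ⟨q, mem_iInter₂.2 hq⟩
    rcases hs.2.eq_or_lt with rfl | hlt
    · refine Eventually.of_forall fun p => ?_
      obtain ⟨l, hl⟩ := exists_nat_ge (s * ((p : ℝ≥0) + 1))
      have e : τ p l = s := by
        have : s ≤ ((l : ℝ≥0) + 1) / ((p : ℝ≥0) + 1) := by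
          rw [le_div_iff₀ (by positivity)]
          exact hl.trans (le_add_of_nonneg_right zero_le_one)
        simp only [hτ]
        rw [min_eq_left this, max_eq_right hs.1]
      refine ⟨l, ?_⟩
      rw [e]
      exact key ω hu s hs hms hr
    · have h1 := (tendsto_discretize s).eventually ((hX.cadlag ω).eventually_eq s)
      have h2 := (tendsto_discretize s).eventually
        ((eventually_lt_nhds hlt).filter_mono nhdsWithin_le_nhds)
      have h3 := (tendsto_discretize s).eventually (eventually_mem_nhdsWithin)
      filter_upwards [h1, h2, h3] with p hp1 hp2 hp3
      set s' := (((⌊((p : ℝ≥0) + 1) * s⌋₊ : ℝ≥0) + 1) / ((p : ℝ≥0) + 1)) with hs'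
      have e : τ p ⌊((p : ℝ≥0) + 1) * s⌋₊ = s' := by
        simp only [hτ]
        rw [← hs', min_eq_right hp2.le, max_eq_right (hs.1.trans (le_of_lt hp3))]
      refine ⟨⌊((p : ℝ≥0) + 1) * s⌋₊, ?_⟩
      rw [e]
      refine key ω hu s' ⟨hs.1.trans (le_of_lt hp3), hp2.le⟩ ?_ ?_
      · rw [hp1]; exact hms
      · rw [hp1]; exact hr
  have hmono : Monotone fun q => ⋂ p ≥ q, D p := by
    intro i j hij ω hω
    simp only [mem_iInter] at hω ⊢
    exact fun p hp => hω p (le_trans hij hp)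
  calc _ ≤ P (⋃ q, ⋂ p ≥ q, D p) := measure_mono hsub
    _ = ⨆ q, P (⋂ p ≥ q, D p) := hmono.measure_iUnion
    _ ≤ ENNReal.ofReal c⁻¹ := iSup_le fun q =>
        (measure_mono (iInter₂_subset q le_rfl)).trans (hDle q)
    _ = _ := by rw [hc, ← Real.exp_neg, neg_sub]

end Oscillation

/-! ### Oscillations along a time grid -/

/-- The `k`-th time of the grid of mesh `T / m`. -/
def grid (T : ℝ) (m k : ℕ) : ℝ≥0 := (k * T / m).toNNReal

theorem coe_grid {T : ℝ} (hT : 0 < T) (m k : ℕ) : (grid T m k : ℝ) = k * T / m :=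
  Real.coe_toNNReal _ (by positivity)

theorem grid_monotone {T : ℝ} (hT : 0 < T) (m : ℕ) : Monotone (grid T m) := by
  intro i j hij
  refine Real.toNNReal_le_toNNReal ?_
  gcongr

theorem grid_zero (T : ℝ) (m : ℕ) : grid T m 0 = 0 := by simp [grid]

theorem grid_step {T : ℝ} (hT : 0 < T) (m k : ℕ) :
    (grid T m (k + 1) : ℝ) - grid T m k = T / m := by
  rw [coe_grid hT, coe_grid hT]
  push_cast
  ring

theorem exists_grid_mem {T : ℝ} (hT : 0 < T) {m : ℕ} (hm : 0 < m) {s : ℝ} (hs : 0 ≤ s)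
    (hsT : s ≤ T) : ∃ k < m, (grid T m k : ℝ) ≤ s ∧ s ≤ grid T m (k + 1) := by
  have hm' : (0 : ℝ) < m := by exact_mod_cast hm
  rcases hsT.eq_or_lt with rfl | hlt
  · refine ⟨m - 1, by omega, ?_, ?_⟩
    · rw [coe_grid hT, div_le_iff₀ hm', mul_comm]
      gcongr
      omega
    · rw [coe_grid hT, Nat.sub_add_cancel hm, mul_div_cancel_left₀ _ hm'.ne']
  · have h0 : 0 ≤ s * m / T := by positivity
    have h1 := Nat.floor_le h0
    have h2 := Nat.lt_floor_add_one (s * m / T)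
    rw [le_div_iff₀ hT] at h1
    rw [div_lt_iff₀ hT] at h2
    refine ⟨⌊s * m / T⌋₊, ?_, ?_, ?_⟩
    · rw [Nat.floor_lt h0, div_lt_iff₀ hT, mul_comm]
      gcongr
    · rw [coe_grid hT, div_le_iff₀ hm']
      exact h1
    · rw [coe_grid hT, le_div_iff₀ hm']
      push_cast
      exact h2.le

/-- The `ℓ¹` distance of two configurations. -/
def dist1 {N : ℕ} (x y : Fin N → ℕ) : ℝ := ∑ i, |(x i : ℝ) - y i|

theorem dist1_comm {N : ℕ} (x y : Fin N → ℕ) : dist1 x y = dist1 y x :=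
  Finset.sum_congr rfl fun _ _ => abs_sub_comm _ _

theorem dist1_triangle {N : ℕ} (x y z : Fin N → ℕ) : dist1 x z ≤ dist1 x y + dist1 y z := by
  rw [dist1, dist1, dist1, ← Finset.sum_add_distrib]
  exact Finset.sum_le_sum fun i _ => abs_sub_le _ _ _

section Oscillation

variable {lam : C(I × I, ℝ)} {N : ℕ} {Ω : Type*} [mΩ : MeasurableSpace Ω] {P : Measure Ω}
  {X : ℝ≥0 → Ω → Fin N → ℕ} {ℱ : Filtration ℝ≥0 mΩ}

/-- The `ℓ¹` distance is the maximum over the `2 ^ N` directions with entries `±1`; their number is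
only exponential in `N`. -/
theorem measure_osc_le [IsProbabilityMeasure P] (hX : IsUrnProcess lam N P X)
    (hM : SolvesMartingaleProblem lam P X ℱ) (hpos : ∀ p, 0 < lam p) {θ : ℝ} (hθ : 0 ≤ θ)
    {u v : ℝ≥0} (huv : u ≤ v) (n : ℕ) (r : ℝ) :
    P {ω | mass (X u ω) ≤ n ∧ ∃ s ∈ Icc u v, mass (X s ω) ≤ n ∧ r ≤ dist1 (X s ω) (X u ω)}
      ≤ ENNReal.ofReal (Real.exp (N * Real.log 2 + (n * oscRate lam θ (v - u) - θ * r))) := by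
  set f : (Fin N → Bool) → Fin N → ℝ := fun e i => if e i then 1 else -1 with hf
  have hf1 : ∀ e i, |f e i| ≤ 1 := fun e i => by simp only [hf]; split_ifs <;> simp
  have hsub : {ω | mass (X u ω) ≤ n ∧ ∃ s ∈ Icc u v, mass (X s ω) ≤ n ∧
      r ≤ dist1 (X s ω) (X u ω)} ⊆ ⋃ e, {ω | mass (X u ω) ≤ n ∧ ∃ s ∈ Icc u v,
        mass (X s ω) ≤ n ∧ r ≤ ∑ i, f e i * ((X s ω i : ℝ) - X u ω i)} := by
    rintro ω ⟨hu, s, hs, hms, hr⟩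
    refine mem_iUnion.2 ⟨fun i => decide (X u ω i ≤ X s ω i), hu, s, hs, hms, hr.trans
      (le_of_eq (Finset.sum_congr rfl fun i _ => ?_))⟩
    simp only [hf, decide_eq_true_eq]
    split_ifs with h
    · rw [one_mul, abs_of_nonneg]
      exact sub_nonneg.2 (by exact_mod_cast h)
    · rw [abs_of_nonpos, neg_one_mul]
      exact sub_nonpos.2 (by exact_mod_cast (not_le.1 h).le)
  refine (measure_mono hsub).trans ((measure_iUnion_fintype_le P _).trans
    ((Finset.sum_le_sum fun e _ =>
      measure_osc_direction_le hX hM hpos (hf1 e) hθ huv n r).trans ?_))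
  rw [Finset.sum_const, nsmul_eq_mul, Real.exp_add, ENNReal.ofReal_mul (Real.exp_pos _).le]
  gcongr
  rw [Finset.card_univ, Fintype.card_fun, Fintype.card_bool, Fintype.card_fin, mul_comm,
    Real.exp_mul, Real.exp_log two_pos, Real.rpow_natCast]
  simp [ENNReal.ofReal_pow]

/-- On the exponential scale, the process does not move by a positive fraction of the balls in a
short time. -/
theorem exists_measure_osc_le (hpos : ∀ p, 0 < lam p) {T : ℝ} (hT : 0 < T) {M ε : ℝ}
    (hM0 : 0 ≤ M) (hε : 0 < ε) (a : ℝ) : ∃ m₀ : ℕ, 0 < m₀ ∧ ∀ m ≥ m₀, ∀ (N : ℕ) (Ω : Type*)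
      [mΩ : MeasurableSpace Ω] (P : Measure Ω) [IsProbabilityMeasure P]
      (X : ℝ≥0 → Ω → Fin N → ℕ) (ℱ : Filtration ℝ≥0 mΩ), IsUrnProcess lam N P X →
      SolvesMartingaleProblem lam P X ℱ →
      P {ω | (mass (X 0 ω) : ℝ) ≤ M * N ∧ ∃ s t : ℝ≥0, s ≤ t ∧ (t : ℝ) ≤ T ∧
        (t : ℝ) ≤ s + T / m ∧ ε * N ≤ dist1 (X s ω) (X t ω)}
      ≤ ENNReal.ofReal (m * Real.exp (-(a * N))) := by
  set θ : ℝ := 3 * (|a| + 1 + Real.log 2) / ε with hθ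
  have hlog : 0 ≤ Real.log 2 := Real.log_nonneg one_le_two
  have hθ0 : 0 ≤ θ := by positivity
  have hlim : Tendsto (fun m : ℕ => M * oscRate lam θ (T / m)) atTop (𝓝 0) := by
    have h1 := (tendsto_oscRate lam θ).comp (tendsto_const_div_atTop_nhds_zero_nat T)
    simpa using h1.const_mul M
  obtain ⟨m₁, hm₁⟩ := eventually_atTop.1 (hlim.eventually (gt_mem_nhds zero_lt_one))
  refine ⟨max m₁ 1, by simp, fun m hm N Ω mΩ P _ X ℱ hX hM => ?_⟩
  have hmpos : 0 < m := lt_of_lt_of_le (by simp) hm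
  have hosc : M * oscRate lam θ (T / m) < 1 := hm₁ m (le_trans (le_max_left _ _) hm)
  set n : ℕ := ⌊M * N⌋₊ with hn
  have hnle : (n : ℝ) ≤ M * N := Nat.floor_le (by positivity)
  -- times at distance at most `T / m` lie in the same or in adjacent grid intervals, hence the
  -- threshold `ε N / 3`
  set bad : ℕ → Set Ω := fun k => {ω | mass (X (grid T m k) ω) ≤ n ∧
    ∃ s ∈ Icc (grid T m k) (grid T m (k + 1)), mass (X s ω) ≤ n ∧
      ε * N / 3 ≤ dist1 (X s ω) (X (grid T m k) ω)} with hbad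
  have hbadle : ∀ k, P (bad k) ≤ ENNReal.ofReal (Real.exp (-(a * N))) := by
    intro k
    refine (measure_osc_le hX hM hpos hθ0 (grid_monotone hT m (Nat.le_succ k)) n _).trans
      (ENNReal.ofReal_le_ofReal (Real.exp_le_exp.2 ?_))
    rw [grid_step hT]
    have h1 : (n : ℝ) * oscRate lam θ (T / m) ≤ N := by
      have h0 : 0 ≤ oscRate lam θ (T / m) := by unfold oscRate; positivity
      calc (n : ℝ) * oscRate lam θ (T / m) ≤ M * N * oscRate lam θ (T / m) := by gcongr
        _ = N * (M * oscRate lam θ (T / m)) := by ring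
        _ ≤ N * 1 := by gcongr
        _ = N := mul_one _
    have h2 : θ * (ε * N / 3) = (|a| + 1 + Real.log 2) * N := by
      rw [hθ]; field_simp
    have h3 : a * N ≤ |a| * N := by gcongr; exact le_abs_self a
    rw [h2]
    linarith
  have hsub : ∀ᵐ ω ∂P, ((mass (X 0 ω) : ℝ) ≤ M * N ∧ ∃ s t : ℝ≥0, s ≤ t ∧ (t : ℝ) ≤ T ∧
      (t : ℝ) ≤ s + T / m ∧ ε * N ≤ dist1 (X s ω) (X t ω)) →
      ω ∈ ⋃ k ∈ Finset.range m, bad k := by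
    filter_upwards [ae_forall_mass_le hX hM] with ω hω
    rintro ⟨h0, s, t, hst, htT, hts, hd⟩
    by_contra hcon
    simp only [mem_iUnion, not_exists, Finset.mem_range] at hcon
    have hmass : ∀ r, mass (X r ω) ≤ n := fun r =>
      (hω r).trans (Nat.le_floor h0)
    have hgood : ∀ k < m, ∀ r ∈ Icc (grid T m k) (grid T m (k + 1)),
        dist1 (X r ω) (X (grid T m k) ω) < ε * N / 3 := by
      intro k hk r hr
      by_contra h
      exact hcon k hk ⟨hmass _, r, hr, hmass _, not_lt.1 h⟩
    have hst' : (s : ℝ) ≤ t := by exact_mod_cast hst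
    obtain ⟨k, hk, h1, h2⟩ := exists_grid_mem hT hmpos s.2 (hst'.trans htT)
    have h1' : grid T m k ≤ s := by exact_mod_cast h1
    have h2' : s ≤ grid T m (k + 1) := by exact_mod_cast h2
    have hs := hgood k hk s ⟨h1', h2'⟩
    have hd1 := dist1_triangle (X s ω) (X (grid T m k) ω) (X t ω)
    rcases le_total t (grid T m (k + 1)) with h3 | h3
    · have ht := hgood k hk t ⟨h1'.trans hst, h3⟩
      rw [dist1_comm] at ht
      linarith [(Nat.cast_nonneg N : (0 : ℝ) ≤ N), mul_nonneg hε.le (Nat.cast_nonneg N : (0 : ℝ) ≤ N)]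
    · have hg := hgood k hk (grid T m (k + 1)) ⟨grid_monotone hT m (Nat.le_succ k), le_rfl⟩
      have hd2 := dist1_triangle (X (grid T m k) ω) (X (grid T m (k + 1)) ω) (X t ω)
      rw [dist1_comm] at hg
      by_cases hk1 : k + 1 < m
      · have h4 : t ≤ grid T m (k + 1 + 1) := by
          have h5 := grid_step hT m (k + 1)
          have : (t : ℝ) ≤ grid T m (k + 1 + 1) := by linarith
          exact_mod_cast this
        have ht := hgood (k + 1) hk1 t ⟨h3, h4⟩
        rw [dist1_comm] at ht
        linarith
      · have h6 : k + 1 = m := by omega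
        have h7 : t = grid T m (k + 1) := by
          refine le_antisymm ?_ h3
          have : (t : ℝ) ≤ grid T m (k + 1) := by
            have hm' : (m : ℝ) ≠ 0 := by exact_mod_cast hmpos.ne'
            rw [coe_grid hT, h6, mul_div_cancel_left₀ _ hm']
            exact htT
          exact_mod_cast this
        rw [h7] at hd hd1
        linarith [mul_nonneg hε.le (Nat.cast_nonneg N : (0 : ℝ) ≤ N)]
  calc _ ≤ P (⋃ k ∈ Finset.range m, bad k) := measure_mono_ae hsub
    _ ≤ ∑ k ∈ Finset.range m, P (bad k) := measure_biUnion_finset_le _ _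
    _ ≤ ∑ k ∈ Finset.range m, ENNReal.ofReal (Real.exp (-(a * N))) :=
        Finset.sum_le_sum fun k _ => hbadle k
    _ = _ := by
        rw [Finset.sum_const, Finset.card_range, nsmul_eq_mul,
          ENNReal.ofReal_mul (Nat.cast_nonneg _), ENNReal.ofReal_natCast]

/-- The number of balls is at most of order `N`, on the exponential scale. -/
theorem measure_mass_gt_le {φ : C(I, ℝ)} (hφ : ∀ x, 0 ≤ φ x) {Y : Ω → Fin N → ℕ}
    (hY : Measurable Y) (h : IsPoissonInitial φ N P Y) (a : ℝ) :
    P {ω | (a + 2 * ‖φ‖) * N < mass (Y ω)} ≤ ENNReal.ofReal (Real.exp (-(a * N))) := by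
  have h1 := lintegral_mult_initial hφ hY h (c := fun _ => Real.exp 1)
    (fun _ => (Real.exp_pos 1).le)
  have h2 : ∀ ω, mult (fun _ => Real.exp 1) (Y ω) = Real.exp (mass (Y ω)) := by
    intro ω
    rw [mult_exp (fun _ => (1 : ℝ))]
    simp [mass]
  simp_rw [h2] at h1
  have hm : Measurable fun ω => ENNReal.ofReal (Real.exp (mass (Y ω))) :=
    (measurable_of_countable fun x : Fin N → ℕ => ENNReal.ofReal (Real.exp (mass x))).comp hY
  have h3 := mul_meas_ge_le_lintegral hm (μ := P) (ENNReal.ofReal (Real.exp ((a + 2 * ‖φ‖) * N)))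
  rw [h1] at h3
  have h4 : ∑ i : Fin N, φ (node i) * (Real.exp 1 - 1) ≤ 2 * ‖φ‖ * N := by
    have he : Real.exp 1 - 1 ≤ 2 := by linarith [Real.exp_one_lt_d9]
    have he0 : 0 ≤ Real.exp 1 - 1 := by linarith [Real.add_one_le_exp (1 : ℝ)]
    calc ∑ i : Fin N, φ (node i) * (Real.exp 1 - 1) ≤ ∑ _i : Fin N, ‖φ‖ * 2 :=
          Finset.sum_le_sum fun i _ => mul_le_mul (φ.apply_le_norm _) he he0 (norm_nonneg _)
      _ = _ := by simp; ring
  have h5 : P {ω | (a + 2 * ‖φ‖) * N < mass (Y ω)} ≤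
      P {ω | ENNReal.ofReal (Real.exp ((a + 2 * ‖φ‖) * N))
        ≤ ENNReal.ofReal (Real.exp (mass (Y ω)))} :=
    measure_mono fun ω hω => ENNReal.ofReal_le_ofReal (Real.exp_le_exp.2 (le_of_lt hω))
  refine h5.trans ?_
  have h6 : ENNReal.ofReal (Real.exp ((a + 2 * ‖φ‖) * N)) ≠ 0 :=
    (ENNReal.ofReal_pos.2 (Real.exp_pos _)).ne'
  rw [mul_comm, ← ENNReal.le_div_iff_mul_le (Or.inl h6) (Or.inl ENNReal.ofReal_ne_top)] at h3
  refine h3.trans ?_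
  rw [← ENNReal.ofReal_div_of_pos (Real.exp_pos _), ← Real.exp_sub]
  refine ENNReal.ofReal_le_ofReal (Real.exp_le_exp.2 ?_)
  linarith

end Oscillation

/-! ### Riemann sums -/

theorem integral_unitInterval_eq (f : C(I, ℝ)) :
    ∫ x : I, f x = ∫ x in (0 : ℝ)..1, IccExtend zero_le_one f x := by
  rw [intervalIntegral.integral_of_le zero_le_one, ← integral_Icc_eq_integral_Ioc,
    ← integral_subtype_comap measurableSet_Icc]
  refine integral_congr_ae (Eventually.of_forall fun x => ?_)
  simp [IccExtend_val]

theorem integrable_of_continuous {f : I → ℝ} (hf : Continuous f) : Integrable f :=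
  hf.integrable_of_hasCompactSupport (HasCompactSupport.of_compactSpace f)

/-- Riemann sums over the boxes converge uniformly. -/
theorem exists_riemann_sum_le {Y : Type*} [PseudoMetricSpace Y] [CompactSpace Y] (Φ : C(Y × I, ℝ))
    {ε : ℝ} (hε : 0 < ε) : ∃ N₀ : ℕ, ∀ N ≥ N₀, ∀ y,
      |1 / (N : ℝ) * ∑ i : Fin N, Φ (y, node i) - ∫ x : I, Φ (y, x)| ≤ ε := by
  have huc := CompactSpace.uniformContinuous_of_continuous Φ.continuous
  obtain ⟨δ, hδ, h⟩ := Metric.uniformContinuous_iff.1 huc ε hε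
  obtain ⟨N₀, hN₀⟩ := exists_nat_gt (1 / δ)
  refine ⟨max N₀ 1, fun N hN y => ?_⟩
  have hNpos : 0 < N := lt_of_lt_of_le (by simp) hN
  have hN' : (0 : ℝ) < N := by exact_mod_cast hNpos
  have hNδ : 1 / (N : ℝ) < δ := by
    rw [one_div_lt hN' hδ]
    exact hN₀.trans_le (by exact_mod_cast le_trans (le_max_left _ _) hN)
  set f : C(I, ℝ) := ⟨fun x => Φ (y, x), by fun_prop⟩ with hf
  have e1 : ∫ x : I, Φ (y, x) = ∫ x in (0 : ℝ)..1, IccExtend zero_le_one f x :=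
    integral_unitInterval_eq f
  set F : ℝ → ℝ := IccExtend zero_le_one f with hF
  have hFc : Continuous F := f.continuous.Icc_extend'
  have e2 : ∫ x in (0 : ℝ)..1, F x
      = ∑ i : Fin N, ∫ x in ((i : ℕ) / N : ℝ)..(((i : ℕ) + 1 : ℕ) / N : ℝ), F x := by
    rw [Fin.sum_univ_eq_sum_range
      (fun i : ℕ => ∫ x in ((i : ℕ) / N : ℝ)..((i + 1 : ℕ) / N : ℝ), F x) N,
      intervalIntegral.sum_integral_adjacent_intervals
        (a := fun i : ℕ => (i / N : ℝ)) (fun k _ => hFc.intervalIntegrable _ _)]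
    simp [hN'.ne']
  rw [e1, e2, Finset.mul_sum, ← Finset.sum_sub_distrib]
  have h3 : ∀ i : Fin N, |1 / (N : ℝ) * Φ (y, node i)
      - ∫ x in ((i : ℕ) / N : ℝ)..(((i : ℕ) + 1 : ℕ) / N : ℝ), F x| ≤ ε * (1 / N) := by
    intro i
    have hle : ((i : ℕ) / N : ℝ) ≤ (((i : ℕ) + 1 : ℕ) / N : ℝ) := by
      push_cast; gcongr; linarith
    have hlen : ((((i : ℕ) + 1 : ℕ) / N : ℝ)) - ((i : ℕ) / N : ℝ) = 1 / N := by
      push_cast; ring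
    have e3 : 1 / (N : ℝ) * Φ (y, node i)
        = ∫ _ in ((i : ℕ) / N : ℝ)..(((i : ℕ) + 1 : ℕ) / N : ℝ), Φ (y, node i) := by
      rw [intervalIntegral.integral_const, hlen, smul_eq_mul]
    rw [e3, ← intervalIntegral.integral_sub (intervalIntegrable_const)
      (hFc.intervalIntegrable _ _)]
    have h4 := intervalIntegral.norm_integral_le_of_norm_le_const (C := ε)
      (a := ((i : ℕ) / N : ℝ)) (b := (((i : ℕ) + 1 : ℕ) / N : ℝ))
      (f := fun x => Φ (y, node i) - F x) (fun x hx => by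
        rw [uIoc_of_le hle] at hx
        have hx0 : 0 ≤ x := le_trans (by positivity) hx.1.le
        have hx1 : x ≤ 1 := by
          refine hx.2.trans ?_
          rw [div_le_one hN']
          exact_mod_cast i.isLt
        have e4 : F x = Φ (y, ⟨x, hx0, hx1⟩) := by
          rw [hF, IccExtend_of_mem _ _ (⟨hx0, hx1⟩ : x ∈ Icc (0 : ℝ) 1)]
          rfl
        rw [e4, ← dist_eq_norm]
        refine (h ?_).le
        rw [Prod.dist_eq, dist_self, max_lt_iff]
        refine ⟨hδ, ?_⟩
        rw [Subtype.dist_eq, Real.dist_eq]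
        have e5 : ((node i : I) : ℝ) = (((i : ℕ) + 1 : ℕ) / N : ℝ) := by
          simp [node]
        rw [e5, abs_of_nonneg (sub_nonneg.2 hx.2)]
        linarith [hx.1])
    rw [hlen, abs_of_nonneg (by positivity)] at h4
    exact h4
  refine (Finset.abs_sum_le_sum_abs _ _).trans ((Finset.sum_le_sum fun i _ => h3 i).trans ?_)
  rw [Finset.sum_const, Finset.card_univ, Fintype.card_fin, nsmul_eq_mul]
  field_simp
  exact le_rfl

/-! ### Short time expansions -/

/-- The nonlinear operator of the `N`-urn process, the discrete counterpart of `B`. -/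
def discB (lam : C(I × I, ℝ)) {N : ℕ} (g : Fin N → ℝ) (i : Fin N) : ℝ :=
  1 / (N : ℝ) * ∑ j, lam (node i, node j) * (Real.exp (g j - g i) - 1)

/-- The generator of a single ball, tilted by `exp g`. -/
def tiltedJump (lam : C(I × I, ℝ)) {N : ℕ} (g f : Fin N → ℝ) (i : Fin N) : ℝ :=
  1 / (N : ℝ) * ∑ j, lam (node i, node j) * Real.exp (g j - g i) * (f j - f i)

section Expansion

variable {lam : C(I × I, ℝ)}

theorem abs_discB_le {N : ℕ} {g : Fin N → ℝ} {R : ℝ} (hg : ∀ i, |g i| ≤ R) (i : Fin N) :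
    |discB lam g i| ≤ ‖lam‖ * (Real.exp (2 * R) + 1) := by
  refine abs_avg_le _ (by positivity) fun j => ?_
  rw [abs_mul]
  have h1 : |lam (node i, node j)| ≤ ‖lam‖ := lam.norm_coe_le_norm _
  have h2 : Real.exp (g j - g i) ≤ Real.exp (2 * R) := Real.exp_le_exp.2 (by
    linarith [(abs_le.1 (hg j)).2, (abs_le.1 (hg i)).1])
  have h3 : |Real.exp (g j - g i) - 1| ≤ Real.exp (2 * R) + 1 := by
    rw [abs_le]
    constructor <;> linarith [Real.exp_pos (g j - g i)]
  gcongr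

theorem abs_tiltedJump_le {N : ℕ} {g : Fin N → ℝ} {R : ℝ} (hg : ∀ i, |g i| ≤ R) (f : Fin N → ℝ)
    (i : Fin N) : |tiltedJump lam g f i| ≤ 2 * ‖lam‖ * Real.exp (2 * R) * ‖f‖ := by
  refine abs_avg_le _ (by positivity) fun j => ?_
  rw [abs_mul, abs_mul, abs_of_pos (Real.exp_pos _)]
  have h1 : |lam (node i, node j)| ≤ ‖lam‖ := lam.norm_coe_le_norm _
  have h2 : Real.exp (g j - g i) ≤ Real.exp (2 * R) := Real.exp_le_exp.2 (by
    linarith [(abs_le.1 (hg j)).2, (abs_le.1 (hg i)).1])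
  have h3 : |f j - f i| ≤ 2 * ‖f‖ := by
    have h4 := norm_le_pi_norm f j
    have h5 := norm_le_pi_norm f i
    simp only [Real.norm_eq_abs] at *
    exact (abs_sub _ _).trans (by linarith)
  calc _ ≤ ‖lam‖ * Real.exp (2 * R) * (2 * ‖f‖) := by gcongr
    _ = _ := by ring

theorem jumpOp_exp_mul {N : ℕ} (g f : Fin N → ℝ) (i : Fin N) :
    jumpOp lam N (fun j => Real.exp (g j) * f j) i
      = Real.exp (g i) * (tiltedJump lam g f i + f i * discB lam g i) := by
  rw [jumpOp_apply, tiltedJump, discB, mul_left_comm (f i), ← mul_add, mul_left_comm,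
    Finset.mul_sum (a := f i), ← Finset.sum_add_distrib, Finset.mul_sum (a := Real.exp (g i))]
  congr 1
  refine Finset.sum_congr rfl fun j _ => ?_
  have : Real.exp (g j) = Real.exp (g i) * Real.exp (g j - g i) := by
    rw [← Real.exp_add]; ring_nf
  rw [this]; ring

/-- The second order expansion of the semigroup on `exp g * f`, conjugated by `exp g`. -/
theorem semi_exp_mul_sub_le {N : ℕ} {g : Fin N → ℝ} {R : ℝ} (hg : ∀ i, |g i| ≤ R)
    (f : Fin N → ℝ) {d : ℝ} (hd : 0 ≤ d) (hd1 : d ≤ 1) (i : Fin N) :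
    |Real.exp (-g i) * semi lam N d (fun j => Real.exp (g j) * f j) i - f i
        - d * (tiltedJump lam g f i + f i * discB lam g i)|
      ≤ (2 * ‖lam‖) ^ 2 * Real.exp (2 * ‖lam‖) * Real.exp (2 * R) * d ^ 2 * ‖f‖ := by
  set h : Fin N → ℝ := fun j => Real.exp (g j) * f j with hh
  have hR : 0 ≤ R := (abs_nonneg _).trans (hg i)
  have h1 := (norm_le_pi_norm (semi lam N d h - h - d • jumpOp lam N h) i).trans
    (norm_semi_sub_sub_le hd h)
  have hhn : ‖h‖ ≤ Real.exp R * ‖f‖ := by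
    rw [pi_norm_le_iff_of_nonneg (by positivity)]
    intro j
    rw [hh, Real.norm_eq_abs, abs_mul, abs_of_pos (Real.exp_pos _)]
    have h2 := norm_le_pi_norm f j
    rw [Real.norm_eq_abs] at h2
    have h3 : Real.exp (g j) ≤ Real.exp R := Real.exp_le_exp.2 (abs_le.1 (hg j)).2
    gcongr
  have e : Real.exp (-g i) * semi lam N d h i - f i
        - d * (tiltedJump lam g f i + f i * discB lam g i)
      = Real.exp (-g i) * (semi lam N d h - h - d • jumpOp lam N h) i := by
    have h4 : Real.exp (-g i) * Real.exp (g i) = 1 := by rw [← Real.exp_add]; simp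
    rw [Pi.sub_apply, Pi.sub_apply, Pi.smul_apply, smul_eq_mul, jumpOp_exp_mul]
    have h5 : h i = Real.exp (g i) * f i := rfl
    rw [h5]
    linear_combination (f i + d * (tiltedJump lam g f i + f i * discB lam g i)) * h4
  rw [e, abs_mul, abs_of_pos (Real.exp_pos _)]
  rw [Real.norm_eq_abs] at h1
  have h6 : Real.exp (-g i) ≤ Real.exp R := Real.exp_le_exp.2 (by linarith [(abs_le.1 (hg i)).1])
  have h7 : Real.exp (d * (2 * ‖lam‖)) ≤ Real.exp (2 * ‖lam‖) := Real.exp_le_exp.2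
    (mul_le_of_le_one_left (by positivity) hd1)
  calc _ ≤ Real.exp R * (d ^ 2 * (2 * ‖lam‖) ^ 2 * Real.exp (2 * ‖lam‖) * (Real.exp R * ‖f‖)) := by
        refine mul_le_mul h6 (h1.trans ?_) (abs_nonneg _) (Real.exp_pos _).le
        gcongr
    _ = _ := by
        have : Real.exp (2 * R) = Real.exp R * Real.exp R := by rw [← Real.exp_add]; ring_nf
        rw [this]; ring

theorem abs_log_sub_le {y : ℝ} (hy : |y - 1| ≤ 1 / 2) : |Real.log y - (y - 1)| ≤ 2 * (y - 1) ^ 2 := by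
  have hy2 : 1 / 2 ≤ y := by linarith [(abs_le.1 hy).1]
  have hy0 : 0 < y := by linarith
  have h1 := Real.log_le_sub_one_of_pos hy0
  have h2 := Real.one_sub_inv_le_log_of_pos hy0
  rw [abs_le]
  constructor
  · have h3 : 1 - y⁻¹ - (y - 1) = -((y - 1) ^ 2 * y⁻¹) := by field_simp; ring
    have h4 : y⁻¹ ≤ 2 := by rw [inv_le_comm₀ hy0 two_pos]; linarith
    nlinarith [sq_nonneg (y - 1)]
  · nlinarith [sq_nonneg (y - 1)]

/-- The expansion of the semigroup on exponentials: `log (P_d exp g) = g + d B g + O(d²)`. -/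
theorem exists_log_semi_sub_le (lam : C(I × I, ℝ)) (R : ℝ) : ∃ C ≥ 0, ∃ d₀ > 0,
    ∀ (N : ℕ) (g : Fin N → ℝ), (∀ i, |g i| ≤ R) → ∀ d, 0 ≤ d → d ≤ d₀ → ∀ i,
      |Real.log (semi lam N d (fun j => Real.exp (g j)) i) - g i - d * discB lam g i|
        ≤ C * d ^ 2 := by
  set C₁ : ℝ := (2 * ‖lam‖) ^ 2 * Real.exp (2 * ‖lam‖) * Real.exp (2 * R) with hC₁
  set C₂ : ℝ := ‖lam‖ * (Real.exp (2 * R) + 1) with hC₂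
  have h1 : 0 ≤ C₁ := by positivity
  have h2 : 0 ≤ C₂ := by positivity
  refine ⟨C₁ + 2 * (C₁ + C₂) ^ 2, by positivity, 1 / (2 * (C₁ + C₂) + 1), by positivity,
    fun N g hg d hd hdd i => ?_⟩
  have hd1 : d ≤ 1 := hdd.trans (by rw [div_le_one (by positivity)]; linarith)
  have hN : Nonempty (Fin N) := ⟨i⟩
  have h3 := semi_exp_mul_sub_le (lam := lam) hg (fun _ => 1) hd hd1 i
  have e1 : tiltedJump lam g (fun _ => 1) i = 0 := by simp [tiltedJump]
  simp only [mul_one, one_mul, e1, zero_add, pi_norm_const, norm_one] at h3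
  set y := Real.exp (-g i) * semi lam N d (fun j => Real.exp (g j)) i with hy
  have h4 := abs_discB_le (lam := lam) hg i
  have h5 : |y - 1| ≤ (C₁ + C₂) * d := by
    have e2 : y - 1 = (y - 1 - d * discB lam g i) + d * discB lam g i := by ring
    rw [e2]
    refine (abs_add_le _ _).trans ?_
    rw [abs_mul, abs_of_nonneg hd]
    have h6 : d ^ 2 ≤ d := by nlinarith
    nlinarith [mul_le_mul_of_nonneg_left h6 h1, mul_le_mul_of_nonneg_left h4 hd]
  have h6 : (C₁ + C₂) * d ≤ 1 / 2 := by
    have h0 : 0 ≤ C₁ + C₂ := by positivity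
    calc (C₁ + C₂) * d ≤ (C₁ + C₂) * (1 / (2 * (C₁ + C₂) + 1)) := by gcongr
      _ ≤ 1 / 2 := by
        rw [mul_one_div, div_le_iff₀ (by positivity)]; linarith
  have h7 := abs_log_sub_le (h5.trans h6)
  have hypos : 0 < y := by linarith [(abs_le.1 (h5.trans h6)).1]
  have e3 : semi lam N d (fun j => Real.exp (g j)) i = Real.exp (g i) * y := by
    rw [hy, ← mul_assoc, ← Real.exp_add, add_neg_cancel, Real.exp_zero, one_mul]
  rw [e3, Real.log_mul (Real.exp_pos _).ne' hypos.ne', Real.log_exp]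
  have e4 : g i + Real.log y - g i - d * discB lam g i
      = (Real.log y - (y - 1)) + (y - 1 - d * discB lam g i) := by ring
  rw [e4]
  refine (abs_add_le _ _).trans ((add_le_add h7 h3).trans ?_)
  have h8 : (y - 1) ^ 2 ≤ ((C₁ + C₂) * d) ^ 2 := by
    rw [← sq_abs (y - 1)]; gcongr
  nlinarith

/-- The expansion of the tilted kernel over a short time. -/
theorem exists_kern_sub_le (lam : C(I × I, ℝ)) (R : ℝ) : ∃ C ≥ 0, ∃ d₀ > 0,
    ∀ (N : ℕ) (g : Fin N → ℝ), (∀ i, |g i| ≤ R) → ∀ d, 0 ≤ d → d ≤ d₀ → ∀ f i,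
      |kern lam N d (fun j => Real.exp (g j)) f i - f i - d * tiltedJump lam g f i|
        ≤ C * d ^ 2 * ‖f‖ := by
  set C₁ : ℝ := (2 * ‖lam‖) ^ 2 * Real.exp (2 * ‖lam‖) * Real.exp (2 * R) with hC₁
  set C₂ : ℝ := ‖lam‖ * (Real.exp (2 * R) + 1) with hC₂
  set C₃ : ℝ := 2 * ‖lam‖ * Real.exp (2 * R) with hC₃
  have h1 : 0 ≤ C₁ := by positivity
  have h2 : 0 ≤ C₂ := by positivity
  have h20 : 0 ≤ C₃ := by positivity
  refine ⟨2 * (2 * C₁ + C₃ * (C₁ + C₂)), by positivity, 1 / (2 * (C₁ + C₂) + 1), by positivity,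
    fun N g hg d hd hdd f i => ?_⟩
  have hd1 : d ≤ 1 := hdd.trans (by rw [div_le_one (by positivity)]; linarith)
  have hN : Nonempty (Fin N) := ⟨i⟩
  have h3 := semi_exp_mul_sub_le (lam := lam) hg (fun _ => 1) hd hd1 i
  have e1 : tiltedJump lam g (fun _ => 1) i = 0 := by simp [tiltedJump]
  simp only [mul_one, one_mul, e1, zero_add, pi_norm_const, norm_one] at h3
  set y := Real.exp (-g i) * semi lam N d (fun j => Real.exp (g j)) i with hy
  have h4 := abs_discB_le (lam := lam) hg i
  have h5 : |y - 1| ≤ (C₁ + C₂) * d := by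
    have e2 : y - 1 = (y - 1 - d * discB lam g i) + d * discB lam g i := by ring
    rw [e2]
    refine (abs_add_le _ _).trans ?_
    rw [abs_mul, abs_of_nonneg hd]
    have h6 : d ^ 2 ≤ d := by nlinarith
    nlinarith [mul_le_mul_of_nonneg_left h6 h1, mul_le_mul_of_nonneg_left h4 hd]
  have h6 : (C₁ + C₂) * d ≤ 1 / 2 := by
    have h0 : 0 ≤ C₁ + C₂ := by positivity
    calc (C₁ + C₂) * d ≤ (C₁ + C₂) * (1 / (2 * (C₁ + C₂) + 1)) := by gcongr
      _ ≤ 1 / 2 := by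
        rw [mul_one_div, div_le_iff₀ (by positivity)]; linarith
  have hy2 : 1 / 2 ≤ y := by linarith [(abs_le.1 (h5.trans h6)).1]
  have hypos : 0 < y := by linarith
  have h7 := semi_exp_mul_sub_le (lam := lam) hg f hd hd1 i
  set z := Real.exp (-g i) * semi lam N d (fun j => Real.exp (g j) * f j) i with hz
  have e3 : kern lam N d (fun j => Real.exp (g j)) f i = z / y := by
    rw [kern, Pi.div_apply, hz, hy, mul_div_mul_left _ _ (Real.exp_pos _).ne']
    rfl
  set J := tiltedJump lam g f i with hJ
  have h8 : |J| ≤ C₃ * ‖f‖ := abs_tiltedJump_le hg f i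
  have hfi : |f i| ≤ ‖f‖ := norm_le_pi_norm f i
  have h9 : |z - y * f i - d * J * y| ≤ (2 * C₁ + C₃ * (C₁ + C₂)) * d ^ 2 * ‖f‖ := by
    have e4 : z - y * f i - d * J * y = (z - f i - d * (J + f i * discB lam g i))
        - f i * (y - 1 - d * discB lam g i) - d * J * (y - 1) := by ring
    rw [e4]
    refine (abs_sub _ _).trans ((add_le_add_left (abs_sub _ _) _).trans ?_)
    rw [abs_mul (f i), abs_mul (d * J), abs_mul d, abs_of_nonneg hd]
    have h10 : |f i| * |y - 1 - d * discB lam g i| ≤ ‖f‖ * (C₁ * d ^ 2) :=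
      mul_le_mul hfi h3 (abs_nonneg _) (norm_nonneg _)
    have h11 : d * |J| * |y - 1| ≤ d * (C₃ * ‖f‖) * ((C₁ + C₂) * d) := by gcongr
    have e5 : (2 * C₁ + C₃ * (C₁ + C₂)) * d ^ 2 * ‖f‖ = C₁ * d ^ 2 * ‖f‖ + ‖f‖ * (C₁ * d ^ 2)
        + d * (C₃ * ‖f‖) * ((C₁ + C₂) * d) := by ring
    rw [e5]
    linarith
  rw [e3]
  have e6 : z / y - f i - d * J = (z - y * f i - d * J * y) / y := by
    field_simp
  rw [e6, abs_div, abs_of_pos hypos, div_le_iff₀ hypos]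
  refine h9.trans ?_
  have h12 : 0 ≤ (2 * C₁ + C₃ * (C₁ + C₂)) * d ^ 2 * ‖f‖ := by positivity
  nlinarith

end Expansion

/-! ### Time-dependent test functions -/

section TestFunctions

variable {T : ℝ}

/-- The operator `B` applied to a time-dependent function at every time. -/
def Bmap (lam : C(I × I, ℝ)) (g : C(Icc (0 : ℝ) T × I, ℝ)) : C(Icc (0 : ℝ) T × I, ℝ) where
  toFun p := ∫ y : I, lam (p.2, y) * (Real.exp (g (p.1, y) - g p) - 1)
  continuous_toFun := by
    have h := continuous_parametric_integral_of_continuous (μ := (volume : Measure I))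
      (f := fun (p : Icc (0 : ℝ) T × I) (y : I) =>
        lam (p.2, y) * (Real.exp (g (p.1, y) - g p) - 1))
      (by unfold Function.uncurry; fun_prop) isCompact_univ
    simpa using h

theorem Bmap_apply (lam : C(I × I, ℝ)) (g : C(Icc (0 : ℝ) T × I, ℝ)) (t : Icc (0 : ℝ) T) (x : I) :
    Bmap lam g (t, x) = ∫ y : I, lam (x, y) * (Real.exp (g (t, y) - g (t, x)) - 1) := rfl

theorem exists_discB_sub_le (lam : C(I × I, ℝ)) (g : C(Icc (0 : ℝ) T × I, ℝ)) {ε : ℝ}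
    (hε : 0 < ε) : ∃ N₀ : ℕ, ∀ N ≥ N₀, ∀ t, ∀ i : Fin N,
      |discB lam (fun j => g (t, node j)) i - Bmap lam g (t, node i)| ≤ ε := by
  obtain ⟨N₀, h⟩ := exists_riemann_sum_le (Y := Icc (0 : ℝ) T × I)
    ⟨fun q => lam (q.1.2, q.2) * (Real.exp (g (q.1.1, q.2) - g q.1) - 1), by fun_prop⟩ hε
  exact ⟨N₀, fun N hN t i => h N hN (t, node i)⟩

/-- The `k`-th grid time as an element of `[0,T]`. -/
def gridI (hT : 0 < T) (m k : ℕ) : Icc (0 : ℝ) T := projIcc 0 T hT.le (grid T m k)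

theorem coe_gridI (hT : 0 < T) {m k : ℕ} (hm : 0 < m) (hk : k ≤ m) :
    (gridI hT m k : ℝ) = k * T / m := by
  have hm' : (0 : ℝ) < m := by exact_mod_cast hm
  rw [gridI, coe_grid hT, projIcc_of_mem hT.le ⟨by positivity, ?_⟩]
  rw [div_le_iff₀ hm', mul_comm]
  gcongr

theorem coe_gridI' (hT : 0 < T) {m k : ℕ} (hm : 0 < m) (hk : k ≤ m) :
    (gridI hT m k : ℝ).toNNReal = grid T m k := by
  rw [coe_gridI hT hm hk]; rfl

theorem gridI_zero (hT : 0 < T) (m : ℕ) : gridI hT m 0 = t0 hT := by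
  rw [gridI, grid_zero]
  exact projIcc_left hT.le

theorem gridI_last (hT : 0 < T) {m : ℕ} (hm : 0 < m) : gridI hT m m = tT hT := by
  have hm' : (m : ℝ) ≠ 0 := by exact_mod_cast hm.ne'
  rw [gridI, coe_grid hT, mul_div_cancel_left₀ _ hm']
  exact projIcc_right hT.le

theorem gridI_step (hT : 0 < T) {m k : ℕ} (hk : k < m) :
    (gridI hT m (k + 1) : ℝ) - gridI hT m k = T / m := by
  rw [coe_gridI hT (by omega) hk, coe_gridI hT (by omega) hk.le]
  push_cast
  ring

theorem exists_modulus {E : Type*} [PseudoMetricSpace E] [CompactSpace E] (g : C(E × I, ℝ)) {ε : ℝ}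
    (hε : 0 < ε) : ∃ δ > 0, ∀ s t : E, dist s t < δ → ∀ x, |g (s, x) - g (t, x)| ≤ ε := by
  have huc := CompactSpace.uniformContinuous_of_continuous g.continuous
  obtain ⟨δ, hδ, h⟩ := Metric.uniformContinuous_iff.1 huc ε hε
  refine ⟨δ, hδ, fun s t hst x => ?_⟩
  rw [← Real.dist_eq]
  refine (h ?_).le
  rw [Prod.dist_eq, dist_self, max_lt_iff]
  exact ⟨hst, hδ⟩

/-- The first order expansion in time of a function of class `C^{1,0}` is uniform. -/
theorem exists_increment_le {hT : 0 < T} (G : C10 hT) {ε : ℝ} (hε : 0 < ε) : ∃ δ > 0,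
    ∀ s t : Icc (0 : ℝ) T, s ≤ t → (t : ℝ) - s < δ → ∀ x,
      |G.val (t, x) - G.val (s, x) - ((t : ℝ) - s) * G.dt (s, x)| ≤ ε * ((t : ℝ) - s) := by
  obtain ⟨δ, hδ, h⟩ := exists_modulus G.dt hε
  refine ⟨δ, hδ, fun s t hst hd x => ?_⟩
  have hst' : (s : ℝ) ≤ t := hst
  set F : ℝ → ℝ := fun r => IccExtend hT.le (fun s => G.val (s, x)) r - r * G.dt (s, x) with hF
  have hder : ∀ r ∈ Icc (s : ℝ) t, HasDerivWithinAt F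
      (IccExtend hT.le (fun s => G.dt (s, x)) r - G.dt (s, x)) (Icc (s : ℝ) t) r := by
    intro r hr
    have hr' : r ∈ Icc (0 : ℝ) T := ⟨s.2.1.trans hr.1, hr.2.trans t.2.2⟩
    have h1 := (G.hasDeriv ⟨r, hr'⟩ x).mono (Icc_subset_Icc s.2.1 t.2.2)
    have h2 := ((hasDerivAt_id r).mul_const (G.dt (s, x))).hasDerivWithinAt (s := Icc (s : ℝ) t)
    rw [one_mul] at h2
    rw [IccExtend_of_mem _ _ hr']
    exact h1.sub h2
  have hbound : ∀ r ∈ Icc (s : ℝ) t,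
      ‖IccExtend hT.le (fun s => G.dt (s, x)) r - G.dt (s, x)‖ ≤ ε := by
    intro r hr
    have hr' : r ∈ Icc (0 : ℝ) T := ⟨s.2.1.trans hr.1, hr.2.trans t.2.2⟩
    rw [IccExtend_of_mem _ _ hr']
    refine h _ _ ?_ x
    rw [Subtype.dist_eq, Real.dist_eq, abs_of_nonneg (sub_nonneg.2 hr.1)]
    linarith [hr.2]
  have key := (convex_Icc (s : ℝ) t).norm_image_sub_le_of_norm_hasDerivWithin_le hder hbound
    (left_mem_Icc.2 hst') (right_mem_Icc.2 hst')
  rw [Real.norm_eq_abs, Real.norm_eq_abs, abs_of_nonneg (sub_nonneg.2 hst')] at key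
  simp only [hF, IccExtend_of_mem _ _ s.2, IccExtend_of_mem _ _ t.2] at key
  convert key using 2
  ring

/-- The function `(∂_t + B) G`. -/
def dtB (lam : C(I × I, ℝ)) {hT : 0 < T} (G : C10 hT) : C(Icc (0 : ℝ) T × I, ℝ) :=
  G.dt + Bmap lam G.val

theorem exists_mesh_lt (T : ℝ) {δ : ℝ} (hδ : 0 < δ) : ∃ m₀ : ℕ, 0 < m₀ ∧
    ∀ m ≥ m₀, T / (m : ℝ) < δ := by
  have h := (tendsto_const_div_atTop_nhds_zero_nat T).eventually (gt_mem_nhds hδ)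
  obtain ⟨m₀, hm₀⟩ := eventually_atTop.1 h
  exact ⟨max m₀ 1, by simp, fun m hm => hm₀ m (le_trans (le_max_left _ _) hm)⟩

theorem dist_gridI (hT : 0 < T) {m k : ℕ} (hk : k < m) :
    dist (gridI hT m (k + 1)) (gridI hT m k) = T / m := by
  rw [Subtype.dist_eq, Real.dist_eq, gridI_step hT hk, abs_of_nonneg (by positivity)]

/-- Over one step of a fine grid, the log-Laplace functional of the process is the one of the
limiting dynamics. -/
theorem exists_log_semi_step_le (lam : C(I × I, ℝ)) {hT : 0 < T} (G : C10 hT) {ε : ℝ}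
    (hε : 0 < ε) : ∃ m₀ N₀ : ℕ, 0 < m₀ ∧ ∀ m ≥ m₀, ∀ N ≥ N₀, ∀ k < m, ∀ i : Fin N,
      |Real.log (semi lam N (T / m) (fun j => Real.exp (G.val (gridI hT m (k + 1), node j))) i)
        - G.val (gridI hT m k, node i) - T / m * dtB lam G (gridI hT m k, node i)|
      ≤ ε * (T / m) := by
  have hε4 : 0 < ε / 4 := by positivity
  obtain ⟨C, hC, d₀, hd₀, h1⟩ := exists_log_semi_sub_le lam ‖G.val‖
  obtain ⟨δ₁, hδ₁, h2⟩ := exists_increment_le G hε4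
  obtain ⟨δ₂, hδ₂, h3⟩ := exists_modulus (Bmap lam G.val) hε4
  obtain ⟨N₀, h4⟩ := exists_discB_sub_le lam G.val hε4
  have hmin : 0 < min (min d₀ (ε / 4 / (C + 1))) (min δ₁ δ₂) := by positivity
  obtain ⟨m₀, hm₀, h5⟩ := exists_mesh_lt T hmin
  refine ⟨m₀, N₀, hm₀, fun m hm N hN k hk i => ?_⟩
  have h6 := h5 m hm
  have hmpos : 0 < m := lt_of_lt_of_le hm₀ hm
  set d : ℝ := T / m with hd
  have hd0 : 0 ≤ d := by positivity
  have hdd : d ≤ d₀ := (h6.trans_le ((min_le_left _ _).trans (min_le_left _ _))).le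
  have hdC : d ≤ ε / 4 / (C + 1) :=
    (h6.trans_le ((min_le_left _ _).trans (min_le_right _ _))).le
  have hdδ₁ : d < δ₁ := h6.trans_le ((min_le_right _ _).trans (min_le_left _ _))
  have hdδ₂ : d < δ₂ := h6.trans_le ((min_le_right _ _).trans (min_le_right _ _))
  set t := gridI hT m k
  set t' := gridI hT m (k + 1)
  have hstep : (t' : ℝ) - t = d := gridI_step hT hk
  have htt : t ≤ t' := by
    have : (t : ℝ) ≤ t' := by linarith
    exact this
  have e1 := h1 N (fun j => G.val (t', node j)) (fun j => G.val.norm_coe_le_norm _) d hd0 hdd i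
  have e2 := h2 t t' htt (by rw [hstep]; exact hdδ₁) (node i)
  rw [hstep] at e2
  have e3 := h3 t' t (by rw [dist_gridI hT hk]; exact hdδ₂) (node i)
  have e4 := h4 N hN t' i
  have e5 : C * d ^ 2 ≤ ε / 4 * d := by
    rw [le_div_iff₀ (by positivity)] at hdC
    nlinarith
  have e6 := mul_le_mul_of_nonneg_left e3 hd0
  have e7 := mul_le_mul_of_nonneg_left e4 hd0
  rw [← abs_of_nonneg hd0, ← abs_mul, abs_of_nonneg hd0] at e6 e7
  rw [dtB, ContinuousMap.add_apply]
  rw [abs_le] at *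
  constructor <;> nlinarith

end TestFunctions

/-! ### Exponential bounds for empirical measures -/

section Functionals

variable {T : ℝ}

/-- Left Riemann sums on the grid converge for continuous functions. -/
theorem exists_grid_sum_le (hT : 0 < T) (F : C(Icc (0 : ℝ) T, ℝ)) {ε : ℝ} (hε : 0 < ε) :
    ∃ m₀ : ℕ, 0 < m₀ ∧ ∀ m ≥ m₀, |∑ k ∈ Finset.range m, T / m * F (gridI hT m k)
      - ∫ s in (0 : ℝ)..T, IccExtend hT.le F s| ≤ ε := by
  obtain ⟨δ, hδ, h⟩ := Metric.uniformContinuous_iff.1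
    (CompactSpace.uniformContinuous_of_continuous F.continuous) (ε / T) (by positivity)
  obtain ⟨m₀, hm₀, h1⟩ := exists_mesh_lt T hδ
  refine ⟨m₀, hm₀, fun m hm => ?_⟩
  have hmpos : 0 < m := lt_of_lt_of_le hm₀ hm
  have hm' : (0 : ℝ) < m := by exact_mod_cast hmpos
  have hFc : Continuous (IccExtend hT.le F) := F.continuous.Icc_extend'
  have e2 : ∫ x in (0 : ℝ)..T, IccExtend hT.le F x
      = ∑ k ∈ Finset.range m, ∫ x in ((k : ℕ) * T / m : ℝ)..((k + 1 : ℕ) * T / m : ℝ),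
        IccExtend hT.le F x := by
    rw [intervalIntegral.sum_integral_adjacent_intervals
        (a := fun i : ℕ => (i * T / m : ℝ)) (fun k _ => hFc.intervalIntegrable _ _)]
    simp [hm'.ne']
  rw [e2, ← Finset.sum_sub_distrib]
  have h3 : ∀ k ∈ Finset.range m, |T / m * F (gridI hT m k)
      - ∫ x in ((k : ℕ) * T / m : ℝ)..((k + 1 : ℕ) * T / m : ℝ), IccExtend hT.le F x|
        ≤ ε / T * (T / m) := by
    intro k hk
    rw [Finset.mem_range] at hk
    have hle : ((k : ℕ) * T / m : ℝ) ≤ ((k + 1 : ℕ) * T / m : ℝ) := by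
      push_cast; gcongr; linarith
    have hlen : (((k + 1 : ℕ) * T / m : ℝ)) - ((k : ℕ) * T / m : ℝ) = T / m := by
      push_cast; ring
    have e3 : T / m * F (gridI hT m k)
        = ∫ _ in ((k : ℕ) * T / m : ℝ)..((k + 1 : ℕ) * T / m : ℝ), F (gridI hT m k) := by
      rw [intervalIntegral.integral_const, hlen, smul_eq_mul]
    rw [e3, ← intervalIntegral.integral_sub (intervalIntegrable_const)
      (hFc.intervalIntegrable _ _)]
    have h4 := intervalIntegral.norm_integral_le_of_norm_le_const (C := ε / T)
      (a := ((k : ℕ) * T / m : ℝ)) (b := ((k + 1 : ℕ) * T / m : ℝ))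
      (f := fun x => F (gridI hT m k) - IccExtend hT.le F x) (fun x hx => by
        rw [uIoc_of_le hle] at hx
        have hx0 : 0 ≤ x := le_trans (by positivity) hx.1.le
        have hx1 : x ≤ T := by
          refine hx.2.trans ?_
          rw [div_le_iff₀ hm', mul_comm]
          gcongr
          exact_mod_cast hk
        have hxm : x ∈ Icc (0 : ℝ) T := ⟨hx0, hx1⟩
        rw [IccExtend_of_mem _ _ hxm, ← dist_eq_norm]
        refine (h ?_).le
        rw [Subtype.dist_eq, Real.dist_eq, coe_gridI hT hmpos hk.le, abs_sub_comm,
          abs_of_nonneg (sub_nonneg.2 hx.1.le)]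
        linarith [hx.2, h1 m hm])
    rw [hlen, abs_of_nonneg (by positivity)] at h4
    exact h4
  refine (Finset.abs_sum_le_sum_abs _ _).trans ((Finset.sum_le_sum h3).trans ?_)
  rw [Finset.sum_const, Finset.card_range, nsmul_eq_mul]
  field_simp
  exact le_rfl

/-- The normalized pairing of a configuration with a vector. -/
def avgc {N : ℕ} (x : Fin N → ℕ) (f : Fin N → ℝ) : ℝ := 1 / (N : ℝ) * ∑ i, (x i : ℝ) * f i

theorem empirical_eq_avgc {N : ℕ} (x : Fin N → ℕ) (f : C(I, ℝ)) :
    empirical x f = avgc x (fun i => f (node i)) := empirical_apply x f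

theorem avgc_add {N : ℕ} (x : Fin N → ℕ) (f g : Fin N → ℝ) :
    avgc x (f + g) = avgc x f + avgc x g := by
  simp only [avgc, Pi.add_apply, mul_add, Finset.sum_add_distrib]

theorem avgc_smul {N : ℕ} (x : Fin N → ℕ) (c : ℝ) (f : Fin N → ℝ) :
    avgc x (c • f) = c * avgc x f := by
  simp only [avgc, Pi.smul_apply, smul_eq_mul, Finset.mul_sum]
  exact Finset.sum_congr rfl fun i _ => by ring

theorem abs_avgc_le {N : ℕ} {x : Fin N → ℕ} {f : Fin N → ℝ} {M c : ℝ} (hM : 0 ≤ M) (hc : 0 ≤ c)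
    (hx : (mass x : ℝ) ≤ M * N) (hf : ∀ i, |f i| ≤ c) : |avgc x f| ≤ M * c := by
  rcases N.eq_zero_or_pos with rfl | hN
  · simpa [avgc] using mul_nonneg hM hc
  have hN' : (0 : ℝ) < N := by exact_mod_cast hN
  rw [avgc, abs_mul, abs_of_nonneg (by positivity), one_div, inv_mul_le_iff₀ hN']
  calc |∑ i, (x i : ℝ) * f i| ≤ ∑ i, (x i : ℝ) * c := by
        refine (Finset.abs_sum_le_sum_abs _ _).trans (Finset.sum_le_sum fun i _ => ?_)
        rw [abs_mul, abs_of_nonneg (Nat.cast_nonneg _)]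
        gcongr
        exact hf i
    _ = mass x * c := by rw [← Finset.sum_mul, mass]; push_cast; rfl
    _ ≤ M * N * c := by gcongr
    _ = _ := by ring

theorem abs_avgc_sub_le {N : ℕ} (x y : Fin N → ℕ) {f : Fin N → ℝ} {c : ℝ} (hf : ∀ i, |f i| ≤ c) :
    |avgc x f - avgc y f| ≤ 1 / N * dist1 x y * c := by
  rw [avgc, avgc, ← mul_sub, ← Finset.sum_sub_distrib, abs_mul, abs_of_nonneg (by positivity),
    mul_assoc, dist1, Finset.sum_mul]
  gcongr
  refine (Finset.abs_sum_le_sum_abs _ _).trans (Finset.sum_le_sum fun i _ => ?_)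
  rw [← sub_mul, abs_mul]
  gcongr
  exact hf i

/-- The tilt by `exp H` and `exp (g k)` as an exponential of averages over the balls. -/
theorem tilt_exp_eq {lam : C(I × I, ℝ)} (hpos : ∀ p, 0 < lam p) {N : ℕ} {Ω : Type*}
    {X : ℝ≥0 → Ω → Fin N → ℕ} {τ : ℕ → ℝ≥0} (hτ : Monotone τ) (hN : 0 < N) (H : Fin N → ℝ)
    (g : ℕ → Fin N → ℝ) (n : ℕ) (ω : Ω) :
    tilt lam X τ (fun i => Real.exp (H i)) (fun k i => Real.exp (g k i)) n ω
      = Real.exp (N * (avgc (X (τ 0) ω) H + ∑ k ∈ Finset.range n,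
        (avgc (X (τ (k + 1)) ω) (g (k + 1)) - avgc (X (τ k) ω)
          (fun i => Real.log (semi lam N (τ (k + 1) - τ k) (fun j => Real.exp (g (k + 1) j)) i))))) := by
  have hN' : (N : ℝ) ≠ 0 := by exact_mod_cast hN.ne'
  have e : ∀ (x : Fin N → ℕ) (f : Fin N → ℝ), (N : ℝ) * avgc x f = ∑ i, (x i : ℝ) * f i := by
    intro x f
    rw [avgc, ← mul_assoc, mul_one_div_cancel hN', one_mul]
  rw [mul_add, Finset.mul_sum, Real.exp_add, Real.exp_sum, e, ← mult_exp, tilt]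
  congr 1
  refine Finset.prod_congr rfl fun k _ => ?_
  rw [mul_sub, e, e, Real.exp_sub, ← mult_exp, ← mult_exp, ratio]
  congr 2
  ext i
  rw [Real.exp_log]
  exact semi_pos hpos (step_nonneg hτ k) (fun j => Real.exp_pos _) i

/-- The variational functional of the dynamics, along the grid. -/
def Jgrid (lam : C(I × I, ℝ)) {hT : 0 < T} (G : C10 hT) (m : ℕ) (μ : D T) : ℝ :=
  μ (tT hT) (G.val.curry (tT hT)) - μ (t0 hT) (G.val.curry (t0 hT))
    - ∑ k ∈ Finset.range m, T / m * μ (gridI hT m k) ((dtB lam G).curry (gridI hT m k))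

/-- The variational functional of the dynamics. -/
def Jdyn (lam : C(I × I, ℝ)) {hT : 0 < T} (G : C10 hT) (μ : D T) : ℝ :=
  μ (tT hT) (G.val.curry (tT hT)) - μ (t0 hT) (G.val.curry (t0 hT))
      - ∫ s in (0 : ℝ)..T, IccExtend hT.le
          (fun r => μ r (G.dt.curry r + B lam (G.val.curry r))) s

/-- The variational functional of the initial state. -/
def Jini (φ : C(I, ℝ)) (H : C(I, ℝ)) (ν : S) : ℝ := ν H - ∫ x : I, φ x * (Real.exp (H x) - 1)

theorem Jdyn_le_Idyn (lam : C(I × I, ℝ)) {hT : 0 < T} (G : C10 hT) (μ : D T) :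
    (Jdyn lam G μ : EReal) ≤ Idyn lam hT μ :=
  le_iSup (fun G : C10 hT => ((Jdyn lam G μ : ℝ) : EReal)) G

theorem Jini_le_Iini (φ H : C(I, ℝ)) (ν : S) : (Jini φ H ν : EReal) ≤ Iini φ ν :=
  le_iSup (fun H : C(I, ℝ) => ((Jini φ H ν : ℝ) : EReal)) H

theorem exists_Jgrid_sub_le (lam : C(I × I, ℝ)) {hT : 0 < T} (G : C10 hT) {μ : D T}
    (hμ : Continuous fun r : Icc (0 : ℝ) T => μ r ((dtB lam G).curry r)) {ε : ℝ} (hε : 0 < ε) :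
    ∃ m₀ : ℕ, 0 < m₀ ∧ ∀ m ≥ m₀, |Jgrid lam G m μ - Jdyn lam G μ| ≤ ε := by
  obtain ⟨m₀, hm₀, h⟩ := exists_grid_sum_le hT ⟨_, hμ⟩ hε
  refine ⟨m₀, hm₀, fun m hm => ?_⟩
  have h1 := h m hm
  have e : Jgrid lam G m μ - Jdyn lam G μ
      = -(∑ k ∈ Finset.range m, T / m * μ (gridI hT m k) ((dtB lam G).curry (gridI hT m k))
        - ∫ s in (0 : ℝ)..T, IccExtend hT.le (fun r => μ r ((dtB lam G).curry r)) s) := by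
    have : (fun r => μ r (G.dt.curry r + B lam (G.val.curry r)))
        = fun r => μ r ((dtB lam G).curry r) := rfl
    rw [Jgrid, Jdyn, this]
    ring
  rw [e, abs_neg]
  exact h1

end Functionals

/-! ### Compact sets of paths -/

section Compactness

variable {T : ℝ}

/-- The linear paths of norm at most `M`, written as functions of the time and the test function,
whose oscillation over times at most `δ j` is at most `2⁻ʲ` for every `j < J`. -/
def pathSet (T M : ℝ) (δ : ℕ → ℝ) (J : ℕ) : Set (Icc (0 : ℝ) T × C(I, ℝ) → ℝ) :=
  {A | (∀ t f g, A (t, f + g) = A (t, f) + A (t, g)) ∧ (∀ t (c : ℝ) f, A (t, c • f) = c * A (t, f)) ∧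
    (∀ t f, |A (t, f)| ≤ M * ‖f‖) ∧
    ∀ j < J, ∀ s t : Icc (0 : ℝ) T, |(s : ℝ) - t| ≤ δ j → ∀ f,
      |A (s, f) - A (t, f)| ≤ (1 / 2) ^ j * ‖f‖}

theorem isClosed_pathSet (T M : ℝ) (δ : ℕ → ℝ) (J : ℕ) : IsClosed (pathSet T M δ J) := by
  refine IsClosed.and ?_ (IsClosed.and ?_ (IsClosed.and ?_ ?_))
  · simp only [Set.ofPred_forall]
    exact isClosed_iInter fun t => isClosed_iInter fun f => isClosed_iInter fun g =>
      isClosed_eq (by fun_prop) (by fun_prop)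
  · simp only [Set.ofPred_forall]
    exact isClosed_iInter fun t => isClosed_iInter fun f => isClosed_iInter fun g =>
      isClosed_eq (by fun_prop) (by fun_prop)
  · simp only [Set.ofPred_forall]
    exact isClosed_iInter fun t => isClosed_iInter fun f =>
      isClosed_le (by fun_prop) (by fun_prop)
  · simp only [Set.ofPred_forall]
    exact isClosed_iInter fun t => isClosed_iInter fun f => isClosed_iInter fun g =>
      isClosed_iInter fun t => isClosed_iInter fun f => isClosed_iInter fun g =>
      isClosed_le (by fun_prop) (by fun_prop)

theorem isCompact_pathSet (T M : ℝ) (δ : ℕ → ℝ) (J : ℕ) : IsCompact (pathSet T M δ J) := by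
  refine (isCompact_univ_pi fun p : Icc (0 : ℝ) T × C(I, ℝ) =>
    isCompact_Icc (a := -(M * ‖p.2‖)) (b := M * ‖p.2‖)).of_isClosed_subset
    (isClosed_pathSet T M δ J) ?_
  intro A hA p _
  exact abs_le.1 (hA.2.2.1 p.1 p.2)

theorem pathSet_antitone (T M : ℝ) (δ : ℕ → ℝ) : Antitone (pathSet T M δ) :=
  fun _ _ hij _ hA => ⟨hA.1, hA.2.1, hA.2.2.1, fun j hj => hA.2.2.2 j (hj.trans_le hij)⟩

/-- Finitely many uniform neighbourhoods of continuous paths cover all paths of controlled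
oscillation at finitely many scales. -/
theorem exists_finite_cover (hT : 0 < T) {M : ℝ} {δ : ℕ → ℝ} (hδ : ∀ j, 0 < δ j)
    (s : (Icc (0 : ℝ) T × C(I, ℝ) → ℝ) → Finset C(I, ℝ))
    (ε : (Icc (0 : ℝ) T × C(I, ℝ) → ℝ) → ℝ) (hε : ∀ A, 0 < ε A) :
    ∃ (F : Finset (Icc (0 : ℝ) T × C(I, ℝ) → ℝ)) (J : ℕ),
      (∀ A ∈ F, ∀ J, A ∈ pathSet T M δ J) ∧ ∀ A' ∈ pathSet T M δ J, ∃ A ∈ F,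
        ∀ t, ∀ f ∈ s A, |A' (t, f) - A (t, f)| < ε A := by
  classical
  have hj : ∀ A, ∃ j : ℕ, ∀ f ∈ s A, (1 / 2 : ℝ) ^ j * ‖f‖ < ε A / 4 := by
    intro A
    have h : ∀ f : C(I, ℝ), ∀ᶠ j : ℕ in atTop, (1 / 2 : ℝ) ^ j * ‖f‖ < ε A / 4 := by
      intro f
      have h1 : Tendsto (fun j : ℕ => (1 / 2 : ℝ) ^ j * ‖f‖) atTop (𝓝 (0 * ‖f‖)) :=
        (tendsto_pow_atTop_nhds_zero_of_lt_one (by norm_num) (by norm_num)).mul_const _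
      rw [zero_mul] at h1
      exact h1.eventually (gt_mem_nhds (by have := hε A; positivity))
    exact ((Finset.eventually_all (s A)).2 fun f _ => h f).exists
  choose j hj using hj
  have hm : ∀ A, ∃ m : ℕ, 0 < m ∧ T / m ≤ δ (j A) := by
    intro A
    obtain ⟨m, hm, h⟩ := exists_mesh_lt T (hδ (j A))
    exact ⟨m, hm, (h m le_rfl).le⟩
  choose m hm hmδ using hm
  -- closeness at the grid times is an open condition for the product topology; the control of the
  -- oscillations turns it into uniform closeness
  set U : (Icc (0 : ℝ) T × C(I, ℝ) → ℝ) → Set (Icc (0 : ℝ) T × C(I, ℝ) → ℝ) := fun A =>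
    {A' | ∀ k ∈ Finset.range (m A), ∀ f ∈ s A,
      |A' (gridI hT (m A) k, f) - A (gridI hT (m A) k, f)| < ε A / 4} with hU
  have hUo : ∀ A, IsOpen (U A) := by
    intro A
    have e : U A = ⋂ k ∈ Finset.range (m A), ⋂ f ∈ s A,
        {A' | |A' (gridI hT (m A) k, f) - A (gridI hT (m A) k, f)| < ε A / 4} := by
      ext A'; simp [hU]
    rw [e]
    exact isOpen_biInter_finset fun k _ => isOpen_biInter_finset fun f _ =>
      isOpen_lt (by fun_prop) (by fun_prop)
  have hUself : ∀ A, A ∈ U A := fun A k _ f _ => by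
    rw [sub_self, abs_zero]; have := hε A; positivity
  -- the compact sets `pathSet T M δ J` decrease to `K`, so a cover of `K` covers one of them
  set K := ⋂ J, pathSet T M δ J with hK
  have hKc : IsCompact K := (isCompact_pathSet T M δ 0).of_isClosed_subset
    (isClosed_iInter fun J => isClosed_pathSet T M δ J) (iInter_subset _ 0)
  obtain ⟨F, hFK, hF⟩ := hKc.elim_nhds_subcover U fun A _ => (hUo A).mem_nhds (hUself A)
  obtain ⟨J, hJ⟩ := exists_subset_nhds_of_isCompact' (pathSet_antitone T M δ).directed_ge
    (isCompact_pathSet T M δ) (isClosed_pathSet T M δ) (U := ⋃ A ∈ F, U A)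
    (fun A hA => (isOpen_biUnion fun A _ => hUo A).mem_nhds (hF hA))
  refine ⟨F, max J (F.sup j + 1), fun A hA J => mem_iInter.1 (hFK A hA) J, fun A' hA' => ?_⟩
  have h1 := hJ (pathSet_antitone T M δ (le_max_left _ _) hA')
  simp only [mem_iUnion] at h1
  obtain ⟨A, hAF, hA'U⟩ := h1
  refine ⟨A, hAF, fun t f hf => ?_⟩
  obtain ⟨k, hk, hk1, hk2⟩ := exists_grid_mem hT (hm A) t.2.1 t.2.2
  have hkt : |(t : ℝ) - gridI hT (m A) k| ≤ δ (j A) := by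
    rw [coe_gridI hT (hm A) hk.le, ← coe_grid hT, abs_of_nonneg (sub_nonneg.2 hk1)]
    have := grid_step hT (m A) k
    linarith [hmδ A]
  have hjA : j A < max J (F.sup j + 1) :=
    lt_of_lt_of_le (Nat.lt_succ_of_le (Finset.le_sup hAF)) (le_max_right _ _)
  have e1 := hA'.2.2.2 (j A) hjA t _ hkt f
  have e2 := (mem_iInter.1 (hFK A hAF) (j A + 1)).2.2.2 (j A) (Nat.lt_succ_self _) t _ hkt f
  have e3 := hA'U k (Finset.mem_range.2 hk) f hf
  have e4 := hj A f hf
  rw [abs_le] at e1 e2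
  rw [abs_lt] at e3 ⊢
  constructor <;> linarith [hε A]

/-- The path of elements of `S` given by a family of bounded linear functionals. -/
def toPath {M : ℝ} {δ : ℕ → ℝ} (hδ : ∀ j, 0 < δ j) (A : Icc (0 : ℝ) T × C(I, ℝ) → ℝ)
    (hA : ∀ J, A ∈ pathSet T M δ J) : D T :=
  ⟨fun t => StrongDual.toWeakDual (LinearMap.mkContinuous
      { toFun := fun f => A (t, f)
        map_add' := fun f g => (hA 0).1 t f g
        map_smul' := fun c f => (hA 0).2.1 t c f } M (fun f => (hA 0).2.2.1 t f)), by
    have hc : Continuous fun t => StrongDual.toWeakDual (LinearMap.mkContinuous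
      ({ toFun := fun f => A (t, f)
         map_add' := fun f g => (hA 0).1 t f g
         map_smul' := fun c f => (hA 0).2.1 t c f } : C(I, ℝ) →ₗ[ℝ] ℝ) M
          (fun f => (hA 0).2.2.1 t f)) := by
      refine WeakDual.continuous_of_continuous_eval fun f => ?_
      change Continuous fun t => A (t, f)
      rw [Metric.continuous_iff]
      intro t η hη
      have h1 : Tendsto (fun j : ℕ => (1 / 2 : ℝ) ^ j * ‖f‖) atTop (𝓝 (0 * ‖f‖)) :=
        (tendsto_pow_atTop_nhds_zero_of_lt_one (by norm_num) (by norm_num)).mul_const _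
      rw [zero_mul] at h1
      obtain ⟨j, hj⟩ := (h1.eventually (gt_mem_nhds hη)).exists
      refine ⟨δ j, hδ j, fun r hr => ?_⟩
      rw [Real.dist_eq]
      refine lt_of_le_of_lt ((hA (j + 1)).2.2.2 j (Nat.lt_succ_self j) r t ?_ f) hj
      rw [Subtype.dist_eq, Real.dist_eq] at hr
      exact hr.le
    exact fun t => ⟨hc.continuousWithinAt, _, hc.continuousWithinAt⟩⟩

/-- The path of a family in every `pathSet` is continuous even when tested against time-dependent
functions. -/
theorem continuous_toPath_curry {M : ℝ} {δ : ℕ → ℝ} (hδ : ∀ j, 0 < δ j)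
    (A : Icc (0 : ℝ) T × C(I, ℝ) → ℝ) (hA : ∀ J, A ∈ pathSet T M δ J)
    (W : C(Icc (0 : ℝ) T × I, ℝ)) :
    Continuous fun r => toPath hδ A hA r (W.curry r) := by
  rw [continuous_iff_continuousAt]
  intro t
  have hW : Tendsto (fun r => ‖W.curry r - W.curry t‖) (𝓝 t) (𝓝 0) := by
    have := (W.curry.continuous.sub continuous_const).norm.tendsto t (f := fun r =>
      ‖W.curry r - W.curry t‖)
    simpa using this
  have hc : Tendsto (fun r => toPath hδ A hA r (W.curry t)) (𝓝 t)
      (𝓝 (toPath hδ A hA t (W.curry t))) := by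
    change Tendsto (fun r => A (r, W.curry t)) (𝓝 t) (𝓝 (A (t, W.curry t)))
    rw [Metric.tendsto_nhds]
    intro η hη
    have h1 : Tendsto (fun j : ℕ => (1 / 2 : ℝ) ^ j * ‖W.curry t‖) atTop (𝓝 (0 * ‖W.curry t‖)) :=
      (tendsto_pow_atTop_nhds_zero_of_lt_one (by norm_num) (by norm_num)).mul_const _
    rw [zero_mul] at h1
    obtain ⟨j, hj⟩ := (h1.eventually (gt_mem_nhds hη)).exists
    filter_upwards [Metric.ball_mem_nhds t (hδ j)] with r hr
    rw [Real.dist_eq]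
    refine lt_of_le_of_lt ((hA (j + 1)).2.2.2 j (Nat.lt_succ_self j) r t ?_ _) hj
    rw [Metric.mem_ball, Subtype.dist_eq, Real.dist_eq] at hr
    exact hr.le
  have h0 : Tendsto (fun r => toPath hδ A hA r (W.curry r - W.curry t)) (𝓝 t) (𝓝 0) := by
    refine squeeze_zero_norm (fun r => (hA 0).2.2.1 r (W.curry r - W.curry t)) ?_
    simpa using hW.const_mul M
  have := h0.add hc
  rw [zero_add] at this
  refine this.congr fun r => ?_
  rw [map_sub, sub_add_cancel]

end Compactness

/-! ### The upper bound for closed sets -/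

/-- The pairing with a configuration as a linear map. -/
def avgLin {N : ℕ} (x : Fin N → ℕ) : (Fin N → ℝ) →ₗ[ℝ] ℝ where
  toFun := avgc x
  map_add' := avgc_add x
  map_smul' := avgc_smul x

/-- The exponent of the tilt is a Riemann sum for the variational functional: summation of
`exists_log_semi_step_le` over the grid, for linear functionals of mass at most `M`. -/
theorem exists_sum_step_le (lam : C(I × I, ℝ)) {T : ℝ} {hT : 0 < T} (G : C10 hT) {ε : ℝ}
    (hε : 0 < ε) : ∃ m₀ N₀ : ℕ, 0 < m₀ ∧ ∀ m ≥ m₀, ∀ N ≥ N₀, ∀ M ≥ 0,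
      ∀ ℓ : ℕ → (Fin N → ℝ) →ₗ[ℝ] ℝ,
      (∀ k f c, 0 ≤ c → (∀ i, |f i| ≤ c) → |ℓ k f| ≤ M * c) →
      |∑ k ∈ Finset.range m, (ℓ (k + 1) (fun i => G.val (gridI hT m (k + 1), node i))
          - ℓ k (fun i => Real.log (semi lam N (grid T m (k + 1) - grid T m k)
            (fun j => Real.exp (G.val (gridI hT m (k + 1), node j))) i)))
        - (ℓ m (fun i => G.val (gridI hT m m, node i)) - ℓ 0 (fun i => G.val (gridI hT m 0, node i))
          - ∑ k ∈ Finset.range m, T / m * ℓ k (fun i => dtB lam G (gridI hT m k, node i)))|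
      ≤ M * ε * T := by
  obtain ⟨m₀, N₀, hm₀, h⟩ := exists_log_semi_step_le lam G hε
  refine ⟨m₀, N₀, hm₀, fun m hm N hN M hM ℓ hℓ => ?_⟩
  have hmpos : 0 < m := lt_of_lt_of_le hm₀ hm
  have hm' : (0 : ℝ) < m := by exact_mod_cast hmpos
  rw [← Finset.sum_range_sub (fun k => ℓ k (fun i => G.val (gridI hT m k, node i))),
    ← Finset.sum_sub_distrib, ← Finset.sum_sub_distrib]
  have hk : ∀ k ∈ Finset.range m,
      |ℓ (k + 1) (fun i => G.val (gridI hT m (k + 1), node i))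
          - ℓ k (fun i => Real.log (semi lam N (grid T m (k + 1) - grid T m k)
            (fun j => Real.exp (G.val (gridI hT m (k + 1), node j))) i))
        - (ℓ (k + 1) (fun i => G.val (gridI hT m (k + 1), node i))
          - ℓ k (fun i => G.val (gridI hT m k, node i))
          - T / m * ℓ k (fun i => dtB lam G (gridI hT m k, node i)))| ≤ M * (ε * (T / m)) := by
    intro k hk
    have e := hℓ k (fun i => Real.log (semi lam N (T / m)
        (fun j => Real.exp (G.val (gridI hT m (k + 1), node j))) i)
        - G.val (gridI hT m k, node i) - T / m * dtB lam G (gridI hT m k, node i))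
      (ε * (T / m)) (by positivity) (h m hm N hN k (Finset.mem_range.1 hk))
    have e2 : (fun i : Fin N => Real.log (semi lam N (T / m)
        (fun j => Real.exp (G.val (gridI hT m (k + 1), node j))) i)
        - G.val (gridI hT m k, node i) - T / m * dtB lam G (gridI hT m k, node i))
        = (fun i : Fin N => Real.log (semi lam N (T / m)
        (fun j => Real.exp (G.val (gridI hT m (k + 1), node j))) i))
        - (fun i => G.val (gridI hT m k, node i))
        - (T / m) • (fun i : Fin N => dtB lam G (gridI hT m k, node i)) := rfl
    rw [e2, map_sub, map_sub, map_smul, smul_eq_mul] at e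
    rw [grid_step hT, ← abs_neg]
    refine le_trans (le_of_eq ?_) e
    congr 1
    ring
  refine (Finset.abs_sum_le_sum_abs _ _).trans ((Finset.sum_le_sum hk).trans (le_of_eq ?_))
  rw [Finset.sum_const, Finset.card_range, nsmul_eq_mul]
  field_simp

theorem kernIter_const {lam : C(I × I, ℝ)} (hpos : ∀ p, 0 < lam p) {N : ℕ} {τ : ℕ → ℝ≥0}
    (hτ : Monotone τ) {b : ℕ → Fin N → ℝ} (hb : ∀ k i, 0 < b k i) (n : ℕ) (c : ℝ) :
    kernIter lam N τ b n (fun _ => c) = fun _ => c := by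
  induction n with
  | zero => rfl
  | succ n ih => rw [kernIter, kern_const hpos (step_nonneg hτ n) (hb _), ih]

/-- The normalization of the tilt. -/
theorem lintegral_tilt {lam : C(I × I, ℝ)} {N : ℕ} {Ω : Type*} [m : MeasurableSpace Ω]
    {P : Measure Ω} {X : ℝ≥0 → Ω → Fin N → ℕ} {ℱ : Filtration ℝ≥0 m} [IsProbabilityMeasure P]
    (hX : IsUrnProcess lam N P X) (hM : SolvesMartingaleProblem lam P X ℱ)
    (hpos : ∀ p, 0 < lam p) {φ : C(I, ℝ)} (hφ : ∀ x, 0 ≤ φ x)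
    (hX0 : IsPoissonInitial φ N P (X 0)) {τ : ℕ → ℝ≥0} (hτ : Monotone τ) (hτ0 : τ 0 = 0)
    {a : Fin N → ℝ} {b : ℕ → Fin N → ℝ} (ha : ∀ i, 0 < a i) (hb : ∀ k i, 0 < b k i) (n : ℕ) :
    ∫⁻ ω, ENNReal.ofReal (tilt lam X τ a b n ω) ∂P
      = ENNReal.ofReal (Real.exp (∑ i, φ (node i) * (a i - 1))) := by
  have h := lintegral_tilt_mul_mult hX hM hpos hτ ha hb n (f := fun _ => 1)
    (fun _ => zero_le_one)
  rw [kernIter_const hpos hτ hb, hτ0] at h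
  have e1 : a * (fun _ => (1 : ℝ)) = a := by ext i; simp
  rw [e1, lintegral_mult_initial hφ (hX.measurable 0) hX0 (fun i => (ha i).le)] at h
  rw [← h]
  refine lintegral_congr fun ω => ?_
  simp [mult]

section Upper

variable {T : ℝ} {hT : 0 < T} {lam : C(I × I, ℝ)} {φ : C(I, ℝ)} {Ω : ℕ → Type*}
  [∀ N, MeasurableSpace (Ω N)] {P : ∀ N, Measure (Ω N)} [∀ N, IsProbabilityMeasure (P N)]
  {X : ∀ N, ℝ≥0 → Ω N → Fin N → ℕ}

theorem exists_initial_sum_le (φ H : C(I, ℝ)) {ε : ℝ} (hε : 0 < ε) : ∀ᶠ N : ℕ in atTop,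
    |1 / (N : ℝ) * ∑ i : Fin N, φ (node i) * (Real.exp (H (node i)) - 1)
      - ∫ x : I, φ x * (Real.exp (H x) - 1)| ≤ ε := by
  obtain ⟨N₀, h⟩ := exists_riemann_sum_le (Y := Unit)
    ⟨fun q => φ q.2 * (Real.exp (H q.2) - 1), by fun_prop⟩ hε
  exact eventually_atTop.2 ⟨N₀, fun N hN => h N hN ()⟩

/-- The exponential Chebyshev inequality near a continuous path. -/
theorem exists_measure_near_le (hpos : ∀ p, 0 < lam p) (hφ : ∀ x, 0 ≤ φ x)
    (hX : ∀ N, IsUrnProcess lam N (P N) (X N)) (hX0 : ∀ N, IsPoissonInitial φ N (P N) (X N 0))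
    {M : ℝ} (hM : 0 ≤ M) {μ : D T}
    (hμ : ∀ W : C(Icc (0 : ℝ) T × I, ℝ), Continuous fun r => μ r (W.curry r))
    (H : C(I, ℝ)) (G : C10 hT) {a : ℝ} (ha : a < Jini φ H (μ (t0 hT)) + Jdyn lam G μ) :
    ∃ (s : Finset C(I, ℝ)) (ε : ℝ), 0 < ε ∧ ∀ᶠ N : ℕ in atTop,
      P N {ω | (mass (X N 0 ω) : ℝ) ≤ M * N ∧ ∀ t, ∀ f ∈ s,
        |empiricalPath T (fun t => X N t ω) ((hX N).cadlag ω) t f - μ t f| < ε}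
      ≤ ENNReal.ofReal (Real.exp (-(a * N))) := by
  classical
  set gap : ℝ := Jini φ H (μ (t0 hT)) + Jdyn lam G μ - a with hgap
  have hgap0 : 0 < gap := sub_pos.2 ha
  obtain ⟨m₁, hm₁, h1⟩ := exists_Jgrid_sub_le lam G (hμ (dtB lam G)) (ε := gap / 8) (by positivity)
  obtain ⟨m₂, N₂, hm₂, h2⟩ := exists_sum_step_le lam G (ε := gap / 8 / ((M + 1) * T))
    (by positivity)
  set m := max m₁ m₂ with hm
  have hmpos : 0 < m := lt_of_lt_of_le hm₁ (le_max_left _ _)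
  have hm' : (0 : ℝ) < m := by exact_mod_cast hmpos
  set W : ℕ → C(I, ℝ) := fun k => (dtB lam G).curry (gridI hT m k) with hW
  set s : Finset C(I, ℝ) := {H, G.val.curry (tT hT), G.val.curry (t0 hT)} ∪
    (Finset.range m).image W with hs
  set ε : ℝ := gap / 8 / (3 + T) with hε
  have hεpos : 0 < ε := by positivity
  refine ⟨s, ε, hεpos, ?_⟩
  have hev := exists_initial_sum_le φ H (ε := gap / 8) (by positivity)
  filter_upwards [hev, eventually_ge_atTop N₂, eventually_gt_atTop 0] with N hN hN₂ hNpos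
  have hN' : (0 : ℝ) < N := by exact_mod_cast hNpos
  obtain ⟨ℱ, hℱ⟩ := (hX N).martingale
  have hMP : SolvesMartingaleProblem lam (P N) (X N) ℱ := hℱ
  have hτ := grid_monotone hT m
  set τ : ℕ → ℝ≥0 := grid T m with hτdef
  set Hv : Fin N → ℝ := fun i => H (node i) with hHv
  set g : ℕ → Fin N → ℝ := fun k i => G.val (gridI hT m k, node i) with hg
  set Z : Ω N → ℝ := tilt lam (X N) τ (fun i => Real.exp (Hv i)) (fun k i => Real.exp (g k i)) m
    with hZ
  set c : ℝ := ∑ i : Fin N, φ (node i) * (Real.exp (H (node i)) - 1) with hc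
  have hint : ∫⁻ ω, ENNReal.ofReal (Z ω) ∂(P N) = ENNReal.ofReal (Real.exp c) :=
    lintegral_tilt (hX N) hMP hpos hφ (hX0 N) hτ (grid_zero T m) (fun i => Real.exp_pos _)
      (fun k i => Real.exp_pos _) m
  have hZm : Measurable fun ω => ENNReal.ofReal (Z ω) :=
    ENNReal.measurable_ofReal.comp ((measurable_tilt hMP hτ m).mono (ℱ.le _) le_rfl)
  have key : ∀ᵐ ω ∂(P N), ((mass (X N 0 ω) : ℝ) ≤ M * N ∧ ∀ t, ∀ f ∈ s,
      |empiricalPath T (fun t => X N t ω) ((hX N).cadlag ω) t f - μ t f| < ε) →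
      ENNReal.ofReal (Real.exp (a * N + c)) ≤ ENNReal.ofReal (Z ω) := by
    -- close to `μ` the exponent of the tilt is at least `N` times the value of the functional at `μ`, up
    -- to errors of total size less than `gap`
    filter_upwards [ae_forall_mass_le (hX N) hMP] with ω hω
    rintro ⟨hmass, hnear⟩
    refine ENNReal.ofReal_le_ofReal ?_
    rw [hZ, tilt_exp_eq hpos hτ hNpos]
    refine Real.exp_le_exp.2 ?_
    set ν := empiricalPath T (fun t => X N t ω) ((hX N).cadlag ω) with hν
    have hνk : ∀ k ≤ m, ∀ f : C(I, ℝ), ν (gridI hT m k) f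
        = avgc (X N (τ k) ω) (fun i => f (node i)) := by
      intro k hk f
      rw [← empirical_eq_avgc]
      have e : (gridI hT m k : ℝ).toNNReal = τ k := coe_gridI' hT hmpos hk
      rw [← e]
      rfl
    have hms : ∀ k, (mass (X N (τ k) ω) : ℝ) ≤ M * N := fun k =>
      le_trans (by exact_mod_cast hω (τ k)) hmass
    have h3 := h2 m (le_max_right _ _) N hN₂ M hM (fun k => avgLin (X N (τ k) ω))
      (fun k f c hc hf => abs_avgc_le hM hc (hms k) hf)
    have h4 : avgc (X N (τ m) ω) (g m) = ν (tT hT) (G.val.curry (tT hT)) := by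
      rw [← gridI_last hT hmpos, hνk m le_rfl]; rfl
    have h5 : avgc (X N (τ 0) ω) (g 0) = ν (t0 hT) (G.val.curry (t0 hT)) := by
      rw [← gridI_zero hT m, hνk 0 (Nat.zero_le _)]; rfl
    have h6 : avgc (X N (τ 0) ω) Hv = ν (t0 hT) H := by
      rw [← gridI_zero hT m, hνk 0 (Nat.zero_le _)]
    have h7 : ∑ k ∈ Finset.range m, T / m * avgc (X N (τ k) ω)
        (fun i => dtB lam G (gridI hT m k, node i))
        = ∑ k ∈ Finset.range m, T / m * ν (gridI hT m k) (W k) := by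
      refine Finset.sum_congr rfl fun k hk => ?_
      rw [hνk k (Finset.mem_range.1 hk).le]; rfl
    have h8 : ∑ k ∈ Finset.range m, T / m * ν (gridI hT m k) (W k)
        ≤ ∑ k ∈ Finset.range m, T / m * μ (gridI hT m k) (W k) + T * ε := by
      have : T * ε = ∑ k ∈ Finset.range m, T / m * ε := by
        rw [Finset.sum_const, Finset.card_range, nsmul_eq_mul]; field_simp
      rw [this, ← Finset.sum_add_distrib]
      refine Finset.sum_le_sum fun k hk => ?_
      have := (abs_lt.1 (hnear (gridI hT m k) (W k)
        (Finset.mem_union_right _ (Finset.mem_image_of_mem W hk)))).2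
      have hTm : 0 ≤ T / m := by positivity
      nlinarith
    have h9 := (abs_lt.1 (hnear (tT hT) (G.val.curry (tT hT))
      (Finset.mem_union_left _ (by simp)))).1
    have h10 := (abs_lt.1 (hnear (t0 hT) (G.val.curry (t0 hT))
      (Finset.mem_union_left _ (by simp)))).2
    have h11 := (abs_lt.1 (hnear (t0 hT) H (Finset.mem_union_left _ (by simp)))).1
    have h12 := (abs_le.1 (h1 m (le_max_left _ _))).1
    have h13 := (abs_le.1 h3).1
    have h14 : M * (gap / 8 / ((M + 1) * T)) * T ≤ gap / 8 := by
      have : M * (gap / 8 / ((M + 1) * T)) * T = gap / 8 * (M / (M + 1)) := by field_simp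
      rw [this]
      exact mul_le_of_le_one_right (by positivity) ((div_le_one (by positivity)).2 (by linarith))
    have h15 : (3 + T) * ε = gap / 8 := by rw [hε]; field_simp
    have h16 : 1 / (N : ℝ) * c ≤ (∫ x : I, φ x * (Real.exp (H x) - 1)) + gap / 8 := by
      have := (abs_le.1 hN).2
      linarith
    have h17 : c = N * (1 / (N : ℝ) * c) := by field_simp
    rw [h17]
    change _ ≤ N * (avgc (X N (τ 0) ω) Hv + _)
    have h18 : a * N + N * (1 / (N : ℝ) * c) = N * (a + 1 / (N : ℝ) * c) := by ring
    rw [h18]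
    refine mul_le_mul_of_nonneg_left ?_ hN'.le
    rw [Jgrid] at h12
    rw [Jini] at hgap
    rw [h6]
    change -(M * (gap / 8 / ((M + 1) * T)) * T) ≤ _ - (avgc (X N (τ m) ω) (g m)
      - avgc (X N (τ 0) ω) (g 0) - ∑ k ∈ Finset.range m, T / m * avgc (X N (τ k) ω)
        (fun i => dtB lam G (gridI hT m k, node i))) at h13
    rw [h4, h5, h7] at h13
    set Sm := ∑ k ∈ Finset.range m, T / m * μ (gridI hT m k) (W k) with hSm
    have h19 : -(gap / 8) ≤ μ (tT hT) (G.val.curry (tT hT)) - μ (t0 hT) (G.val.curry (t0 hT)) - Sm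
        - Jdyn lam G μ := h12
    suffices h : ∀ S₀, -(M * (gap / 8 / ((M + 1) * T)) * T) ≤ S₀ - (ν (tT hT) (G.val.curry (tT hT))
        - ν (t0 hT) (G.val.curry (t0 hT)) - ∑ k ∈ Finset.range m, T / m * ν (gridI hT m k) (W k)) →
        a + 1 / (N : ℝ) * c ≤ ν (t0 hT) H + S₀ from h _ h13
    intro S₀ h13
    linarith
  have hmeas : MeasurableSet {ω | ENNReal.ofReal (Real.exp (a * N + c)) ≤ ENNReal.ofReal (Z ω)} :=
    measurableSet_le measurable_const hZm
  have hcheb := mul_meas_ge_le_lintegral (μ := P N) hZm (ENNReal.ofReal (Real.exp (a * N + c)))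
  rw [hint] at hcheb
  refine (measure_mono_ae (key.mono fun ω h => h)).trans ?_
  have hpos' : ENNReal.ofReal (Real.exp (a * N + c)) ≠ 0 := by
    simpa using Real.exp_pos _
  rw [← ENNReal.mul_le_mul_iff_right hpos' ENNReal.ofReal_ne_top]
  refine hcheb.trans (le_of_eq ?_)
  rw [← ENNReal.ofReal_mul (Real.exp_pos _).le, ← Real.exp_add]
  congr 2
  ring

end Upper

theorem Iini_nonneg (φ : C(I, ℝ)) (ν : S) : 0 ≤ Iini φ ν := by
  refine le_trans (le_of_eq ?_) (Jini_le_Iini φ 0 ν)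
  simp [Jini]

theorem B_zero (lam : C(I × I, ℝ)) : B lam 0 = 0 := by
  ext x
  simp [B]

/-- The test function `0`. -/
def C10.zero {T : ℝ} (hT : 0 < T) : C10 hT where
  val := 0
  dt := 0
  hasDeriv := fun t x => by
    have : (IccExtend hT.le fun s : Icc (0 : ℝ) T => (0 : C(Icc (0 : ℝ) T × I, ℝ)) (s, x))
        = fun _ => 0 := rfl
    rw [this]
    exact hasDerivWithinAt_const _ _ _

theorem Jdyn_zero (lam : C(I × I, ℝ)) {T : ℝ} (hT : 0 < T) (μ : D T) :
    Jdyn lam (C10.zero hT) μ = 0 := by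
  have h0 : ∀ r : Icc (0 : ℝ) T, (0 : C(Icc (0 : ℝ) T × I, ℝ)).curry r = 0 := fun r => rfl
  have h1 : (fun r => μ r ((C10.zero hT).dt.curry r + B lam ((C10.zero hT).val.curry r)))
      = fun _ => (0 : ℝ) := by
    funext r
    change μ r ((0 : C(Icc (0 : ℝ) T × I, ℝ)).curry r
      + B lam ((0 : C(Icc (0 : ℝ) T × I, ℝ)).curry r)) = 0
    rw [h0, B_zero, add_zero, map_zero]
  rw [Jdyn, h1]
  change μ (tT hT) ((0 : C(Icc (0 : ℝ) T × I, ℝ)).curry _)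
    - μ (t0 hT) ((0 : C(Icc (0 : ℝ) T × I, ℝ)).curry _) - _ = 0
  rw [h0, h0, map_zero, map_zero]
  simp [IccExtend]

theorem Idyn_nonneg (lam : C(I × I, ℝ)) {T : ℝ} (hT : 0 < T) (μ : D T) : 0 ≤ Idyn lam hT μ := by
  refine le_trans (le_of_eq ?_) (Jdyn_le_Idyn lam (C10.zero hT) μ)
  rw [Jdyn_zero]; rfl

/-- The two suprema in the rate function are taken independently. -/
theorem exists_lt_Jini_add_Jdyn {lam : C(I × I, ℝ)} {T : ℝ} {hT : 0 < T} {φ : C(I, ℝ)} {μ : D T}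
    {a : ℝ} (ha : (a : EReal) < Iini φ (μ (t0 hT)) + Idyn lam hT μ) :
    ∃ (H : C(I, ℝ)) (G : C10 hT), a < Jini φ H (μ (t0 hT)) + Jdyn lam G μ := by
  by_contra! hcon
  have h1 := Iini_nonneg φ (μ (t0 hT))
  have h2 := Idyn_nonneg lam hT μ
  have h3 : ∀ H : C(I, ℝ), Idyn lam hT μ ≤ ((a - Jini φ H (μ (t0 hT)) : ℝ) : EReal) := fun H =>
    iSup_le fun G => EReal.coe_le_coe_iff.2 (by
      have := hcon H G
      rw [Jdyn] at this
      linarith)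
  have h4 : Idyn lam hT μ ≠ ⊤ := ne_top_of_le_ne_top (EReal.coe_ne_top _) (h3 0)
  have h5 : Idyn lam hT μ ≠ ⊥ := ne_bot_of_le_ne_bot EReal.zero_ne_bot h2
  lift Idyn lam hT μ to ℝ using ⟨h4, h5⟩ with d hd
  have h6 : Iini φ (μ (t0 hT)) ≤ ((a - d : ℝ) : EReal) := iSup_le fun H =>
    EReal.coe_le_coe_iff.2 (by
      have := EReal.coe_le_coe_iff.1 (h3 H)
      rw [Jini] at this
      linarith)
  have h7 : Iini φ (μ (t0 hT)) + d ≤ ((a - d : ℝ) : EReal) + d := add_le_add h6 le_rfl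
  rw [← EReal.coe_add, sub_add_cancel] at h7
  exact absurd ha (not_lt.2 h7)

theorem log_div_le {p : ℝ≥0∞} {a : ℝ} {N : ℕ} (hN : 0 < N)
    (h : p ≤ ENNReal.ofReal (Real.exp (a * N))) : ENNReal.log p / (N : EReal) ≤ a := by
  have hN' : (0 : EReal) < N := by exact_mod_cast hN
  rw [EReal.div_le_iff_le_mul hN' (EReal.natCast_ne_top N)]
  refine (ENNReal.log_monotone h).trans (le_of_eq ?_)
  rw [ENNReal.log_ofReal_of_pos (Real.exp_pos _), Real.log_exp, mul_comm]
  norm_cast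

section Upper

variable {T : ℝ} {lam : C(I × I, ℝ)} {φ : C(I, ℝ)} {Ω : ℕ → Type*}
  [∀ N, MeasurableSpace (Ω N)] {P : ∀ N, Measure (Ω N)} [∀ N, IsProbabilityMeasure (P N)]
  {X : ∀ N, ℝ≥0 → Ω N → Fin N → ℕ}

/-- The exponential bound for closed sets: up to events of small probability the path belongs to a
`pathSet`, which is covered by finitely many neighbourhoods of continuous paths; each of these paths
either lies in `C`, where the exponential Chebyshev inequality applies, or has a neighbourhood that
avoids `C`. -/
theorem exists_measure_closed_le (hT : 0 < T) (hpos : ∀ p, 0 < lam p) (hφ : ∀ x, 0 ≤ φ x)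
    (hX : ∀ N, IsUrnProcess lam N (P N) (X N)) (hX0 : ∀ N, IsPoissonInitial φ N (P N) (X N 0))
    {C : Set (D T)} (hC : IsClosed C) {a : ℝ}
    (ha : ∀ μ ∈ C, (a : EReal) < Iini φ (μ (t0 hT)) + Idyn lam hT μ) :
    ∃ K : ℝ, ∀ᶠ N : ℕ in atTop,
      P N {ω | empiricalPath T (fun t => X N t ω) ((hX N).cadlag ω) ∈ C}
        ≤ ENNReal.ofReal (K * Real.exp (-(a * N))) := by
  classical
  set M : ℝ := |a| + 2 * ‖φ‖ with hMdef
  have hM : 0 ≤ M := by positivity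
  choose mj hmj hosc using fun j : ℕ =>
    exists_measure_osc_le hpos hT hM (ε := (1 / 2 : ℝ) ^ j) (by positivity) a
  set δ : ℕ → ℝ := fun j => T / mj j with hδdef
  have hδ : ∀ j, 0 < δ j := fun j => by
    have : (0 : ℝ) < mj j := by exact_mod_cast hmj j
    positivity
  have hloc : ∀ A : Icc (0 : ℝ) T × C(I, ℝ) → ℝ, ∃ (s : Finset C(I, ℝ)) (ε : ℝ), 0 < ε ∧
      ((∀ J, A ∈ pathSet T M δ J) → ∀ᶠ N : ℕ in atTop,
        P N {ω | (mass (X N 0 ω) : ℝ) ≤ M * N ∧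
          empiricalPath T (fun t => X N t ω) ((hX N).cadlag ω) ∈ C ∧ ∀ t, ∀ f ∈ s,
          |empiricalPath T (fun t => X N t ω) ((hX N).cadlag ω) t f - A (t, f)| < ε}
        ≤ ENNReal.ofReal (Real.exp (-(a * N)))) := by
    intro A
    by_cases hA : ∀ J, A ∈ pathSet T M δ J
    swap
    · exact ⟨∅, 1, one_pos, fun h => absurd h hA⟩
    by_cases hmem : toPath hδ A hA ∈ C
    · obtain ⟨H, G, hHG⟩ := exists_lt_Jini_add_Jdyn (ha _ hmem)
      obtain ⟨s, ε, hε, h⟩ := exists_measure_near_le hpos hφ hX hX0 hM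
        (continuous_toPath_curry hδ A hA) H G hHG
      refine ⟨s, ε, hε, fun _ => h.mono fun N hN => le_trans (measure_mono ?_) hN⟩
      rintro ω ⟨h1, -, h3⟩
      exact ⟨h1, h3⟩
    · have hopen : ∀ F ∈ Cᶜ, ∃ s : Finset C(I, ℝ), ∃ ε > 0, skorokhodBall F s ε ⊆ Cᶜ :=
        hC.isOpen_compl
      obtain ⟨s, ε, hε, h⟩ := hopen _ hmem
      -- a uniform neighbourhood is contained in the Skorokhod neighbourhood: take the identity as the
      -- change of time
      refine ⟨s, ε, hε, fun _ => Eventually.of_forall fun N => ?_⟩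
      rw [show {ω | (mass (X N 0 ω) : ℝ) ≤ M * N ∧
          empiricalPath T (fun t => X N t ω) ((hX N).cadlag ω) ∈ C ∧ ∀ t, ∀ f ∈ s,
          |empiricalPath T (fun t => X N t ω) ((hX N).cadlag ω) t f - A (t, f)| < ε} = ∅ from ?_]
      · simp
      refine eq_empty_of_forall_notMem fun ω hω => h ?_ hω.2.1
      exact ⟨OrderIso.refl _, fun t => by simpa using hε, hω.2.2⟩
  choose s ε hε hse using hloc
  obtain ⟨F, J, hF, hcov⟩ := exists_finite_cover hT (M := M) hδ s ε hε
  refine ⟨1 + ∑ j ∈ Finset.range J, (mj j : ℝ) + F.card, ?_⟩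
  have hFev : ∀ᶠ N : ℕ in atTop, ∀ A ∈ F,
        P N {ω | (mass (X N 0 ω) : ℝ) ≤ M * N ∧
          empiricalPath T (fun t => X N t ω) ((hX N).cadlag ω) ∈ C ∧ ∀ t, ∀ f ∈ s A,
          |empiricalPath T (fun t => X N t ω) ((hX N).cadlag ω) t f - A (t, f)| < ε A}
        ≤ ENNReal.ofReal (Real.exp (-(a * N))) :=
    (Finset.eventually_all F).2 fun A hA => hse A (hF A hA)
  filter_upwards [hFev, eventually_gt_atTop 0] with N hN hNpos
  have hN' : (0 : ℝ) < N := by exact_mod_cast hNpos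
  obtain ⟨ℱ, hℱ⟩ := (hX N).martingale
  have hMP : SolvesMartingaleProblem lam (P N) (X N) ℱ := hℱ
  -- too many balls; a large oscillation at the scale `j`; a path of `C` close to `A`
  set E₁ : Set (Ω N) := {ω | M * N < mass (X N 0 ω)} with hE₁
  set E₂ : ℕ → Set (Ω N) := fun j => {ω | (mass (X N 0 ω) : ℝ) ≤ M * N ∧ ∃ s t : ℝ≥0, s ≤ t ∧
    (t : ℝ) ≤ T ∧ (t : ℝ) ≤ s + T / mj j ∧ (1 / 2 : ℝ) ^ j * N ≤ dist1 (X N s ω) (X N t ω)} with hE₂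
  set E₃ : (Icc (0 : ℝ) T × C(I, ℝ) → ℝ) → Set (Ω N) := fun A => {ω | (mass (X N 0 ω) : ℝ) ≤ M * N ∧
    empiricalPath T (fun t => X N t ω) ((hX N).cadlag ω) ∈ C ∧ ∀ t, ∀ f ∈ s A,
      |empiricalPath T (fun t => X N t ω) ((hX N).cadlag ω) t f - A (t, f)| < ε A} with hE₃
  set E := {ω | empiricalPath T (fun t => X N t ω) ((hX N).cadlag ω) ∈ C} with hE
  have hP₁ : P N E₁ ≤ ENNReal.ofReal (Real.exp (-(a * N))) := by
    refine (measure_mass_gt_le hφ ((hX N).measurable 0) (hX0 N) |a|).trans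
      (ENNReal.ofReal_le_ofReal (Real.exp_le_exp.2 ?_))
    exact neg_le_neg (mul_le_mul_of_nonneg_right (le_abs_self a) hN'.le)
  have hP₂ : ∀ j, P N (E₂ j) ≤ ENNReal.ofReal (mj j * Real.exp (-(a * N))) := fun j =>
    hosc j (mj j) le_rfl N (Ω N) (P N) (X N) ℱ (hX N) hMP
  have hdist : ∀ᵐ ω ∂(P N), ω ∈ E → ω ∈ E₁ ∪ (⋃ j ∈ Finset.range J, E₂ j) ∪ ⋃ A ∈ F, E₃ A := by
    filter_upwards [ae_forall_mass_le (hX N) hMP] with ω hω hωE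
    by_cases h1 : ω ∈ E₁
    · exact Or.inl (Or.inl h1)
    by_cases h2 : ω ∈ ⋃ j ∈ Finset.range J, E₂ j
    · exact Or.inl (Or.inr h2)
    refine Or.inr ?_
    have hmass : (mass (X N 0 ω) : ℝ) ≤ M * N := not_lt.1 h1
    simp only [mem_iUnion, not_exists] at h2
    set ν := empiricalPath T (fun t => X N t ω) ((hX N).cadlag ω) with hν
    have hosc' : ∀ j < J, ∀ s t : Icc (0 : ℝ) T, (s : ℝ) ≤ t → |(s : ℝ) - t| ≤ δ j → ∀ f,
        |ν s f - ν t f| ≤ (1 / 2) ^ j * ‖f‖ := by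
      intro j hj s t hst hd f
      have h3 : ¬ ((1 / 2 : ℝ) ^ j * N ≤ dist1 (X N (s : ℝ).toNNReal ω) (X N (t : ℝ).toNNReal ω)) :=
        fun h => h2 j (Finset.mem_range.2 hj) ⟨hmass, _, _, Real.toNNReal_le_toNNReal hst, by
          rw [Real.coe_toNNReal _ t.2.1]; exact t.2.2, by
          rw [Real.coe_toNNReal _ t.2.1, Real.coe_toNNReal _ s.2.1]
          have := (abs_le.1 hd).1
          simp only [hδdef] at this
          linarith, h⟩
      have h4 := abs_avgc_sub_le (X N (s : ℝ).toNNReal ω) (X N (t : ℝ).toNNReal ω)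
        (f := fun i => f (node i)) (c := ‖f‖) (fun i => f.norm_coe_le_norm _)
      rw [← empirical_eq_avgc, ← empirical_eq_avgc] at h4
      refine h4.trans ?_
      gcongr
      rw [one_div, inv_mul_le_iff₀ hN', mul_comm]
      exact (not_le.1 h3).le
    have hpath : (fun p : Icc (0 : ℝ) T × C(I, ℝ) => ν p.1 p.2) ∈ pathSet T M δ J := by
      refine ⟨fun t f g => map_add _ _ _, fun t c f => map_smul _ _ _, fun t f => ?_, ?_⟩
      · change |empirical (X N (t : ℝ).toNNReal ω) f| ≤ _
        rw [empirical_eq_avgc]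
        exact abs_avgc_le hM (norm_nonneg _)
          (le_trans (by exact_mod_cast hω (t : ℝ).toNNReal) hmass) fun i => f.norm_coe_le_norm _
      · intro j hj s t hd f
        rcases le_total (s : ℝ) t with h | h
        · exact hosc' j hj s t h hd f
        · rw [abs_sub_comm]
          exact hosc' j hj t s h (by rwa [abs_sub_comm]) f
    obtain ⟨A, hA, hnear⟩ := hcov _ hpath
    exact mem_iUnion₂.2 ⟨A, hA, hmass, hωE, hnear⟩
  calc P N E ≤ P N (E₁ ∪ (⋃ j ∈ Finset.range J, E₂ j) ∪ ⋃ A ∈ F, E₃ A) := measure_mono_ae hdist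
    _ ≤ P N E₁ + ∑ j ∈ Finset.range J, P N (E₂ j) + ∑ A ∈ F, P N (E₃ A) := by
        refine (measure_union_le _ _).trans ?_
        refine add_le_add ((measure_union_le _ _).trans ?_) (measure_biUnion_finset_le _ _)
        exact add_le_add le_rfl (measure_biUnion_finset_le _ _)
    _ ≤ ENNReal.ofReal (Real.exp (-(a * N)))
        + ∑ j ∈ Finset.range J, ENNReal.ofReal (mj j * Real.exp (-(a * N)))
        + ∑ A ∈ F, ENNReal.ofReal (Real.exp (-(a * N))) := by
        gcongr with j _ A hA
        · exact hP₂ j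
        · exact hN A hA
    _ = _ := by
        rw [← ENNReal.ofReal_sum_of_nonneg (fun _ _ => by positivity),
          ← ENNReal.ofReal_sum_of_nonneg (fun _ _ => by positivity),
          ← ENNReal.ofReal_add (by positivity) (Finset.sum_nonneg fun _ _ => by positivity),
          ← ENNReal.ofReal_add (by positivity) (by positivity)]
        congr 1
        rw [Finset.sum_const, nsmul_eq_mul, ← Finset.sum_mul]
        ring

/-- The upper bound of the large deviation principle. -/
theorem limsup_log_measure_le (hT : 0 < T) (hpos : ∀ p, 0 < lam p) (hφ : ∀ x, 0 ≤ φ x)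
    (hX : ∀ N, IsUrnProcess lam N (P N) (X N)) (hX0 : ∀ N, IsPoissonInitial φ N (P N) (X N 0))
    {C : Set (D T)} (hC : IsClosed C) :
    limsup (fun N : ℕ => ENNReal.log (P N {ω | empiricalPath T (fun t => X N t ω)
          ((hX N).cadlag ω) ∈ C}) / (N : EReal)) atTop
        ≤ -(⨅ μ ∈ C, (Iini φ (μ (t0 hT)) + Idyn lam hT μ)) := by
  refine le_of_forall_gt_imp_ge_of_dense fun b hb => ?_
  obtain ⟨r, hr1, hr2⟩ := EReal.lt_iff_exists_real_btwn.1 hb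
  obtain ⟨r', hr3, hr4⟩ := EReal.lt_iff_exists_real_btwn.1 hr1
  have hrr : r' < r := EReal.coe_lt_coe_iff.1 hr4
  have ha : ∀ μ ∈ C, ((-r' : ℝ) : EReal) < Iini φ (μ (t0 hT)) + Idyn lam hT μ := by
    intro μ hμ
    have h : ((-r' : ℝ) : EReal) < ⨅ μ ∈ C, (Iini φ (μ (t0 hT)) + Idyn lam hT μ) := by
      rw [EReal.coe_neg]
      exact EReal.neg_lt_comm.1 hr3
    exact lt_of_lt_of_le h (iInf₂_le μ hμ)
  obtain ⟨K, hK⟩ := exists_measure_closed_le hT hpos hφ hX hX0 hC ha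
  refine le_trans ?_ hr2.le
  have hlim : Tendsto (fun N : ℕ => K * Real.exp (-((r - r') * N))) atTop (𝓝 (K * 0)) := by
    refine Tendsto.const_mul K (Real.tendsto_exp_neg_atTop_nhds_zero.comp ?_)
    exact tendsto_natCast_atTop_atTop.const_mul_atTop (sub_pos.2 hrr)
  rw [mul_zero] at hlim
  refine limsup_le_of_le (by isBoundedDefault) ?_
  filter_upwards [hK, eventually_gt_atTop 0, hlim.eventually (gt_mem_nhds one_pos)] with N h1 h2 h3
  refine log_div_le h2 (h1.trans (ENNReal.ofReal_le_ofReal ?_))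
  have e : Real.exp (-(-r' * N)) = Real.exp (-((r - r') * N)) * Real.exp (r * N) := by
    rw [← Real.exp_add]; congr 1; ring
  rw [e, ← mul_assoc]
  exact mul_le_of_le_one_left (Real.exp_pos _).le h3.le

end Upper

/-! ### Densities and the cost functionals -/

theorem integral_pos_of_continuous {f : I → ℝ} (hf : Continuous f) (h0 : ∀ x, 0 ≤ f x) {x₀ : I}
    (hx₀ : 0 < f x₀) : 0 < ∫ x : I, f x := by
  have h := integral_unitInterval_eq ⟨f, hf⟩
  simp only [ContinuousMap.coe_mk] at h
  rw [h]
  refine intervalIntegral.integral_pos zero_lt_one (hf.Icc_extend'.continuousOn)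
    (fun x _ => h0 _) ⟨x₀, x₀.2, ?_⟩
  rw [IccExtend_val]
  exact hx₀

theorem abs_integral_unitInterval_le {f : I → ℝ} {c : ℝ} (h : ∀ x, |f x| ≤ c) :
    |∫ x : I, f x| ≤ c := by
  have := norm_integral_le_of_norm_le_const (μ := (volume : Measure I)) (f := f) (C := c)
    (Eventually.of_forall h)
  simpa using this

theorem continuous_integral_unitInterval {Y : Type*} [PseudoMetricSpace Y] [CompactSpace Y]
    {F : Y → I → ℝ} (hF : Continuous F.uncurry) : Continuous fun y => ∫ x : I, F y x := by
  have h := continuous_parametric_integral_of_continuous (μ := (volume : Measure I)) hF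
    isCompact_univ
  simpa using h

section Densities

variable {T : ℝ} {hT : 0 < T}

/-- Linear combinations in `C^{1,0}`. -/
def C10.lin (a b : ℝ) (ψ χ : C10 hT) : C10 hT where
  val := a • ψ.val + b • χ.val
  dt := a • ψ.dt + b • χ.dt
  hasDeriv := fun t x => ((ψ.hasDeriv t x).const_mul a).add ((χ.hasDeriv t x).const_mul b)

/-- Integration by parts in time. -/
theorem integral_mul_sub_integral_mul (ψ G : C10 hT) (t : Icc (0 : ℝ) T) :
    (∫ x : I, G.val (t, x) * ψ.val (t, x)) - ∫ x : I, G.val (t0 hT, x) * ψ.val (t0 hT, x)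
      = ∫ s in (0 : ℝ)..t, IccExtend hT.le
        (fun r => ∫ x : I, (G.dt (r, x) * ψ.val (r, x) + G.val (r, x) * ψ.dt (r, x))) s := by
  set F : ℝ → I → ℝ := fun s x => G.dt (projIcc 0 T hT.le s, x) * ψ.val (projIcc 0 T hT.le s, x)
    + G.val (projIcc 0 T hT.le s, x) * ψ.dt (projIcc 0 T hT.le s, x) with hF
  have hproj : Continuous (projIcc 0 T hT.le) := continuous_projIcc
  have hFc : Continuous F.uncurry := by
    unfold Function.uncurry
    simp only [hF]
    fun_prop
  have h1 : ∀ x : I, ∫ s in (0 : ℝ)..t, F s x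
      = G.val (t, x) * ψ.val (t, x) - G.val (t0 hT, x) * ψ.val (t0 hT, x) := by
    intro x
    have hc : ∀ f : C(Icc (0 : ℝ) T × I, ℝ), Continuous (IccExtend hT.le fun s => f (s, x)) :=
      fun f => Continuous.Icc_extend' (by fun_prop)
    have hsub : ∀ s ∈ Ioo (0 : ℝ) t, s ∈ Ioo (0 : ℝ) T := fun s hs => ⟨hs.1, hs.2.trans_le t.2.2⟩
    have h := intervalIntegral.integral_eq_sub_of_hasDeriv_right_of_le
      (f := fun s => IccExtend hT.le (fun s => G.val (s, x)) s
        * IccExtend hT.le (fun s => ψ.val (s, x)) s) (f' := fun s => F s x)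
      (a := 0) (b := t) t.2.1 (((hc _).mul (hc _)).continuousOn) (fun s hs => by
        have hs' := Ioo_subset_Icc_self (hsub s hs)
        have hn : Icc (0 : ℝ) T ∈ 𝓝 s := Icc_mem_nhds (hsub s hs).1 (hsub s hs).2
        have d1 := (G.hasDeriv ⟨s, hs'⟩ x).hasDerivAt hn
        have d2 := (ψ.hasDeriv ⟨s, hs'⟩ x).hasDerivAt hn
        have d3 := (d1.mul d2).hasDerivWithinAt (s := Ioi s)
        simp only [IccExtend_of_mem _ _ hs'] at d3
        have e : F s x = G.dt (⟨s, hs'⟩, x) * ψ.val (⟨s, hs'⟩, x)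
            + G.val (⟨s, hs'⟩, x) * ψ.dt (⟨s, hs'⟩, x) := by
          simp only [hF, projIcc_of_mem hT.le hs']
        rw [e]
        exact d3)
      ((hFc.comp (Continuous.prodMk continuous_id continuous_const)).intervalIntegrable _ _)
    rw [h, IccExtend_of_mem _ _ t.2, IccExtend_of_mem _ _ t.2,
      IccExtend_of_mem _ _ (left_mem_Icc.2 hT.le), IccExtend_of_mem _ _ (left_mem_Icc.2 hT.le)]
    rfl
  rw [← integral_sub (integrable_of_continuous (by fun_prop))
    (integrable_of_continuous (by fun_prop))]
  simp_rw [← h1]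
  rw [← intervalIntegral_integral_swap]
  · rfl
  · have hK : IsCompact (uIcc (0 : ℝ) t ×ˢ (univ : Set I)) := isCompact_uIcc.prod isCompact_univ
    have h2 : IntegrableOn F.uncurry (uIcc (0 : ℝ) t ×ˢ (univ : Set I))
        ((volume : Measure ℝ).prod (volume : Measure I)) := hFc.continuousOn.integrableOn_compact hK
    rw [IntegrableOn, ← Measure.prod_restrict, Measure.restrict_univ] at h2
    exact h2.mono_measure (Measure.prod_mono (Measure.restrict_mono uIoc_subset_uIcc le_rfl) le_rfl)

/-- The variational functional `Jini` of the initial state, for a density. -/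
def costIni (φ H ψ₀ : C(I, ℝ)) : ℝ := (∫ x : I, H x * ψ₀ x) - ∫ x : I, φ x * (Real.exp (H x) - 1)

/-- The variational functional `Jdyn` of the dynamics, for a density. -/
def costDyn (lam : C(I × I, ℝ)) (G : C10 hT) (ψ : C(Icc (0 : ℝ) T × I, ℝ)) : ℝ :=
  (∫ x : I, G.val (tT hT, x) * ψ (tT hT, x)) - (∫ x : I, G.val (t0 hT, x) * ψ (t0 hT, x))
    - ∫ s in (0 : ℝ)..T, IccExtend hT.le (fun r => ∫ x : I, dtB lam G (r, x) * ψ (r, x)) s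

theorem Jini_eq_costIni {φ H ψ₀ : C(I, ℝ)} {ν : S} (hν : ν H = ∫ x : I, H x * ψ₀ x) :
    Jini φ H ν = costIni φ H ψ₀ := by
  rw [Jini, hν]; rfl

theorem Jdyn_eq_costDyn {lam : C(I × I, ℝ)} {G : C10 hT} {ψ : C(Icc (0 : ℝ) T × I, ℝ)} {μ : D T}
    (hμ : ∀ (t : Icc (0 : ℝ) T) (f : C(I, ℝ)), μ t f = ∫ x : I, f x * ψ (t, x)) :
    Jdyn lam G μ = costDyn lam G ψ := by
  simp only [Jdyn, hμ]; rfl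

theorem continuous_integral_mul (f g : C(Icc (0 : ℝ) T × I, ℝ)) :
    Continuous fun r => ∫ x : I, f (r, x) * g (r, x) :=
  continuous_integral_unitInterval (F := fun r x => f (r, x) * g (r, x))
    (by unfold Function.uncurry; fun_prop)

theorem integral_mul_lin {f g h : I → ℝ} (hf : Continuous f) (hg : Continuous g)
    (hh : Continuous h) (a b : ℝ) :
    ∫ x : I, f x * (a * g x + b * h x) = a * (∫ x : I, f x * g x) + b * ∫ x : I, f x * h x := by
  rw [← integral_const_mul, ← integral_const_mul, ← integral_add
    (integrable_of_continuous (by fun_prop)) (integrable_of_continuous (by fun_prop))]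
  refine integral_congr_ae (Eventually.of_forall fun x => ?_)
  simp only
  ring

theorem costDyn_lin (lam : C(I × I, ℝ)) (G : C10 hT) (ψ χ : C(Icc (0 : ℝ) T × I, ℝ)) (a b : ℝ) :
    costDyn lam G (a • ψ + b • χ) = a * costDyn lam G ψ + b * costDyn lam G χ := by
  have h : ∀ (W : C(Icc (0 : ℝ) T × I, ℝ)) (r : Icc (0 : ℝ) T),
      ∫ x : I, W (r, x) * (a • ψ + b • χ) (r, x)
        = a * (∫ x : I, W (r, x) * ψ (r, x)) + b * ∫ x : I, W (r, x) * χ (r, x) := fun W r =>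
    integral_mul_lin (by fun_prop) (by fun_prop) (by fun_prop) a b
  have h1 : ∫ s in (0 : ℝ)..T, IccExtend hT.le
        (fun r => ∫ x : I, dtB lam G (r, x) * (a • ψ + b • χ) (r, x)) s
      = a * (∫ s in (0 : ℝ)..T, IccExtend hT.le
        (fun r => ∫ x : I, dtB lam G (r, x) * ψ (r, x)) s)
      + b * ∫ s in (0 : ℝ)..T, IccExtend hT.le
        (fun r => ∫ x : I, dtB lam G (r, x) * χ (r, x)) s := by
    rw [← intervalIntegral.integral_const_mul, ← intervalIntegral.integral_const_mul,
      ← intervalIntegral.integral_add]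
    · simp only [h]; rfl
    · exact (continuous_const.mul
        (continuous_integral_mul _ _).Icc_extend').intervalIntegrable _ _
    · exact (continuous_const.mul
        (continuous_integral_mul _ _).Icc_extend').intervalIntegrable _ _
  rw [costDyn, costDyn, costDyn, h1, h G.val, h G.val]
  ring

theorem costIni_lin (φ H ψ χ : C(I, ℝ)) {a b : ℝ} (hab : a + b = 1) :
    costIni φ H (a • ψ + b • χ) = a * costIni φ H ψ + b * costIni φ H χ := by
  have h : ∫ x : I, H x * (a • ψ + b • χ) x = a * (∫ x : I, H x * ψ x) + b * ∫ x : I, H x * χ x :=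
    integral_mul_lin (by fun_prop) (by fun_prop) (by fun_prop) a b
  rw [costIni, costIni, costIni, h]
  generalize (∫ x : I, φ x * (Real.exp (H x) - 1)) = c
  linear_combination c * hab

/-- The initial state `φ` is free of cost. -/
theorem costIni_self_le {φ : C(I, ℝ)} (hφ : ∀ x, 0 ≤ φ x) (H : C(I, ℝ)) : costIni φ H φ ≤ 0 := by
  rw [costIni, sub_nonpos]
  refine integral_mono (integrable_of_continuous (by fun_prop))
    (integrable_of_continuous (by fun_prop)) fun x => ?_
  have := Real.add_one_le_exp (H x)
  have := hφ x
  simp only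
  nlinarith

/-- The density, started from `φ`, of independent particles that are resampled uniformly at rate
`1`. -/
def relax (hT : 0 < T) (φ : C(I, ℝ)) : C10 hT where
  val := ⟨fun p => Real.exp (-(p.1 : ℝ)) * φ p.2 + (1 - Real.exp (-(p.1 : ℝ))) * ∫ y : I, φ y,
    by fun_prop⟩
  dt := ⟨fun p => Real.exp (-(p.1 : ℝ)) * ((∫ y : I, φ y) - φ p.2), by fun_prop⟩
  hasDeriv := fun t x => by
    have h1 : HasDerivAt (fun s : ℝ => Real.exp (-s)) (-Real.exp (-(t : ℝ))) (t : ℝ) := by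
      simpa using (hasDerivAt_neg (t : ℝ)).exp
    have h2 := ((h1.mul_const (φ x)).add ((h1.const_sub 1).mul_const (∫ y : I, φ y)))
    have h3 := h2.hasDerivWithinAt (s := Icc 0 T)
    refine (h3.congr_of_mem (fun s hs => ?_) t.2).congr_deriv ?_
    · rw [IccExtend_of_mem _ _ hs]; rfl
    · simp only [ContinuousMap.coe_mk]; ring

theorem relax_dt (φ : C(I, ℝ)) (p : Icc (0 : ℝ) T × I) :
    (relax hT φ).dt p = (∫ y : I, φ y) - (relax hT φ).val p := by
  simp only [relax, ContinuousMap.coe_mk]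
  ring

theorem relax_zero (φ : C(I, ℝ)) (x : I) : (relax hT φ).val (t0 hT, x) = φ x := by
  simp [relax, t0]

theorem integral_relax (φ : C(I, ℝ)) (t : Icc (0 : ℝ) T) :
    ∫ x : I, (relax hT φ).val (t, x) = ∫ y : I, φ y := by
  simp only [relax, ContinuousMap.coe_mk]
  rw [integral_add (integrable_of_continuous (by fun_prop)) (integrable_const _),
    integral_const_mul, integral_const]
  simp
  ring

theorem relax_nonneg {φ : C(I, ℝ)} (hφ : ∀ x, 0 ≤ φ x) (p : Icc (0 : ℝ) T × I) :
    0 ≤ (relax hT φ).val p := by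
  have h1 : Real.exp (-(p.1 : ℝ)) ≤ 1 := Real.exp_le_one_iff.2 (neg_nonpos.2 p.1.2.1)
  have h2 : 0 ≤ ∫ y : I, φ y := integral_nonneg hφ
  have := mul_nonneg (Real.exp_pos (-(p.1 : ℝ))).le (hφ p.2)
  have := mul_nonneg (sub_nonneg.2 h1) h2
  simp only [relax, ContinuousMap.coe_mk]
  linarith

/-- The relaxed density can vanish only at the initial time, and there it increases. -/
theorem relax_pos_or {φ : C(I, ℝ)} (hφ : ∀ x, 0 ≤ φ x) (hm : 0 < ∫ y : I, φ y)
    (p : Icc (0 : ℝ) T × I) :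
    0 < (relax hT φ).val p ∨ p.1 = t0 hT ∧ 0 < (relax hT φ).dt p := by
  rcases (relax_nonneg (hT := hT) hφ p).eq_or_lt with h | h
  · refine Or.inr ⟨?_, ?_⟩
    · by_contra hne
      have ht : 0 < (p.1 : ℝ) := lt_of_le_of_ne p.1.2.1 fun h => hne (Subtype.ext h.symm)
      have h1 : Real.exp (-(p.1 : ℝ)) < 1 := Real.exp_lt_one_iff.2 (neg_lt_zero.2 ht)
      have h2 := mul_nonneg (Real.exp_pos (-(p.1 : ℝ))).le (hφ p.2)
      have h3 := mul_pos (sub_pos.2 h1) hm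
      simp only [relax, ContinuousMap.coe_mk] at h
      linarith
    · rw [relax_dt, ← h, sub_zero]
      exact hm
  · exact Or.inl h

/-- Comparison of `B` with the linear generator of the uniform resampling, from
`λ (e ^ u - 1) ≥ u + log λ + 1 - λ`. -/
theorem exists_sub_le_Bmap {lam : C(I × I, ℝ)} (hpos : ∀ p, 0 < lam p) : ∃ c : ℝ, 0 ≤ c ∧
    ∀ (g : C(Icc (0 : ℝ) T × I, ℝ)) (t : Icc (0 : ℝ) T) (x : I),
      (∫ y : I, g (t, y)) - g (t, x) - c ≤ Bmap lam g (t, x) := by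
  have hc : Continuous fun p => lam p - Real.log (lam p) :=
    lam.continuous.sub (lam.continuous.log fun p => (hpos p).ne')
  obtain ⟨c, h⟩ := (isCompact_univ (X := I × I)).bddAbove_image hc.continuousOn
  refine ⟨max c 0, le_max_right _ _, fun g t x => ?_⟩
  have h1 : ∀ y : I, g (t, y) - (g (t, x) + max c 0)
      ≤ lam (x, y) * (Real.exp (g (t, y) - g (t, x)) - 1) := by
    intro y
    have h2 : lam (x, y) - Real.log (lam (x, y)) ≤ max c 0 :=
      (h (mem_image_of_mem _ (mem_univ (x, y)))).trans (le_max_left _ _)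
    have h3 := Real.add_one_le_exp (g (t, y) - g (t, x) + Real.log (lam (x, y)))
    rw [Real.exp_add, Real.exp_log (hpos _)] at h3
    linarith
  rw [Bmap_apply]
  refine le_trans (le_of_eq ?_) (integral_mono (integrable_of_continuous (by fun_prop))
    (integrable_of_continuous (by fun_prop)) h1)
  rw [integral_sub (integrable_of_continuous (by fun_prop)) (integrable_const _), integral_const]
  simp
  ring

/-- The relaxation to equilibrium has a finite dynamic cost. -/
theorem exists_costDyn_relax_le {lam : C(I × I, ℝ)} (hpos : ∀ p, 0 < lam p) {φ : C(I, ℝ)}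
    (hφ : ∀ x, 0 ≤ φ x) : ∃ c : ℝ, ∀ G : C10 hT, costDyn lam G (relax hT φ).val ≤ c := by
  obtain ⟨c, hc, h⟩ := exists_sub_le_Bmap (T := T) hpos
  set ρ := relax hT φ with hρ
  set m := ∫ y : I, φ y with hm
  refine ⟨∫ s in (0 : ℝ)..T, c * m, fun G => ?_⟩
  have hint : ∀ F : C(Icc (0 : ℝ) T × I, ℝ), Continuous fun r => ∫ x : I, F (r, x) := fun F =>
    continuous_integral_unitInterval (F := fun r x => F (r, x))
      (by unfold Function.uncurry; fun_prop)
  have e := integral_mul_sub_integral_mul ρ G (tT hT)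
  rw [costDyn, e]
  change (∫ s in (0 : ℝ)..T, _) - _ ≤ _
  have c0 : Continuous fun r => ∫ x : I, (G.dt (r, x) * ρ.val (r, x) + G.val (r, x) * ρ.dt (r, x)) :=
    hint (G.dt * ρ.val + G.val * ρ.dt)
  have c1 := c0.Icc_extend' (h := hT.le)
  have c2 := (continuous_integral_mul (dtB lam G) ρ.val).Icc_extend' (h := hT.le)
  rw [← intervalIntegral.integral_sub (c1.intervalIntegrable _ _) (c2.intervalIntegrable _ _)]
  refine intervalIntegral.integral_mono_on hT.le ((c1.sub c2).intervalIntegrable _ _)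
    (intervalIntegrable_const) fun s hs => ?_
  rw [IccExtend_of_mem _ _ hs, IccExtend_of_mem _ _ hs]
  set r : Icc (0 : ℝ) T := ⟨s, hs⟩
  rw [← integral_sub (integrable_of_continuous (by fun_prop))
    (integrable_of_continuous (by fun_prop))]
  have h3 : ∀ x : I, G.dt (r, x) * ρ.val (r, x) + G.val (r, x) * ρ.dt (r, x)
      - dtB lam G (r, x) * ρ.val (r, x)
      ≤ m * G.val (r, x) + (c - ∫ y : I, G.val (r, y)) * ρ.val (r, x) := by
    intro x
    have h4 := mul_le_mul_of_nonneg_right (h G.val r x) (relax_nonneg (hT := hT) hφ (r, x))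
    rw [relax_dt, dtB, ContinuousMap.add_apply]
    linarith
  refine (integral_mono (integrable_of_continuous (by fun_prop))
    (integrable_of_continuous (by fun_prop)) h3).trans (le_of_eq ?_)
  rw [integral_add (integrable_of_continuous (by fun_prop))
    (integrable_of_continuous (by fun_prop)), integral_const_mul, integral_const_mul, integral_relax]
  ring

/-- The mass of a density is conserved if its time derivative has mean `0`. -/
theorem integral_val_eq (ψ : C10 hT) (h : ∀ s : Icc (0 : ℝ) T, ∫ x : I, ψ.dt (s, x) = 0)
    (t : Icc (0 : ℝ) T) : ∫ x : I, ψ.val (t, x) = ∫ x : I, ψ.val (t0 hT, x) := by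
  set G : C10 hT := ⟨1, 0, fun t x => by
    have : (IccExtend hT.le fun s : Icc (0 : ℝ) T => (1 : C(Icc (0 : ℝ) T × I, ℝ)) (s, x))
        = fun _ => 1 := rfl
    rw [this]
    exact hasDerivWithinAt_const _ _ _⟩ with hG
  have e := integral_mul_sub_integral_mul ψ G t
  have h1 : (fun r => ∫ x : I, (G.dt (r, x) * ψ.val (r, x) + G.val (r, x) * ψ.dt (r, x)))
      = fun _ => (0 : ℝ) := by
    funext r
    refine Eq.trans ?_ (h r)
    simp [hG]
  rw [h1] at e
  simp only [hG, ContinuousMap.one_apply, one_mul] at e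
  have h2 : IccExtend hT.le (fun _ : Icc (0 : ℝ) T => (0 : ℝ)) = fun _ => 0 := rfl
  rw [h2] at e
  simp only [intervalIntegral.integral_zero] at e
  linarith

end Densities

/-! ### The control of a density for rates of product form -/

section Control

/-- The equation `∫ sqrt (p ^ 2 + q k) = 2 k` has a unique positive solution `k`, since the left side
divided by `k` is strictly decreasing. -/
theorem exists_root {p q : I → ℝ} (hp : Continuous p) (hq : Continuous q) (hq0 : ∀ x, 0 ≤ q x)
    {x₀ : I} (hx₀ : 0 < q x₀) :
    ∃ k : ℝ, 0 < k ∧ (∫ x : I, Real.sqrt (p x ^ 2 + q x * k)) = 2 * k ∧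
      (∀ j, 0 < j → j < k → 2 * j < ∫ x : I, Real.sqrt (p x ^ 2 + q x * j)) ∧
      ∀ j, k < j → (∫ x : I, Real.sqrt (p x ^ 2 + q x * j)) < 2 * j := by
  have hmono : ∀ a b : ℝ, 0 < a → a < b → a * (∫ x : I, Real.sqrt (p x ^ 2 + q x * b))
      < b * ∫ x : I, Real.sqrt (p x ^ 2 + q x * a) := by
    intro a b ha hab
    have hb : 0 < b := ha.trans hab
    have e : ∀ (c d : ℝ) (x : I), 0 < c → c * Real.sqrt (p x ^ 2 + q x * d)
        = Real.sqrt (c ^ 2 * (p x ^ 2 + q x * d)) := fun c d x hc => by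
      rw [Real.sqrt_mul (sq_nonneg c), Real.sqrt_sq hc.le]
    have hle : ∀ x, a ^ 2 * (p x ^ 2 + q x * b) ≤ b ^ 2 * (p x ^ 2 + q x * a) := fun x => by
      have h1 : 0 ≤ p x ^ 2 * ((b - a) * (b + a)) :=
        mul_nonneg (sq_nonneg _) (mul_nonneg (sub_pos.2 hab).le (by linarith))
      have h2 : 0 ≤ q x * (a * b * (b - a)) :=
        mul_nonneg (hq0 x) (mul_nonneg (by positivity) (sub_pos.2 hab).le)
      nlinarith
    rw [← integral_const_mul, ← integral_const_mul, ← sub_pos, ← integral_sub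
      (integrable_of_continuous (by fun_prop)) (integrable_of_continuous (by fun_prop))]
    refine integral_pos_of_continuous (by fun_prop) (fun x => ?_) (x₀ := x₀) ?_
    · rw [e _ _ _ ha, e _ _ _ hb, sub_nonneg]
      exact Real.sqrt_le_sqrt (hle x)
    · rw [e _ _ _ ha, e _ _ _ hb, sub_pos]
      refine Real.sqrt_lt_sqrt (mul_nonneg (sq_nonneg _)
        (add_nonneg (sq_nonneg _) (mul_nonneg hx₀.le hb.le))) ?_
      have h1 : 0 ≤ p x₀ ^ 2 * ((b - a) * (b + a)) :=
        mul_nonneg (sq_nonneg _) (mul_nonneg (sub_pos.2 hab).le (by linarith))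
      have h2 : 0 < q x₀ * (a * b * (b - a)) :=
        mul_pos hx₀ (mul_pos (by positivity) (sub_pos.2 hab))
      nlinarith
  have hcont : Continuous fun k : ℝ => (∫ x : I, Real.sqrt (p x ^ 2 + q x * k)) - 2 * k := by
    refine Continuous.sub ?_ (by fun_prop)
    have h := continuous_parametric_integral_of_continuous (μ := (volume : Measure I))
      (f := fun (k : ℝ) (x : I) => Real.sqrt (p x ^ 2 + q x * k))
      (by unfold Function.uncurry; fun_prop) isCompact_univ
    simpa using h
  -- near `0` the square root dominates
  set c : ℝ := ∫ x : I, Real.sqrt (q x) with hc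
  have hc0 : 0 < c := integral_pos_of_continuous (by fun_prop) (fun x => Real.sqrt_nonneg _)
    (Real.sqrt_pos.2 hx₀)
  have hlow : 0 ≤ (∫ x : I, Real.sqrt (p x ^ 2 + q x * (c / 2) ^ 2)) - 2 * (c / 2) ^ 2 := by
    have h1 : (∫ x : I, Real.sqrt (q x) * (c / 2)) ≤ ∫ x : I, Real.sqrt (p x ^ 2 + q x * (c / 2) ^ 2) := by
      refine integral_mono (integrable_of_continuous (by fun_prop))
        (integrable_of_continuous (by fun_prop)) fun x => ?_
      have e : Real.sqrt (q x) * (c / 2) = Real.sqrt (q x * (c / 2) ^ 2) := by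
        rw [Real.sqrt_mul (hq0 x), Real.sqrt_sq (by positivity)]
      simp only [e]
      exact Real.sqrt_le_sqrt (by nlinarith [sq_nonneg (p x)])
    rw [integral_mul_const] at h1
    nlinarith
  obtain ⟨R, hR⟩ := (isCompact_univ (X := I)).bddAbove_image
    (f := fun x => |p x| + Real.sqrt (q x)) (by fun_prop)
  have hR' : ∀ x, |p x| + Real.sqrt (q x) ≤ R := fun x => hR (mem_image_of_mem _ (mem_univ x))
  have hR0 : 0 ≤ R := le_trans (by positivity) (hR' x₀)
  set b : ℝ := R + c + 1 with hb
  have hhigh : (∫ x : I, Real.sqrt (p x ^ 2 + q x * b ^ 2)) - 2 * b ^ 2 ≤ 0 := by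
    have h1 : ∫ x : I, Real.sqrt (p x ^ 2 + q x * b ^ 2) ≤ R * b := by
      refine (le_abs_self _).trans (abs_integral_unitInterval_le fun x => ?_)
      rw [abs_of_nonneg (Real.sqrt_nonneg _)]
      have hb1 : 1 ≤ b := by linarith
      have hsq := Real.sq_sqrt (hq0 x)
      refine Real.sqrt_le_iff.2 ⟨by positivity, ?_⟩
      have h3 : p x ^ 2 + q x * b ^ 2 ≤ ((|p x| + Real.sqrt (q x)) * b) ^ 2 := by
        have h4 : p x ^ 2 ≤ |p x| ^ 2 * b ^ 2 := by
          rw [sq_abs]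
          exact le_mul_of_one_le_right (sq_nonneg _) (by nlinarith)
        have h5 : 0 ≤ 2 * (|p x| * Real.sqrt (q x)) * b ^ 2 := by positivity
        nlinarith
      refine h3.trans ?_
      have := hR' x
      gcongr
    nlinarith
  have hcb : (c / 2) ^ 2 ≤ b ^ 2 := by
    refine pow_le_pow_left₀ (by positivity) ?_ 2
    linarith
  obtain ⟨k, hk, hk0⟩ := intermediate_value_Icc' hcb hcont.continuousOn ⟨hhigh, hlow⟩
  have hkpos : 0 < k := lt_of_lt_of_le (by positivity) hk.1
  have hk1 : (∫ x : I, Real.sqrt (p x ^ 2 + q x * k)) = 2 * k := by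
    simpa [sub_eq_zero] using hk0
  refine ⟨k, hkpos, hk1, fun j hj hjk => ?_, fun j hjk => ?_⟩
  · have h := hmono j k hj hjk
    rw [hk1] at h
    nlinarith
  · have h := hmono k j hkpos hjk
    rw [hk1] at h
    nlinarith

/-- The solution `k` of `∫ sqrt (p ^ 2 + q k) = 2 k` depends continuously on parameters. -/
theorem exists_continuous_root {Y : Type*} [PseudoMetricSpace Y] [CompactSpace Y] (p q : C(Y × I, ℝ))
    (hq0 : ∀ z, 0 ≤ q z) (hq : ∀ y, ∃ x, 0 < q (y, x)) :
    ∃ k : C(Y, ℝ), (∀ y, 0 < k y) ∧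
      ∀ y, ∫ x : I, Real.sqrt (p (y, x) ^ 2 + q (y, x) * k y) = 2 * k y := by
  have h : ∀ y, ∃ k : ℝ, 0 < k ∧ (∫ x : I, Real.sqrt (p (y, x) ^ 2 + q (y, x) * k)) = 2 * k ∧
      (∀ j, 0 < j → j < k → 2 * j < ∫ x : I, Real.sqrt (p (y, x) ^ 2 + q (y, x) * j)) ∧
      ∀ j, k < j → (∫ x : I, Real.sqrt (p (y, x) ^ 2 + q (y, x) * j)) < 2 * j := fun y => by
    obtain ⟨x₀, hx₀⟩ := hq y
    exact exists_root (p := fun x => p (y, x)) (q := fun x => q (y, x)) (by fun_prop) (by fun_prop)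
      (fun x => hq0 _) hx₀
  choose k hk0 hk hlt hgt using h
  have hcont : ∀ j : ℝ, Continuous fun y => ∫ x : I, Real.sqrt (p (y, x) ^ 2 + q (y, x) * j) :=
    fun j => continuous_integral_unitInterval
      (F := fun y x => Real.sqrt (p (y, x) ^ 2 + q (y, x) * j))
      (by unfold Function.uncurry; fun_prop)
  refine ⟨⟨k, ?_⟩, hk0, hk⟩
  rw [continuous_iff_continuousAt]
  intro y
  rw [ContinuousAt, tendsto_order]
  constructor
  · intro a ha
    rcases le_or_gt a 0 with h0 | h0
    · exact Eventually.of_forall fun z => lt_of_le_of_lt h0 (hk0 z)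
    · filter_upwards [(hcont a).tendsto y |>.eventually (lt_mem_nhds (hlt y a h0 ha))] with z hz
      by_contra! hza
      rcases hza.eq_or_lt with h1 | h1
      · rw [← h1, hk z] at hz; exact lt_irrefl _ hz
      · exact lt_asymm hz (hgt z a h1)
  · intro a ha
    have h0 : 0 < a := (hk0 y).trans ha
    filter_upwards [(hcont a).tendsto y |>.eventually (gt_mem_nhds (hgt y a ha))] with z hz
    by_contra! hza
    rcases hza.eq_or_lt with h1 | h1
    · rw [h1, hk z] at hz; exact lt_irrefl _ hz
    · exact lt_asymm hz (hlt z a h0 h1)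

/-- The rate of change of the density `ψ` under the dynamics with rates
`λ(x,y) exp (g y - g x)`. -/
def flux (lam : C(I × I, ℝ)) (ψ g : I → ℝ) (x : I) : ℝ :=
  (∫ y : I, ψ y * lam (y, x) * Real.exp (g x - g y))
    - ψ x * ∫ y : I, lam (x, y) * Real.exp (g y - g x)

/-- For rates of product form, a smooth density that is positive or increasing everywhere solves
the Kolmogorov forward equation for rates tilted by a continuous function `G`. With `w = exp G` the
equation reads `∂ψ = λ₂ w ∫ (λ₁ ψ / w) - ψ (λ₁ / w) ∫ λ₂ w`. It is invariant under `w ↦ c w`, so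
that the first integral may be normalized to `1`; if `k` is the second one, then `w` is the positive
root of `λ₂ w ^ 2 - ∂ψ w - λ₁ ψ k = 0`, and `∫ λ₂ w = k` determines `k`. -/
theorem exists_flux_eq {lam : C(I × I, ℝ)} (hpos : ∀ p, 0 < lam p) {lam₁ lam₂ : C(I, ℝ)}
    (hprod : ∀ x y : I, lam (x, y) = lam₁ x * lam₂ y) {T : ℝ} {hT : 0 < T} (ψ : C10 hT)
    (hψ : ∀ p, 0 < ψ.val p ∨ ψ.val p = 0 ∧ 0 < ψ.dt p)
    (hψ0 : ∀ t, ∃ x, 0 < ψ.val (t, x))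
    (hdt : ∀ t : Icc (0 : ℝ) T, ∫ x : I, ψ.dt (t, x) = 0) :
    ∃ G : C(Icc (0 : ℝ) T × I, ℝ), ∀ t x,
      flux lam (fun x => ψ.val (t, x)) (fun x => G (t, x)) x = ψ.dt (t, x) := by
  -- `lam₁` and `lam₂` may both be negative; their absolute values have the same products
  set l₁ : C(I, ℝ) := ⟨fun x => |lam₁ x|, by fun_prop⟩ with hl₁
  set l₂ : C(I, ℝ) := ⟨fun x => |lam₂ x|, by fun_prop⟩ with hl₂
  have hl : ∀ x y : I, lam (x, y) = l₁ x * l₂ y := fun x y => by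
    change _ = |lam₁ x| * |lam₂ y|
    rw [← abs_mul, ← hprod, abs_of_pos (hpos _)]
  have hne : ∀ x, 0 < l₁ x ∧ 0 < l₂ x := fun x => by
    have h := hpos (x, x)
    rw [hprod] at h
    exact ⟨abs_pos.2 (left_ne_zero_of_mul h.ne'), abs_pos.2 (right_ne_zero_of_mul h.ne')⟩
  have h1 : ∀ x, 0 < l₁ x := fun x => (hne x).1
  have h2 : ∀ x, 0 < l₂ x := fun x => (hne x).2
  have hψnn : ∀ p, 0 ≤ ψ.val p := fun p => (hψ p).elim le_of_lt fun h => h.1.ge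
  set q : C(Icc (0 : ℝ) T × I, ℝ) := ⟨fun z => 4 * l₁ z.2 * l₂ z.2 * ψ.val z, by fun_prop⟩ with hq
  have hqz : ∀ z, q z = 4 * l₁ z.2 * l₂ z.2 * ψ.val z := fun z => rfl
  have hq0 : ∀ z, 0 ≤ q z := fun z => by
    have := h1 z.2
    have := h2 z.2
    have := hψnn z
    rw [hqz]; positivity
  obtain ⟨k, hk0, hk⟩ := exists_continuous_root ψ.dt q hq0 fun t => by
    obtain ⟨x, hx⟩ := hψ0 t
    have := h1 x
    have := h2 x
    exact ⟨x, by rw [hqz]; positivity⟩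
  set r : Icc (0 : ℝ) T × I → ℝ := fun z => Real.sqrt (ψ.dt z ^ 2 + q z * k z.1) with hr
  have hrc : Continuous r := by simp only [hr]; fun_prop
  set w : Icc (0 : ℝ) T × I → ℝ := fun z => (ψ.dt z + r z) / (2 * l₂ z.2) with hw
  have hrsq : ∀ z, r z ^ 2 = ψ.dt z ^ 2 + q z * k z.1 := fun z =>
    Real.sq_sqrt (add_nonneg (sq_nonneg _) (mul_nonneg (hq0 z) (hk0 z.1).le))
  have hwpos : ∀ z, 0 < w z := by
    intro z
    have h2z := h2 z.2
    have h1z := h1 z.2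
    refine div_pos ?_ (by positivity)
    rcases hψ z with h | ⟨-, h⟩
    · have h3 : |ψ.dt z| < r z := by
        refine Real.lt_sqrt_of_sq_lt ?_
        rw [sq_abs]
        have : 0 < q z * k z.1 := mul_pos (by rw [hqz]; positivity) (hk0 z.1)
        linarith
      linarith [neg_abs_le (ψ.dt z)]
    · exact add_pos_of_pos_of_nonneg h (Real.sqrt_nonneg _)
  have hwc : Continuous w := (ψ.dt.continuous.add hrc).div (by fun_prop) fun z => by
    have := h2 z.2
    positivity
  -- the quadratic equation of `w`
  have hquad : ∀ z, l₂ z.2 * w z - ψ.val z * l₁ z.2 * k z.1 / w z = ψ.dt z := by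
    intro z
    have h2z := h2 z.2
    have e : 2 * l₂ z.2 * w z = ψ.dt z + r z := by
      simp only [hw]; field_simp
    have e2 := hrsq z
    rw [hqz] at e2
    have hwz := hwpos z
    field_simp
    have e3 : (2 * l₂ z.2 * w z - ψ.dt z) ^ 2 = ψ.dt z ^ 2 + 4 * l₁ z.2 * l₂ z.2 * ψ.val z * k z.1 := by
      rw [e, add_sub_cancel_left, e2]
    have e4 : 4 * l₂ z.2 * (l₂ z.2 * w z ^ 2 - ψ.val z * l₁ z.2 * k z.1 - w z * ψ.dt z) = 0 := by
      linear_combination e3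
    have := (mul_eq_zero.1 e4).resolve_left (by positivity)
    linarith
  have hcw : ∀ t : Icc (0 : ℝ) T, Continuous fun x => w (t, x) := fun t => by fun_prop
  have hi1 : ∀ t, ∫ x : I, l₂ x * w (t, x) = k t := by
    intro t
    have e : ∀ x : I, l₂ x * w (t, x) = (1 / 2) * ψ.dt (t, x) + (1 / 2) * r (t, x) := fun x => by
      have := h2 x
      simp only [hw]; field_simp
    simp_rw [e]
    rw [integral_add (integrable_of_continuous (by fun_prop))
      (integrable_of_continuous (by fun_prop)), integral_const_mul, integral_const_mul, hdt t]
    have := hk t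
    simp only [hr, this]
    ring
  have hi2 : ∀ t, ∫ x : I, ψ.val (t, x) * l₁ x / w (t, x) = 1 := by
    intro t
    have hc2 : Continuous fun x : I => ψ.val (t, x) * l₁ x / w (t, x) :=
      Continuous.div (by fun_prop) (hcw t) fun x => (hwpos _).ne'
    have e : ∀ x : I, ψ.dt (t, x) = l₂ x * w (t, x) - k t * (ψ.val (t, x) * l₁ x / w (t, x)) :=
      fun x => by rw [← hquad (t, x)]; ring
    have e2 := hdt t
    simp_rw [e] at e2
    rw [integral_sub (integrable_of_continuous (by fun_prop))
      (integrable_of_continuous (by fun_prop)), integral_const_mul, hi1] at e2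
    have := hk0 t
    have e3 : k t * ((∫ x : I, ψ.val (t, x) * l₁ x / w (t, x)) - 1) = 0 := by linarith
    linarith [(mul_eq_zero.1 e3).resolve_left this.ne']
  refine ⟨⟨fun z => Real.log (w z), hwc.log fun z => (hwpos z).ne'⟩, fun t x => ?_⟩
  have hexp : ∀ y z : I, Real.exp (Real.log (w (t, y)) - Real.log (w (t, z)))
      = w (t, y) / w (t, z) := fun y z => by
    rw [Real.exp_sub, Real.exp_log (hwpos _), Real.exp_log (hwpos _)]
  simp only [flux, ContinuousMap.coe_mk, hexp, hl]
  have e1 : ∀ y : I, ψ.val (t, y) * (l₁ y * l₂ x) * (w (t, x) / w (t, y))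
      = (l₂ x * w (t, x)) * (ψ.val (t, y) * l₁ y / w (t, y)) := fun y => by ring
  have e2 : ∀ y : I, l₁ x * l₂ y * (w (t, y) / w (t, x))
      = (l₁ x / w (t, x)) * (l₂ y * w (t, y)) := fun y => by ring
  simp_rw [e1, e2]
  rw [integral_const_mul, integral_const_mul, hi1, hi2, ← hquad (t, x)]
  ring

end Control

/-! ### Nearly optimal smooth controls -/

theorem abs_exp_sub_exp_le {a b c : ℝ} (ha : a ≤ c) (hb : b ≤ c) :
    |Real.exp a - Real.exp b| ≤ Real.exp c * |a - b| := by
  wlog hab : b ≤ a generalizing a b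
  · rw [abs_sub_comm, abs_sub_comm a]
    exact this hb ha (le_of_not_ge hab)
  rw [abs_of_nonneg (sub_nonneg.2 (Real.exp_le_exp.2 hab)), abs_of_nonneg (sub_nonneg.2 hab)]
  have h1 : Real.exp a * (1 - (a - b)) ≤ Real.exp b := by
    have h := mul_le_mul_of_nonneg_left (Real.add_one_le_exp (b - a)) (Real.exp_pos a).le
    rw [← Real.exp_add, add_sub_cancel] at h
    linarith
  have h2 := mul_le_mul_of_nonneg_right (Real.exp_le_exp.2 ha) (sub_nonneg.2 hab)
  linarith

/-- The rates depend on the control in a Lipschitz way. -/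
theorem abs_flux_sub_le (lam : C(I × I, ℝ)) {ψ g g' : I → ℝ} (hψ : Continuous ψ)
    (hg : Continuous g) (hg' : Continuous g') {M R η : ℝ} (hM : ∀ x, |ψ x| ≤ M)
    (hR : ∀ x, |g x| ≤ R) (hR' : ∀ x, |g' x| ≤ R) (hη : ∀ x, |g x - g' x| ≤ η) (x : I) :
    |flux lam ψ g x - flux lam ψ g' x| ≤ 4 * (M * ‖lam‖ * Real.exp (2 * R)) * η := by
  have hM0 : 0 ≤ M := (abs_nonneg _).trans (hM x)
  have hη0 : 0 ≤ η := (abs_nonneg _).trans (hη x)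
  have hexp : ∀ y z : I, |Real.exp (g y - g z) - Real.exp (g' y - g' z)|
      ≤ Real.exp (2 * R) * (2 * η) := by
    intro y z
    have b1 := abs_le.1 (hR y)
    have b2 := abs_le.1 (hR z)
    have b3 := abs_le.1 (hR' y)
    have b4 := abs_le.1 (hR' z)
    have b5 := abs_le.1 (hη y)
    have b6 := abs_le.1 (hη z)
    refine (abs_exp_sub_exp_le (c := 2 * R) (by linarith) (by linarith)).trans ?_
    gcongr
    rw [abs_le]
    constructor <;> linarith
  have hlam : ∀ p, |lam p| ≤ ‖lam‖ := fun p => lam.norm_coe_le_norm p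
  have e : flux lam ψ g x - flux lam ψ g' x
      = (∫ y : I, ψ y * lam (y, x) * (Real.exp (g x - g y) - Real.exp (g' x - g' y)))
        - ψ x * ∫ y : I, lam (x, y) * (Real.exp (g y - g x) - Real.exp (g' y - g' x)) := by
    simp only [flux, mul_sub]
    rw [integral_sub (integrable_of_continuous (by fun_prop))
      (integrable_of_continuous (by fun_prop)), integral_sub (integrable_of_continuous (by fun_prop))
      (integrable_of_continuous (by fun_prop))]
    ring
  rw [e]
  have i1 : |∫ y : I, ψ y * lam (y, x) * (Real.exp (g x - g y) - Real.exp (g' x - g' y))|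
      ≤ M * ‖lam‖ * (Real.exp (2 * R) * (2 * η)) := by
    refine abs_integral_unitInterval_le fun y => ?_
    rw [abs_mul, abs_mul]
    exact mul_le_mul (mul_le_mul (hM y) (hlam _) (abs_nonneg _) hM0) (hexp _ _) (abs_nonneg _)
      (by positivity)
  have i2 : |∫ y : I, lam (x, y) * (Real.exp (g y - g x) - Real.exp (g' y - g' x))|
      ≤ ‖lam‖ * (Real.exp (2 * R) * (2 * η)) := by
    refine abs_integral_unitInterval_le fun y => ?_
    rw [abs_mul]
    exact mul_le_mul (hlam _) (hexp _ _) (abs_nonneg _) (norm_nonneg _)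
  have i3 : |ψ x * ∫ y : I, lam (x, y) * (Real.exp (g y - g x) - Real.exp (g' y - g' x))|
      ≤ M * (‖lam‖ * (Real.exp (2 * R) * (2 * η))) := by
    rw [abs_mul]
    exact mul_le_mul (hM x) i2 (abs_nonneg _) hM0
  have := abs_sub (∫ y : I, ψ y * lam (y, x) * (Real.exp (g x - g y) - Real.exp (g' x - g' y)))
    (ψ x * ∫ y : I, lam (x, y) * (Real.exp (g y - g x) - Real.exp (g' y - g' x)))
  linarith

section Smoothing

variable {T : ℝ} {hT : 0 < T}

/-- A continuous function is a uniform limit of its averages over short time intervals, which are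
of class `C^{1,0}`. -/
theorem exists_C10_sub_le (G : C(Icc (0 : ℝ) T × I, ℝ)) {η : ℝ} (hη : 0 < η) :
    ∃ G' : C10 hT, ∀ p, |G'.val p - G p| ≤ η := by
  obtain ⟨δ, hδ, hmod⟩ := exists_modulus G hη
  set h : ℝ := δ / 2 with hh
  have h0 : 0 < h := by positivity
  have hproj : Continuous (projIcc 0 T hT.le) := continuous_projIcc
  set F : Icc (0 : ℝ) T × I → ℝ → ℝ := fun p u => G (projIcc 0 T hT.le u, p.2) with hF
  have hFc : Continuous F.uncurry := by
    unfold Function.uncurry; simp only [hF]; fun_prop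
  have hFu : ∀ p, Continuous (F p) := fun p => by simp only [hF]; fun_prop
  have hc1 := intervalIntegral.continuous_parametric_intervalIntegral_of_continuous
    (μ := (volume : Measure ℝ)) (a₀ := 0) hFc
    (s := fun p : Icc (0 : ℝ) T × I => (p.1 : ℝ) + h) (by fun_prop)
  have hc2 := intervalIntegral.continuous_parametric_intervalIntegral_of_continuous
    (μ := (volume : Measure ℝ)) (a₀ := 0) hFc
    (s := fun p : Icc (0 : ℝ) T × I => (p.1 : ℝ)) (by fun_prop)
  refine ⟨⟨⟨fun p => (1 / h) * ((∫ u in (0 : ℝ)..(p.1 + h), F p u) - ∫ u in (0 : ℝ)..p.1, F p u),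
      continuous_const.mul (hc1.sub hc2)⟩,
    ⟨fun p => (1 / h) * (F p (p.1 + h) - F p p.1), by simp only [hF]; fun_prop⟩,
    fun t x => ?_⟩, fun p => ?_⟩
  · have d : ∀ s : ℝ, HasDerivAt (fun s => ∫ u in (0 : ℝ)..s, F (t, x) u) (F (t, x) s) s := fun s =>
      intervalIntegral.integral_hasDerivAt_right ((hFu _).intervalIntegrable _ _)
        ((hFu _).stronglyMeasurableAtFilter _ _) (hFu _).continuousAt
    have d1 : HasDerivAt (fun s => ∫ u in (0 : ℝ)..(s + h), F (t, x) u) (F (t, x) (t + h)) t :=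
      HasDerivAt.comp_add_const (t : ℝ) h (d _)
    have d2 := ((d1.sub (d t)).const_mul (1 / h)).hasDerivWithinAt (s := Icc 0 T)
    refine d2.congr_of_mem (fun s hs => ?_) t.2
    rw [IccExtend_of_mem _ _ hs]
    rfl
  · simp only [ContinuousMap.coe_mk]
    have e1 : (∫ u in (0 : ℝ)..(p.1 + h), F p u) - ∫ u in (0 : ℝ)..p.1, F p u
        = ∫ u in (p.1 : ℝ)..(p.1 + h), F p u :=
      intervalIntegral.integral_interval_sub_left ((hFu p).intervalIntegrable _ _)
        ((hFu p).intervalIntegrable _ _)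
    have e2 : (1 / h) * (∫ u in (p.1 : ℝ)..(p.1 + h), F p u) - G p
        = (1 / h) * ∫ u in (p.1 : ℝ)..(p.1 + h), (F p u - G p) := by
      rw [intervalIntegral.integral_sub ((hFu p).intervalIntegrable _ _) intervalIntegrable_const,
        intervalIntegral.integral_const, smul_eq_mul]
      field_simp
      ring
    rw [e1, e2]
    have h3 := intervalIntegral.norm_integral_le_of_norm_le_const (C := η)
      (a := (p.1 : ℝ)) (b := p.1 + h) (f := fun u => F p u - G p) (fun u hu => by
        rw [uIoc_of_le (by linarith)] at hu
        have hd : dist (projIcc 0 T hT.le u) p.1 < δ := by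
          have h4 := (LipschitzWith.projIcc hT.le).dist_le_mul u p.1
          rw [projIcc_val, NNReal.coe_one, one_mul, Real.dist_eq,
            abs_of_nonneg (by linarith [hu.1])] at h4
          linarith [hu.2]
        exact hmod _ _ hd p.2)
    rw [abs_mul, abs_of_pos (by positivity), one_div, inv_mul_le_iff₀ h0]
    rw [add_sub_cancel_left, abs_of_pos h0] at h3
    rw [mul_comm]
    exact h3

/-- A finite initial cost forces the density to vanish almost everywhere where `φ` does: test with
`H = log (1 + 1 / (φ + η))`, which is large there and whose second term costs at most `1`. -/
theorem ae_eq_zero_of_costIni_le {φ ψ₀ : C(I, ℝ)} (hφ : ∀ x, 0 ≤ φ x) (hψ : ∀ x, 0 ≤ ψ₀ x) {a : ℝ}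
    (ha : ∀ H : C(I, ℝ), costIni φ H ψ₀ ≤ a) : ∀ᵐ x : I, φ x = 0 → ψ₀ x = 0 := by
  have hmeas : MeasurableSet {x : I | φ x = 0} :=
    (isClosed_eq φ.continuous continuous_const).measurableSet
  have hbound : ∀ η : ℝ, 0 < η → Real.log (1 + 1 / η) * (∫ x in {x : I | φ x = 0}, ψ₀ x) ≤ a + 1 := by
    intro η hη
    have hden : ∀ x, 0 < φ x + η := fun x => by linarith [hφ x]
    set u : I → ℝ := fun x => 1 / (φ x + η) with hu
    have huc : Continuous u := continuous_const.div (by fun_prop) fun x => (hden x).ne'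
    have hu0 : ∀ x, 0 < u x := fun x => one_div_pos.2 (hden x)
    have hlogc : Continuous fun x => Real.log (1 + u x) :=
      Continuous.log (by fun_prop) fun x => (add_pos one_pos (hu0 x)).ne'
    have h1 := ha ⟨fun x => Real.log (1 + u x), hlogc⟩
    simp only [costIni, ContinuousMap.coe_mk] at h1
    have h2 : (∫ x : I, φ x * (Real.exp (Real.log (1 + u x)) - 1)) ≤ 1 := by
      refine (le_abs_self _).trans (abs_integral_unitInterval_le fun x => ?_)
      have h3 := hu0 x
      rw [Real.exp_log (by linarith), add_sub_cancel_left, abs_of_nonneg (mul_nonneg (hφ x) h3.le)]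
      simp only [hu]
      rw [mul_one_div, div_le_one (hden x)]
      linarith
    have h4 : Real.log (1 + 1 / η) * (∫ x in {x : I | φ x = 0}, ψ₀ x)
        ≤ ∫ x : I, Real.log (1 + u x) * ψ₀ x := by
      have hnn : ∀ x, 0 ≤ Real.log (1 + u x) * ψ₀ x := fun x =>
        mul_nonneg (Real.log_nonneg (by linarith [hu0 x])) (hψ x)
      have hint : Integrable (fun x : I => Real.log (1 + u x) * ψ₀ x) :=
        integrable_of_continuous (by fun_prop)
      refine le_trans (le_of_eq ?_) (setIntegral_le_integral (s := {x : I | φ x = 0}) hint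
        (Eventually.of_forall hnn))
      rw [← integral_const_mul]
      refine setIntegral_congr_fun hmeas fun x hx => ?_
      have hx' : φ x = 0 := hx
      simp only [hu, hx', zero_add]
    linarith
  have hnn : 0 ≤ ∫ x in {x : I | φ x = 0}, ψ₀ x := integral_nonneg hψ
  have hzero : ∫ x in {x : I | φ x = 0}, ψ₀ x = 0 := by
    by_contra hne
    have hpos : 0 < ∫ x in {x : I | φ x = 0}, ψ₀ x := lt_of_le_of_ne hnn (Ne.symm hne)
    set c := ∫ x in {x : I | φ x = 0}, ψ₀ x with hc
    have h := hbound (Real.exp (-((|a| + 2) / c))) (Real.exp_pos _)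
    have h5 : (|a| + 2) / c ≤ Real.log (1 + 1 / Real.exp (-((|a| + 2) / c))) := by
      rw [Real.le_log_iff_exp_le (by positivity), Real.exp_neg, one_div, inv_inv]
      linarith
    have h6 := mul_le_mul_of_nonneg_right h5 hnn
    rw [div_mul_cancel₀ _ hpos.ne'] at h6
    linarith [le_abs_self a]
  have h7 := (setIntegral_eq_zero_iff_of_nonneg_ae (Eventually.of_forall hψ)
    (integrable_of_continuous ψ₀.continuous).integrableOn).1 hzero
  exact (ae_restrict_iff' hmeas).1 h7

/-- Initial tilts that turn `φ` into nearly `ψ₀`, namely `H = log ((ψ₀ + η) / (φ + η))` for small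
`η`. By the sign condition, replacing `ψ₀` by `φ e ^ H` does not increase the pairing with `H`. -/
theorem exists_initial_tilt {φ ψ₀ : C(I, ℝ)} (hφ : ∀ x, 0 ≤ φ x) (hψ : ∀ x, 0 ≤ ψ₀ x)
    (hz : ∀ᵐ x : I, φ x = 0 → ψ₀ x = 0) {δ : ℝ} (hδ : 0 < δ) :
    ∃ H : C(I, ℝ), (∀ x, (φ x * Real.exp (H x) - ψ₀ x) * H x ≤ 0) ∧
      ∫ x : I, |φ x * Real.exp (H x) - ψ₀ x| ≤ δ := by
  have hlim : Tendsto (fun n : ℕ => ∫ x : I, |1 / ((n : ℝ) + 1) * (φ x - ψ₀ x) / (φ x + 1 / ((n : ℝ) + 1))|)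
      atTop (𝓝 (∫ _ : I, (0 : ℝ))) := by
    have hη : ∀ n : ℕ, (0 : ℝ) < 1 / ((n : ℝ) + 1) := fun n => by positivity
    have hden : ∀ (n : ℕ) x, 0 < φ x + 1 / ((n : ℝ) + 1) := fun n x =>
      add_pos_of_nonneg_of_pos (hφ x) (hη n)
    refine tendsto_integral_of_dominated_convergence (fun x => |φ x - ψ₀ x|) (fun n => ?_)
      (integrable_of_continuous (by fun_prop)) (fun n => Eventually.of_forall fun x => ?_) ?_
    · exact (Continuous.abs (Continuous.div (by fun_prop) (by fun_prop) fun x =>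
        (hden n x).ne')).aestronglyMeasurable
    · rw [Real.norm_eq_abs, abs_abs, abs_div, abs_mul, abs_of_pos (hη n), abs_of_pos (hden n x),
        div_le_iff₀ (hden n x), mul_comm]
      have := hφ x
      gcongr
      linarith
    · filter_upwards [hz] with x hx
      rcases (hφ x).eq_or_lt with h | h
      · have h' : ψ₀ x = 0 := hx h.symm
        simp only [← h, h', sub_zero, mul_zero, zero_div, abs_zero]
        exact tendsto_const_nhds
      · have h1 : Tendsto (fun n : ℕ => 1 / ((n : ℝ) + 1)) atTop (𝓝 0) :=
          tendsto_one_div_add_atTop_nhds_zero_nat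
        have h2 := ((h1.mul_const (φ x - ψ₀ x)).div (h1.const_add (φ x)) (by simpa using h.ne')).abs
        simpa using h2
  rw [integral_zero] at hlim
  obtain ⟨n, hn⟩ := (hlim.eventually (gt_mem_nhds hδ)).exists
  set η : ℝ := 1 / ((n : ℝ) + 1) with hηdef
  have hη : 0 < η := by positivity
  have h1 : ∀ x, 0 < φ x + η := fun x => by linarith [hφ x]
  have h2 : ∀ x, 0 < ψ₀ x + η := fun x => by linarith [hψ x]
  have hq : ∀ x, 0 < (ψ₀ x + η) / (φ x + η) := fun x => div_pos (h2 x) (h1 x)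
  have hc : Continuous fun x => Real.log ((ψ₀ x + η) / (φ x + η)) :=
    Continuous.log (Continuous.div (by fun_prop) (by fun_prop) fun x => (h1 x).ne')
      fun x => (hq x).ne'
  have e : ∀ x, φ x * Real.exp (Real.log ((ψ₀ x + η) / (φ x + η))) - ψ₀ x
      = η * (φ x - ψ₀ x) / (φ x + η) := fun x => by
    have := h1 x
    rw [Real.exp_log (hq x)]
    field_simp
    ring
  refine ⟨⟨_, hc⟩, fun x => ?_, ?_⟩
  · simp only [ContinuousMap.coe_mk, e]
    rcases le_total (ψ₀ x) (φ x) with h | h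
    · refine mul_nonpos_of_nonneg_of_nonpos (div_nonneg (mul_nonneg hη.le (sub_nonneg.2 h))
        (h1 x).le) (Real.log_nonpos (hq x).le ?_)
      rw [div_le_one (h1 x)]; linarith
    · refine mul_nonpos_of_nonpos_of_nonneg (div_nonpos_of_nonpos_of_nonneg
        (mul_nonpos_of_nonneg_of_nonpos hη.le (sub_nonpos.2 h)) (h1 x).le) (Real.log_nonneg ?_)
      rw [le_div_iff₀ (h1 x)]; linarith
  · simp only [ContinuousMap.coe_mk, e]
    exact hn.le

end Smoothing

section NearlyOptimal

variable {T : ℝ} {hT : 0 < T}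

/-- A nonnegative density cannot decrease from `0`. -/
theorem dt_nonneg_of_eq_zero (ψ : C10 hT) (hψ : ∀ p, 0 ≤ ψ.val p) {x : I}
    (h : ψ.val (t0 hT, x) = 0) : 0 ≤ ψ.dt (t0 hT, x) := by
  refine le_of_forall_pos_le_add fun ε hε => ?_
  obtain ⟨δ, hδ, hinc⟩ := exists_increment_le ψ hε
  have h0 : 0 < min T (δ / 2) := by positivity
  set t : Icc (0 : ℝ) T := ⟨min T (δ / 2), h0.le, min_le_left _ _⟩ with ht
  have e : (t : ℝ) - (t0 hT : Icc (0 : ℝ) T) = min T (δ / 2) := sub_zero _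
  have h1 := hinc (t0 hT) t h0.le (by
    rw [e]; exact (min_le_right _ _).trans_lt (by linarith)) x
  rw [e, h, sub_zero] at h1
  have h2 := (abs_le.1 h1).2
  have h3 := hψ (t, x)
  by_contra! hneg
  nlinarith

theorem eq_zero_of_integral_eq_zero {f : I → ℝ} (hf : Continuous f) (h0 : ∀ x, 0 ≤ f x)
    (h : ∫ x : I, f x = 0) (x : I) : f x = 0 := by
  by_contra hne
  exact (integral_pos_of_continuous hf h0 (lt_of_le_of_ne (h0 x) (Ne.symm hne))).ne' h

theorem costDyn_zero_left (lam : C(I × I, ℝ)) (ψ : C(Icc (0 : ℝ) T × I, ℝ)) :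
    costDyn lam (C10.zero hT) ψ = 0 := by
  have h0 : dtB lam (C10.zero hT) = 0 := by
    ext p
    change (0 : ℝ) + ∫ y : I, lam (p.2, y) * (Real.exp ((0 : ℝ) - 0) - 1) = 0
    simp
  have h1 : (C10.zero hT).val = 0 := rfl
  have h2 : IccExtend hT.le (fun _ : Icc (0 : ℝ) T => (0 : ℝ)) = fun _ => 0 := rfl
  simp [costDyn, h0, h1, h2]

/-- Every density of finite cost is close to one that is generated, up to arbitrarily small errors,
by smooth controls of nearly the same cost. -/
theorem exists_control {lam : C(I × I, ℝ)} (hpos : ∀ p, 0 < lam p) {lam₁ lam₂ : C(I, ℝ)}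
    (hprod : ∀ x y : I, lam (x, y) = lam₁ x * lam₂ y) {φ : C(I, ℝ)} (hφ : ∀ x, 0 ≤ φ x)
    (ψ : C10 hT) (hψ : ∀ p, 0 ≤ ψ.val p) (hdt : ∀ s : Icc (0 : ℝ) T, ∫ x : I, ψ.dt (s, x) = 0)
    {a₁ a₂ : ℝ} (ha₁ : ∀ H, costIni φ H (ψ.val.curry (t0 hT)) ≤ a₁)
    (ha₂ : ∀ G : C10 hT, costDyn lam G ψ.val ≤ a₂) {ε : ℝ} (hε : 0 < ε) :
    ∃ χ : C10 hT, (∀ p, 0 ≤ χ.val p) ∧ (∀ p, |χ.val p - ψ.val p| ≤ ε) ∧ ∃ R : ℝ, 0 ≤ R ∧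
      ∀ δ > 0, ∃ (H : C(I, ℝ)) (G : C10 hT), ‖G.val‖ ≤ R ∧
        (∀ x, (φ x * Real.exp (H x) - χ.val (t0 hT, x)) * H x ≤ 0) ∧
        (∫ x : I, |φ x * Real.exp (H x) - χ.val (t0 hT, x)|) ≤ δ ∧
        (∀ t x, |flux lam (fun y => χ.val (t, y)) (fun y => G.val (t, y)) x - χ.dt (t, x)| ≤ δ) ∧
        costIni φ H (χ.val.curry (t0 hT)) + costDyn lam G χ.val ≤ a₁ + a₂ + ε := by
  have h1 : 0 ≤ a₁ := by
    refine le_trans (le_of_eq ?_) (ha₁ 0)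
    simp [costIni]
  have h2 : 0 ≤ a₂ := (costDyn_zero_left lam ψ.val).symm.trans_le (ha₂ (C10.zero hT))
  have hz := ae_eq_zero_of_costIni_le hφ (fun x => hψ (t0 hT, x)) ha₁
  have hφm : 0 ≤ ∫ x : I, φ x := integral_nonneg hφ
  rcases hφm.eq_or_lt with hm | hm
  · -- without balls the density vanishes, and no control is needed
    have hφ0 := eq_zero_of_integral_eq_zero φ.continuous hφ hm.symm
    have hψ0 : ∫ x : I, ψ.val (t0 hT, x) = 0 := by
      exact integral_eq_zero_of_ae (hz.mono fun x hx => hx (hφ0 x))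
    have hψz : ∀ p, ψ.val p = 0 := fun p => eq_zero_of_integral_eq_zero (f := fun x => ψ.val (p.1, x))
      (by fun_prop) (fun x => hψ _) ((integral_val_eq ψ hdt p.1).trans hψ0) p.2
    have hv : ∀ p, (C10.zero hT).val p = 0 := fun p => rfl
    refine ⟨C10.zero hT, fun p => le_rfl, fun p => ?_, 0, le_rfl, fun δ hδ => ⟨0, C10.zero hT, ?_,
      fun x => ?_, ?_, fun t x => ?_, ?_⟩⟩
    · rw [hψz, hv]; simpa using hε.le
    · exact (norm_zero (E := C(Icc (0 : ℝ) T × I, ℝ))).le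
    · simp
    · simpa [hφ0, hv] using hδ.le
    · have : (C10.zero hT).dt (t, x) = 0 := rfl
      simpa [flux, hv, this] using hδ.le
    · rw [costDyn_zero_left]
      have : costIni φ 0 ((C10.zero hT).val.curry (t0 hT)) = 0 := by simp [costIni]
      rw [this]; linarith
  -- mixing with `relax` makes the density positive or increasing everywhere; the cost is convex, and
  -- `relax` has a finite cost
  set ρ := relax hT φ with hρ
  obtain ⟨c, hc⟩ := exists_costDyn_relax_le (hT := hT) hpos hφ
  set a : ℝ := min (1 / 2) (ε / (‖ρ.val - ψ.val‖ + |c| + 1)) with ha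
  have ha0 : 0 < a := by positivity
  have ha1 : a ≤ 1 / 2 := min_le_left _ _
  have haε : a * (‖ρ.val - ψ.val‖ + |c| + 1) ≤ ε := by
    rw [← le_div_iff₀ (by positivity)]
    exact min_le_right _ _
  set χ : C10 hT := C10.lin (1 - a) a ψ ρ with hχ
  have hval : ∀ p, χ.val p = (1 - a) * ψ.val p + a * ρ.val p := fun p => rfl
  have hdtv : ∀ p, χ.dt p = (1 - a) * ψ.dt p + a * ρ.dt p := fun p => rfl
  have hρnn := relax_nonneg (hT := hT) hφ
  have hχnn : ∀ p, 0 ≤ χ.val p := fun p => by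
    rw [hval]
    exact add_nonneg (mul_nonneg (by linarith) (hψ p)) (mul_nonneg ha0.le (hρnn p))
  have hχdt : ∀ t : Icc (0 : ℝ) T, ∫ x : I, χ.dt (t, x) = 0 := by
    intro t
    simp only [hdtv, hρ, relax_dt]
    rw [integral_add (integrable_of_continuous (by fun_prop))
      (integrable_of_continuous (by fun_prop)), integral_const_mul, integral_const_mul, hdt t,
      integral_sub (integrable_const _) (integrable_of_continuous (by fun_prop)), integral_relax,
      integral_const]
    simp
  have hχpos : ∀ p, 0 < χ.val p ∨ χ.val p = 0 ∧ 0 < χ.dt p := by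
    intro p
    rcases (hχnn p).eq_or_lt with h | h
    swap
    · exact Or.inl h
    refine Or.inr ⟨h.symm, ?_⟩
    have h3 := mul_nonneg (by linarith : 0 ≤ 1 - a) (hψ p)
    have h4 := mul_nonneg ha0.le (hρnn p)
    rw [hval] at h
    have h5 : ψ.val p = 0 := by
      have : (1 - a) * ψ.val p = 0 := by linarith
      exact (mul_eq_zero.1 this).resolve_left (by linarith)
    have h6 : ρ.val p = 0 := by
      have : a * ρ.val p = 0 := by linarith
      exact (mul_eq_zero.1 this).resolve_left ha0.ne'
    rcases relax_pos_or (hT := hT) hφ hm p with h7 | ⟨h7, h8⟩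
    · exact absurd h6 h7.ne'
    · obtain ⟨t, x⟩ := p
      obtain rfl : t = t0 hT := h7
      rw [hdtv]
      have h9 := dt_nonneg_of_eq_zero ψ hψ h5
      have := mul_nonneg (by linarith : 0 ≤ 1 - a) h9
      have := mul_pos ha0 h8
      linarith
  have hχm : ∀ t, ∃ x, 0 < χ.val (t, x) := by
    intro t
    by_contra! hcon
    have h3 : ∫ x : I, ρ.val (t, x) = 0 := by
      refine integral_eq_zero_of_ae (Eventually.of_forall fun x => ?_)
      have h4 := hcon x
      rw [hval] at h4
      have h5 := mul_nonneg (by linarith : 0 ≤ 1 - a) (hψ (t, x))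
      have h6 := mul_nonneg ha0.le (hρnn (t, x))
      have : a * ρ.val (t, x) = 0 := by linarith
      exact (mul_eq_zero.1 this).resolve_left ha0.ne'
    rw [hρ, integral_relax] at h3
    exact hm.ne' h3
  -- the exact control is only continuous; it is smoothed in time below
  obtain ⟨G₀, hG₀⟩ := exists_flux_eq hpos hprod χ hχpos hχm hχdt
  refine ⟨χ, hχnn, fun p => ?_, ‖G₀‖ + 1, by positivity, fun δ hδ => ?_⟩
  · have e : χ.val p - ψ.val p = a * (ρ.val - ψ.val) p := by
      rw [hval, ContinuousMap.sub_apply]; ring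
    rw [e, abs_mul, abs_of_pos ha0]
    refine le_trans (mul_le_mul_of_nonneg_left ?_ ha0.le) haε
    have := (ρ.val - ψ.val).norm_coe_le_norm p
    rw [Real.norm_eq_abs] at this
    linarith [abs_nonneg c]
  have hχ0 : χ.val.curry (t0 hT) = (1 - a) • ψ.val.curry (t0 hT) + a • φ := by
    ext x
    change (1 - a) * ψ.val (t0 hT, x) + a * ρ.val (t0 hT, x) = _
    rw [hρ, relax_zero]
    rfl
  obtain ⟨H, hH1, hH2⟩ := exists_initial_tilt hφ (fun x => hχnn (t0 hT, x))
    (ψ₀ := χ.val.curry (t0 hT)) (by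
      filter_upwards [hz] with x hx hx0
      have h3 : ψ.val (t0 hT, x) = 0 := hx hx0
      change χ.val (t0 hT, x) = 0
      rw [hval, h3, hρ, relax_zero, hx0]
      ring) hδ
  set K : ℝ := 4 * (‖χ.val‖ * ‖lam‖ * Real.exp (2 * (‖G₀‖ + 1))) with hK
  have hK0 : 0 ≤ K := by positivity
  obtain ⟨G, hG⟩ := exists_C10_sub_le (hT := hT) G₀ (η := min 1 (δ / (K + 1))) (by positivity)
  have hGR : ∀ p, |G.val p| ≤ ‖G₀‖ + 1 := fun p => by
    have h3 := abs_le.1 ((hG p).trans (min_le_left _ _))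
    have h4 := abs_le.1 (G₀.norm_coe_le_norm p)
    rw [abs_le]
    constructor <;> linarith
  refine ⟨H, G, (ContinuousMap.norm_le _ (by positivity)).2 hGR, hH1, hH2, fun t x => ?_, ?_⟩
  · rw [← hG₀ t x]
    refine (abs_flux_sub_le lam (M := ‖χ.val‖) (R := ‖G₀‖ + 1) (η := δ / (K + 1)) (by fun_prop)
      (by fun_prop) (by fun_prop) (fun y => χ.val.norm_coe_le_norm _) (fun y => hGR _)
      (fun y => (G₀.norm_coe_le_norm _).trans (by linarith))
      (fun y => (hG _).trans (min_le_right _ _)) x).trans ?_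
    rw [← hK, mul_div_assoc', div_le_iff₀ (by positivity)]
    nlinarith
  · have e1 : costIni φ H (χ.val.curry (t0 hT)) ≤ (1 - a) * a₁ + a * 0 := by
      rw [hχ0, costIni_lin φ H _ _ (by ring)]
      exact add_le_add (mul_le_mul_of_nonneg_left (ha₁ H) (by linarith))
        (mul_le_mul_of_nonneg_left (costIni_self_le hφ H) ha0.le)
    have e2 : costDyn lam G χ.val ≤ (1 - a) * a₂ + a * c := by
      have : χ.val = (1 - a) • ψ.val + a • ρ.val := rfl
      rw [this, costDyn_lin]
      exact add_le_add (mul_le_mul_of_nonneg_left (ha₂ G) (by linarith))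
        (mul_le_mul_of_nonneg_left (hc G) ha0.le)
    have e3 : a * c ≤ ε := by
      refine le_trans (mul_le_mul_of_nonneg_left ?_ ha0.le) haε
      linarith [le_abs_self c, norm_nonneg (ρ.val - ψ.val)]
    have e4 := mul_nonneg ha0.le h1
    have e5 := mul_nonneg ha0.le h2
    linarith

end NearlyOptimal

/-! ### The mean of the tilted process -/

/-- The normalized pairing of two vectors, as a linear map of the second one. -/
def wavg {N : ℕ} (v : Fin N → ℝ) : (Fin N → ℝ) →ₗ[ℝ] ℝ where
  toFun f := 1 / (N : ℝ) * ∑ i, v i * f i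
  map_add' f g := by simp only [Pi.add_apply, mul_add, Finset.sum_add_distrib]
  map_smul' c f := by
    simp only [Pi.smul_apply, smul_eq_mul, RingHom.id_apply, Finset.mul_sum]
    exact Finset.sum_congr rfl fun i _ => by ring

theorem wavg_apply {N : ℕ} (v f : Fin N → ℝ) : wavg v f = 1 / (N : ℝ) * ∑ i, v i * f i := rfl

theorem abs_wavg_le {N : ℕ} {v f : Fin N → ℝ} {M c : ℝ} (hM : 0 ≤ M) (hc : 0 ≤ c)
    (hv : ∀ i, |v i| ≤ M) (hf : ∀ i, |f i| ≤ c) : |wavg v f| ≤ M * c := by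
  refine abs_avg_le _ (mul_nonneg hM hc) fun i => ?_
  rw [abs_mul]
  exact mul_le_mul (hv i) (hf i) (abs_nonneg _) hM

/-- The discrete counterpart of `flux`. -/
def dflux (lam : C(I × I, ℝ)) {N : ℕ} (v g : Fin N → ℝ) (i : Fin N) : ℝ :=
  1 / (N : ℝ) * ∑ j, v j * lam (node j, node i) * Real.exp (g i - g j)
    - v i * (1 / (N : ℝ) * ∑ j, lam (node i, node j) * Real.exp (g j - g i))

/-- The discrete flux is dual to the tilted generator. -/
theorem wavg_tiltedJump (lam : C(I × I, ℝ)) {N : ℕ} (v g f : Fin N → ℝ) :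
    wavg v (tiltedJump lam g f) = wavg (dflux lam v g) f := by
  simp only [wavg_apply, tiltedJump, dflux, sub_mul, Finset.sum_sub_distrib]
  have e1 : ∑ i, v i * (1 / (N : ℝ) * ∑ j, lam (node i, node j) * Real.exp (g j - g i) * (f j - f i))
      = ∑ i, ∑ j, 1 / (N : ℝ) * (v i * lam (node i, node j) * Real.exp (g j - g i) * f j)
        - ∑ i, v i * (1 / (N : ℝ) * ∑ j, lam (node i, node j) * Real.exp (g j - g i)) * f i := by
    rw [← Finset.sum_sub_distrib]
    refine Finset.sum_congr rfl fun i _ => ?_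
    simp only [Finset.mul_sum, Finset.sum_mul]
    rw [← Finset.sum_sub_distrib]
    exact Finset.sum_congr rfl fun j _ => by ring
  have e2 : ∑ i, 1 / (N : ℝ) * (∑ j, v j * lam (node j, node i) * Real.exp (g i - g j)) * f i
      = ∑ i, ∑ j, 1 / (N : ℝ) * (v i * lam (node i, node j) * Real.exp (g j - g i) * f j) := by
    rw [Finset.sum_comm]
    refine Finset.sum_congr rfl fun i _ => ?_
    rw [Finset.mul_sum, Finset.sum_mul]
    exact Finset.sum_congr rfl fun j _ => by ring
  rw [e1, e2]

section Consistency

variable {T : ℝ} {hT : 0 < T}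

theorem exists_dflux_sub_le (lam : C(I × I, ℝ)) (ψ G : C(Icc (0 : ℝ) T × I, ℝ)) {ε : ℝ}
    (hε : 0 < ε) : ∃ N₀ : ℕ, ∀ N ≥ N₀, ∀ s t, ∀ i : Fin N,
      |dflux lam (fun j => ψ (s, node j)) (fun j => G (t, node j)) i
        - flux lam (fun y => ψ (s, y)) (fun y => G (t, y)) (node i)| ≤ ε := by
  obtain ⟨N₁, h1⟩ := exists_riemann_sum_le (Y := (Icc (0 : ℝ) T × Icc (0 : ℝ) T) × I)
    ⟨fun q => ψ (q.1.1.1, q.2) * lam (q.2, q.1.2) * Real.exp (G (q.1.1.2, q.1.2) - G (q.1.1.2, q.2)),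
      by fun_prop⟩ (ε := ε / 2) (by positivity)
  obtain ⟨N₂, h2⟩ := exists_riemann_sum_le (Y := Icc (0 : ℝ) T × I)
    ⟨fun q => lam (q.1.2, q.2) * Real.exp (G (q.1.1, q.2) - G q.1), by fun_prop⟩
    (ε := ε / 2 / (‖ψ‖ + 1)) (by positivity)
  refine ⟨max N₁ N₂, fun N hN s t i => ?_⟩
  have e1 := h1 N (le_trans (le_max_left _ _) hN) ((s, t), node i)
  have e2 := h2 N (le_trans (le_max_right _ _) hN) (t, node i)
  simp only [ContinuousMap.coe_mk] at e1 e2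
  have e3 : |ψ (s, node i)| ≤ ‖ψ‖ := ψ.norm_coe_le_norm _
  have e4 := mul_le_mul e3 e2 (abs_nonneg _) (norm_nonneg _)
  rw [← abs_mul] at e4
  have e5 : ‖ψ‖ * (ε / 2 / (‖ψ‖ + 1)) ≤ ε / 2 := by
    rw [mul_div_assoc', div_le_iff₀ (by positivity)]
    nlinarith [norm_nonneg ψ]
  simp only [dflux, flux]
  have e6 := e4.trans e5
  rw [mul_sub] at e6
  rw [abs_le] at *
  constructor <;> linarith

/-- A density which nearly solves the tilted forward equation is nearly transported by the tilted
kernels: `tiltedJump` is dual to `dflux`. -/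
theorem exists_step_consistent (lam : C(I × I, ℝ)) (χ G : C10 hT) {δ : ℝ} (hδ : 0 < δ)
    (hres : ∀ t x, |flux lam (fun y => χ.val (t, y)) (fun y => G.val (t, y)) x - χ.dt (t, x)| ≤ δ) :
    ∃ m₀ N₀ : ℕ, 0 < m₀ ∧ ∀ m ≥ m₀, ∀ N ≥ N₀, ∀ k < m, ∀ f : Fin N → ℝ,
      |wavg (fun i => χ.val (gridI hT m (k + 1), node i)) f
        - wavg (fun i => χ.val (gridI hT m k, node i))
          (kern lam N (T / m) (fun j => Real.exp (G.val (gridI hT m (k + 1), node j))) f)|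
      ≤ 2 * δ * (T / m) * ‖f‖ := by
  have hδ4 : 0 < δ / 4 := by positivity
  obtain ⟨C, hC, d₀, hd₀, h1⟩ := exists_kern_sub_le lam ‖G.val‖
  obtain ⟨δ₁, hδ₁, h2⟩ := exists_increment_le χ hδ4
  set K : ℝ := 4 * (‖χ.val‖ * ‖lam‖ * Real.exp (2 * ‖G.val‖)) with hK
  have hK0 : 0 ≤ K := by positivity
  obtain ⟨δ₂, hδ₂, h3⟩ := exists_modulus G.val (ε := δ / 4 / (K + 1)) (by positivity)
  obtain ⟨N₀, h4⟩ := exists_dflux_sub_le lam χ.val G.val hδ4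
  have hmin : 0 < min (min d₀ (δ / 4 / (‖χ.val‖ * C + 1))) (min δ₁ δ₂) := by positivity
  obtain ⟨m₀, hm₀, h5⟩ := exists_mesh_lt T hmin
  refine ⟨m₀, N₀, hm₀, fun m hm N hN k hk f => ?_⟩
  have h6 := h5 m hm
  set d : ℝ := T / m with hd
  have hd0 : 0 ≤ d := by positivity
  have hdd : d ≤ d₀ := (h6.trans_le ((min_le_left _ _).trans (min_le_left _ _))).le
  have hdC : d ≤ δ / 4 / (‖χ.val‖ * C + 1) :=
    (h6.trans_le ((min_le_left _ _).trans (min_le_right _ _))).le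
  have hdδ₁ : d < δ₁ := h6.trans_le ((min_le_right _ _).trans (min_le_left _ _))
  have hdδ₂ : d < δ₂ := h6.trans_le ((min_le_right _ _).trans (min_le_right _ _))
  set t := gridI hT m k
  set t' := gridI hT m (k + 1)
  have hstep : (t' : ℝ) - t = d := gridI_step hT hk
  have htt : t ≤ t' := by
    have : (t : ℝ) ≤ t' := by linarith
    exact this
  set g : Fin N → ℝ := fun j => G.val (t', node j) with hg
  set v : Fin N → ℝ := fun j => χ.val (t, node j) with hv
  set v' : Fin N → ℝ := fun j => χ.val (t', node j) with hv'
  have hfn : ∀ i, |f i| ≤ ‖f‖ := fun i => norm_le_pi_norm f i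
  have a1 : |wavg v (kern lam N d (fun j => Real.exp (g j)) f - f - d • tiltedJump lam g f)|
      ≤ δ / 4 * d * ‖f‖ := by
    refine (abs_wavg_le (norm_nonneg χ.val) (c := C * d ^ 2 * ‖f‖) (by positivity)
      (fun i => χ.val.norm_coe_le_norm _)
      (fun i => h1 N g (fun j => G.val.norm_coe_le_norm _) d hd0 hdd f i)).trans ?_
    rw [le_div_iff₀ (by positivity)] at hdC
    have : ‖χ.val‖ * (C * d ^ 2 * ‖f‖) = (d * (‖χ.val‖ * C)) * d * ‖f‖ := by ring
    rw [this]
    gcongr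
    linarith
  have a2 : |wavg (fun i => v' i - v i - d * dflux lam v g i) f|
      ≤ (δ + 3 * (δ / 4)) * d * ‖f‖ := by
    refine abs_wavg_le (by positivity) (norm_nonneg f) (fun i => ?_) hfn
    have b1 := h2 t t' htt (by rw [hstep]; exact hdδ₁) (node i)
    rw [hstep] at b1
    have b2 := h4 N hN t t' i
    have b3 := abs_flux_sub_le lam (ψ := fun y => χ.val (t, y)) (g := fun y => G.val (t', y))
      (g' := fun y => G.val (t, y)) (by fun_prop) (by fun_prop) (by fun_prop)
      (fun y => χ.val.norm_coe_le_norm _) (fun y => G.val.norm_coe_le_norm _)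
      (fun y => G.val.norm_coe_le_norm _) (fun y => h3 t' t (by rw [dist_gridI hT hk]; exact hdδ₂) y)
      (node i)
    have b4 : K * (δ / 4 / (K + 1)) ≤ δ / 4 := by
      rw [mul_div_assoc', div_le_iff₀ (by positivity)]
      nlinarith
    have b5 := hres t (node i)
    have b6 : |dflux lam v g i - χ.dt (t, node i)| ≤ δ + 2 * (δ / 4) := by
      have b3' := b3.trans b4
      rw [abs_le] at *
      constructor <;> linarith
    have b7 := mul_le_mul_of_nonneg_left b6 hd0
    rw [← abs_of_nonneg hd0, ← abs_mul, abs_of_nonneg hd0] at b7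
    rw [abs_le] at *
    constructor <;> linarith
  have e1 : wavg (fun i => v' i - v i - d * dflux lam v g i) f
      = wavg v' f - wavg v f - d * wavg (dflux lam v g) f := by
    simp only [wavg_apply, sub_mul, Finset.sum_sub_distrib, mul_sub, Finset.mul_sum]
    congr 1
    exact Finset.sum_congr rfl fun i _ => by ring
  rw [e1] at a2
  rw [map_sub, map_sub, map_smul, smul_eq_mul, wavg_tiltedJump] at a1
  have e2 : 2 * δ * d * ‖f‖ = δ / 4 * d * ‖f‖ + (δ + 3 * (δ / 4)) * d * ‖f‖ := by ring
  rw [e2]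
  rw [abs_le] at *
  constructor <;> linarith

end Consistency

/-- Stability: the errors of the single steps add up, since the tilted kernels are contractions. -/
theorem abs_wavg_kernIter_sub_le {lam : C(I × I, ℝ)} (hpos : ∀ p, 0 < lam p) {N : ℕ} {τ : ℕ → ℝ≥0}
    (hτ : Monotone τ) {b : ℕ → Fin N → ℝ} (hb : ∀ k i, 0 < b k i) {u : Fin N → ℝ}
    {v : ℕ → Fin N → ℝ} {e₀ e : ℝ} {m : ℕ} (he₀ : 0 ≤ e₀) (he : 0 ≤ e)
    (h0 : ∀ f, |wavg u f - wavg (v 0) f| ≤ e₀ * ‖f‖)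
    (h : ∀ k < m, ∀ f, |wavg (v (k + 1)) f
      - wavg (v k) (kern lam N (τ (k + 1) - τ k) (b (k + 1)) f)| ≤ e * ‖f‖) :
    ∀ n ≤ m, ∀ f, |wavg u (kernIter lam N τ b n f) - wavg (v n) f| ≤ (e₀ + n * e) * ‖f‖ := by
  intro n
  induction n with
  | zero => intro _ f; simpa [kernIter] using h0 f
  | succ n ih =>
    intro hn f
    have h1 := ih (by omega) (kern lam N (τ (n + 1) - τ n) (b (n + 1)) f)
    have h2 := h n (by omega) f
    have h3 := mul_le_mul_of_nonneg_left (norm_kern_le hpos (step_nonneg hτ n) (hb (n + 1)) f)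
      (by positivity : 0 ≤ e₀ + n * e)
    rw [kernIter]
    push_cast
    rw [abs_le] at *
    constructor <;> linarith

theorem exists_norm_kern_sub_log_le (lam : C(I × I, ℝ)) {R : ℝ} (hR : 0 ≤ R) : ∃ C ≥ 0, ∃ d₀ > 0,
    ∀ (N : ℕ) (g : Fin N → ℝ), (∀ i, |g i| ≤ R) → ∀ d, 0 ≤ d → d ≤ d₀ →
      ‖kern lam N d (fun j => Real.exp (g j)) g
        - fun i => Real.log (semi lam N d (fun j => Real.exp (g j)) i)‖ ≤ C * d := by
  obtain ⟨C₁, hC₁, d₁, hd₁, h1⟩ := exists_log_semi_sub_le lam R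
  obtain ⟨C₂, hC₂, d₂, hd₂, h2⟩ := exists_kern_sub_le lam R
  refine ⟨C₁ + C₂ * R + ‖lam‖ * (Real.exp (2 * R) + 1) + 2 * ‖lam‖ * Real.exp (2 * R) * R,
    by positivity, min 1 (min d₁ d₂), by positivity, fun N g hg d hd hdd => ?_⟩
  have hd1 : d ≤ 1 := hdd.trans (min_le_left _ _)
  have hgn : ‖g‖ ≤ R := (pi_norm_le_iff_of_nonneg hR).2 hg
  rw [pi_norm_le_iff_of_nonneg (by positivity)]
  intro i
  have a1 := h1 N g hg d hd (hdd.trans ((min_le_right _ _).trans (min_le_left _ _))) i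
  have a2 := h2 N g hg d hd (hdd.trans ((min_le_right _ _).trans (min_le_right _ _))) g i
  have a3 := mul_le_mul_of_nonneg_left (abs_discB_le (lam := lam) hg i) hd
  have a4 := mul_le_mul_of_nonneg_left (abs_tiltedJump_le (lam := lam) hg g i) hd
  rw [← abs_of_nonneg hd, ← abs_mul, abs_of_nonneg hd] at a3 a4
  have hd2 : d ^ 2 ≤ d := by nlinarith
  have a5 : C₁ * d ^ 2 ≤ C₁ * d := by gcongr
  have a6 : C₂ * d ^ 2 * ‖g‖ ≤ C₂ * d * R := by gcongr
  have a7 : d * (2 * ‖lam‖ * Real.exp (2 * R) * ‖g‖) ≤ d * (2 * ‖lam‖ * Real.exp (2 * R) * R) := by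
    gcongr
  rw [Real.norm_eq_abs, Pi.sub_apply]
  rw [abs_le] at *
  constructor <;> linarith

/-- The cost of the tilt, computed with the mean of the tilted process, is close to the cost computed
with a density which is nearly transported. -/
theorem sum_kernIter_sub_log_le {lam : C(I × I, ℝ)} (hpos : ∀ p, 0 < lam p) {N : ℕ} {τ : ℕ → ℝ≥0}
    (hτ : Monotone τ) {g : ℕ → Fin N → ℝ} {u : Fin N → ℝ}
    {v : ℕ → Fin N → ℝ} {e₀ e κ R : ℝ} {m : ℕ} (he₀ : 0 ≤ e₀) (he : 0 ≤ e) (hR : 0 ≤ R)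
    (hg : ∀ k i, |g k i| ≤ R)
    (h0 : ∀ f, |wavg u f - wavg (v 0) f| ≤ e₀ * ‖f‖)
    (h : ∀ k < m, ∀ f, |wavg (v (k + 1)) f
      - wavg (v k) (kern lam N (τ (k + 1) - τ k) (fun j => Real.exp (g (k + 1) j)) f)| ≤ e * ‖f‖)
    (hκ : ∀ k < m, ‖kern lam N (τ (k + 1) - τ k) (fun j => Real.exp (g (k + 1) j)) (g (k + 1))
        - fun i => Real.log (semi lam N (τ (k + 1) - τ k) (fun j => Real.exp (g (k + 1) j)) i)‖ ≤ κ) :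
    ∑ k ∈ Finset.range m, (wavg u (kernIter lam N τ (fun k j => Real.exp (g k j)) (k + 1) (g (k + 1)))
      - wavg u (kernIter lam N τ (fun k j => Real.exp (g k j)) k
        (fun i => Real.log (semi lam N (τ (k + 1) - τ k) (fun j => Real.exp (g (k + 1) j)) i))))
    ≤ ∑ k ∈ Finset.range m, (wavg (v (k + 1)) (g (k + 1)) - wavg (v k)
        (fun i => Real.log (semi lam N (τ (k + 1) - τ k) (fun j => Real.exp (g (k + 1) j)) i)))
      + m * ((e₀ + m * e) * κ + e * R) := by
  have e1 : (m : ℝ) * ((e₀ + m * e) * κ + e * R)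
      = ∑ _k ∈ Finset.range m, ((e₀ + m * e) * κ + e * R) := by
    rw [Finset.sum_const, Finset.card_range, nsmul_eq_mul]
  rw [e1, ← Finset.sum_add_distrib]
  -- the step contributes the pairing of the mean at the `k`-th time with `Kg - L`, which is small
  refine Finset.sum_le_sum fun k hk => ?_
  rw [Finset.mem_range] at hk
  set b : ℕ → Fin N → ℝ := fun k j => Real.exp (g k j) with hb
  have hiter : ∀ n f f', wavg u (kernIter lam N τ b n f) - wavg u (kernIter lam N τ b n f')
      = wavg u (kernIter lam N τ b n (f - f')) := by
    intro n
    induction n with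
    | zero => intro f f'; simp only [kernIter, map_sub]
    | succ n ih => intro f f'; simp only [kernIter, ih, kern_sub]
  set L : Fin N → ℝ := fun i =>
    Real.log (semi lam N (τ (k + 1) - τ k) (fun j => Real.exp (g (k + 1) j)) i) with hL
  set Kg := kern lam N (τ (k + 1) - τ k) (b (k + 1)) (g (k + 1)) with hKg
  have h1 : kernIter lam N τ b (k + 1) (g (k + 1)) = kernIter lam N τ b k Kg := rfl
  rw [h1, hiter]
  have h2 := (abs_le.1 (abs_wavg_kernIter_sub_le hpos hτ (b := b) (fun k i => Real.exp_pos _) he₀ he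
    h0 h k hk.le (Kg - L))).2
  have h3 := (abs_le.1 (h k hk (g (k + 1)))).1
  have h4 : (e₀ + k * e) * ‖Kg - L‖ ≤ (e₀ + m * e) * κ := by
    have : (k : ℝ) ≤ m := by exact_mod_cast hk.le
    exact mul_le_mul (by gcongr) (hκ k hk) (norm_nonneg _) (by positivity)
  have h5 : e * ‖g (k + 1)‖ ≤ e * R := by
    have : ‖g (k + 1)‖ ≤ R := (pi_norm_le_iff_of_nonneg hR).2 (hg (k + 1))
    gcongr
  rw [map_sub] at h2
  change -(e * ‖g (k + 1)‖) ≤ wavg (v (k + 1)) (g (k + 1)) - wavg (v k) Kg at h3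
  linarith

/-! ### Controls for the mean of the tilted process -/

section MeanControl

variable {T : ℝ} {hT : 0 < T}

theorem exists_wavg_sub_integral_le (W χ : C(Icc (0 : ℝ) T × I, ℝ)) {ε : ℝ} (hε : 0 < ε) :
    ∀ᶠ N : ℕ in atTop, ∀ t, |wavg (fun i : Fin N => χ (t, node i)) (fun i => W (t, node i))
      - ∫ x : I, W (t, x) * χ (t, x)| ≤ ε := by
  obtain ⟨N₀, h⟩ := exists_riemann_sum_le (Y := Icc (0 : ℝ) T)
    ⟨fun q => W q * χ q, by fun_prop⟩ hε
  refine eventually_atTop.2 ⟨N₀, fun N hN t => ?_⟩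
  have := h N hN t
  simp only [ContinuousMap.coe_mk] at this
  rw [wavg_apply]
  simp only [mul_comm (χ _)]
  exact this

/-- The logarithm of the transition semigroup applied to `exp G`, in the `k`-th step of the grid. -/
def logStep (lam : C(I × I, ℝ)) (N : ℕ) (G : C10 hT) (m k : ℕ) : Fin N → ℝ := fun i =>
  Real.log (semi lam N (grid T m (k + 1) - grid T m k)
    (fun j => Real.exp (G.val (gridI hT m (k + 1), node j))) i)

/-- The mean of the empirical measure at the `k`-th time, tested with `f`, when the balls start from
independent Poisson variables of means `φ exp H` and move with the kernels tilted by `exp G`. -/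
def mean (lam : C(I × I, ℝ)) (φ H : C(I, ℝ)) (N : ℕ) (G : C10 hT) (m k : ℕ) (f : Fin N → ℝ) : ℝ :=
  wavg (fun i => φ (node i) * Real.exp (H (node i)))
    (kernIter lam N (grid T m) (fun k j => Real.exp (G.val (gridI hT m k, node j))) k f)

/-- The logarithm of the normalized tilt divided by `N`, with the empirical measures replaced by their
means under the tilted law. -/
def meanCost (lam : C(I × I, ℝ)) (φ H : C(I, ℝ)) (N : ℕ) (G : C10 hT) (m : ℕ) : ℝ :=
  mean lam φ H N G m 0 (fun i => H (node i))
    + ∑ k ∈ Finset.range m, (mean lam φ H N G m (k + 1) (fun i => G.val (gridI hT m (k + 1), node i))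
      - mean lam φ H N G m k (logStep lam N G m k))
    - 1 / (N : ℝ) * ∑ i : Fin N, φ (node i) * (Real.exp (H (node i)) - 1)

set_option maxHeartbeats 1000000 in
/-- Controls which steer the mean of the process along a given density at nearly its cost. -/
theorem exists_mean_control {lam : C(I × I, ℝ)} (hpos : ∀ p, 0 < lam p) {lam₁ lam₂ : C(I, ℝ)}
    (hprod : ∀ x y : I, lam (x, y) = lam₁ x * lam₂ y) {φ : C(I, ℝ)} (hφ : ∀ x, 0 ≤ φ x)
    (ψ : C10 hT) (hψ : ∀ p, 0 ≤ ψ.val p) (hdt : ∀ s : Icc (0 : ℝ) T, ∫ x : I, ψ.dt (s, x) = 0)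
    {a₁ a₂ : ℝ} (ha₁ : ∀ H, costIni φ H (ψ.val.curry (t0 hT)) ≤ a₁)
    (ha₂ : ∀ G : C10 hT, costDyn lam G ψ.val ≤ a₂) (s : Finset C(I, ℝ)) {ε gap : ℝ} (hε : 0 < ε)
    (hgap : 0 < gap) :
    ∃ (H : C(I, ℝ)) (G : C10 hT) (B : ℝ) (m₀ : ℕ), 0 < m₀ ∧ ∀ m ≥ m₀, ∀ᶠ N : ℕ in atTop,
      meanCost lam φ H N G m ≤ a₁ + a₂ + gap ∧
      (∀ k ≤ m, ∀ f ∈ s, |mean lam φ H N G m k (fun i => f (node i))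
        - ∫ x : I, f x * ψ.val (gridI hT m k, x)| ≤ ε) ∧
      ∀ k i, |logStep lam N G m k i| ≤ B := by
  set Fb : ℝ := 1 + ∑ f ∈ s, ‖f‖ with hFb
  have hFb0 : 0 < Fb := by positivity
  have hsF : ∀ f ∈ s, ‖f‖ ≤ Fb := fun f hf => by
    have := Finset.single_le_sum (f := fun f : C(I, ℝ) => ‖f‖) (fun _ _ => norm_nonneg _) hf
    linarith
  set u : ℝ := gap / 8 with hu
  have hu0 : 0 < u := by positivity
  obtain ⟨χ, hχ0, hχψ, R, hR, hctl⟩ := exists_control hpos hprod hφ ψ hψ hdt ha₁ ha₂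
    (ε := min u (ε / 4 / Fb)) (by positivity)
  obtain ⟨C, hC, d₀, hd₀, hκ⟩ := exists_norm_kern_sub_log_le lam hR
  set W₀ : ℝ := 2 * (1 + T) * (Fb + C * T + R) + 1 with hW₀
  have hW₀0 : 0 < W₀ := by positivity
  -- `δ` bounds the error of the control; its bound `R` and hence `W₀` do not depend on `δ`
  set δ : ℝ := min (ε / 4) u / W₀ with hδ
  have hδ0 : 0 < δ := by positivity
  have hδW : δ * W₀ = min (ε / 4) u := by rw [hδ]; field_simp
  obtain ⟨H, G, hGR, hHs, hH1, hres, hcost⟩ := hctl δ hδ0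
  obtain ⟨m₁, N₁, hm₁, hstep⟩ := exists_step_consistent lam χ G hδ0 hres
  obtain ⟨m₂, N₂, hm₂, hsum⟩ := exists_sum_step_le lam G (ε := u / ((‖χ.val‖ + 1) * T))
    (by positivity)
  obtain ⟨m₃, hm₃, hgrid⟩ := exists_grid_sum_le hT
    ⟨_, continuous_integral_mul (dtB lam G) χ.val⟩ hu0
  obtain ⟨m₄, hm₄, hmesh⟩ := exists_mesh_lt T hd₀
  refine ⟨H, G, R + C * T, max (max m₁ m₂) (max m₃ m₄), by positivity, fun m hm => ?_⟩
  have hmm₁ : m₁ ≤ m := le_trans ((le_max_left _ _).trans (le_max_left _ _)) hm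
  have hmm₂ : m₂ ≤ m := le_trans ((le_max_right _ _).trans (le_max_left _ _)) hm
  have hmm₃ : m₃ ≤ m := le_trans ((le_max_left _ _).trans (le_max_right _ _)) hm
  have hmm₄ : m₄ ≤ m := le_trans ((le_max_right _ _).trans (le_max_right _ _)) hm
  have hmpos : 0 < m := lt_of_lt_of_le hm₁ hmm₁
  have hm' : (0 : ℝ) < m := by exact_mod_cast hmpos
  set η : ℝ := u / (3 + T) with hη
  have hη0 : 0 < η := by positivity
  have hηu : (3 + T) * η = u := by rw [hη]; field_simp
  have hev1 : ∀ᶠ N : ℕ in atTop, 1 / (N : ℝ) * ∑ i : Fin N,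
      |φ (node i) * Real.exp (H (node i)) - χ.val (t0 hT, node i)| ≤ 2 * δ := by
    obtain ⟨N₀, h⟩ := exists_riemann_sum_le (Y := Unit)
      ⟨fun q => |φ q.2 * Real.exp (H q.2) - χ.val (t0 hT, q.2)|, by fun_prop⟩ hδ0
    refine eventually_atTop.2 ⟨N₀, fun N hN => ?_⟩
    have h1 := (abs_le.1 (h N hN ())).2
    simp only [ContinuousMap.coe_mk] at h1
    linarith
  have hev2 := exists_wavg_sub_integral_le G.val χ.val hη0
  have hev3 := exists_wavg_sub_integral_le (dtB lam G) χ.val hη0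
  have hev4 := exists_wavg_sub_integral_le ⟨fun q => H q.2, by fun_prop⟩ χ.val hη0
  have hev5 : ∀ᶠ N : ℕ in atTop, ∀ f ∈ s, ∀ t, |wavg (fun i : Fin N => χ.val (t, node i))
      (fun i => f (node i)) - ∫ x : I, f x * χ.val (t, x)| ≤ ε / 4 :=
    (Finset.eventually_all s).2 fun f _ =>
      exists_wavg_sub_integral_le ⟨fun q => f q.2, by fun_prop⟩ χ.val (by positivity)
  have hev6 := exists_initial_sum_le φ H hu0
  filter_upwards [hev1, hev2, hev3, hev4, hev5, hev6, eventually_ge_atTop N₁,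
    eventually_ge_atTop N₂] with N hN1 hN2 hN3 hN4 hN5 hN6 hNN₁ hNN₂
  set w : Fin N → ℝ := fun i => φ (node i) * Real.exp (H (node i)) with hw
  set v : ℕ → Fin N → ℝ := fun k i => χ.val (gridI hT m k, node i) with hv
  set g : ℕ → Fin N → ℝ := fun k i => G.val (gridI hT m k, node i) with hg
  have hτ := grid_monotone hT m
  have hgR : ∀ k i, |g k i| ≤ R := fun k i => (G.val.norm_coe_le_norm _).trans hGR
  have h0 : ∀ f, |wavg w f - wavg (v 0) f| ≤ 2 * δ * ‖f‖ := by
    intro f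
    have e : wavg w f - wavg (v 0) f = 1 / (N : ℝ) * ∑ i, (w i - v 0 i) * f i := by
      rw [wavg_apply, wavg_apply, ← mul_sub, ← Finset.sum_sub_distrib]
      congr 1
      exact Finset.sum_congr rfl fun i _ => by ring
    rw [e, abs_mul, abs_of_nonneg (by positivity : 0 ≤ 1 / (N : ℝ))]
    refine le_trans ?_ (mul_le_mul_of_nonneg_right hN1 (norm_nonneg f))
    rw [mul_assoc, Finset.sum_mul]
    gcongr
    refine (Finset.abs_sum_le_sum_abs _ _).trans (Finset.sum_le_sum fun i _ => ?_)
    rw [abs_mul]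
    refine mul_le_mul (le_of_eq ?_) (norm_le_pi_norm f i) (abs_nonneg _) (abs_nonneg _)
    simp only [hw, hv, gridI_zero]
  have h : ∀ k < m, ∀ f, |wavg (v (k + 1)) f - wavg (v k)
      (kern lam N (grid T m (k + 1) - grid T m k) (fun j => Real.exp (g (k + 1) j)) f)|
      ≤ 2 * δ * (T / m) * ‖f‖ := by
    intro k hk f
    rw [grid_step hT]
    exact hstep m hmm₁ N hNN₁ k hk f
  have hκ' : ∀ k, ‖kern lam N (grid T m (k + 1) - grid T m k)
      (fun j => Real.exp (g (k + 1) j)) (g (k + 1)) - logStep lam N G m k‖ ≤ C * (T / m) := by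
    intro k
    have := hκ N (g (k + 1)) (hgR _) (T / m) (by positivity) (hmesh m hmm₄).le
    have e : logStep lam N G m k
        = fun i => Real.log (semi lam N (T / m) (fun j => Real.exp (g (k + 1) j)) i) := by
      funext i
      rw [logStep, grid_step hT]
    rw [e, grid_step hT]
    exact this
  have hE : 2 * δ + m * (2 * δ * (T / m)) = 2 * δ * (1 + T) := by field_simp
  refine ⟨?_, fun k hk f hf => ?_, fun k i => ?_⟩
  · have c1 := sum_kernIter_sub_log_le hpos hτ (e₀ := 2 * δ) (e := 2 * δ * (T / m))
      (κ := C * (T / m)) (by positivity) (by positivity) hR hgR h0 h (fun k _ => hκ' k)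
    rw [hE] at c1
    have c2 : (m : ℝ) * (2 * δ * (1 + T) * (C * (T / m)) + 2 * δ * (T / m) * R)
        ≤ u := by
      have e : (m : ℝ) * (2 * δ * (1 + T) * (C * (T / m)) + 2 * δ * (T / m) * R)
          = δ * (2 * (1 + T) * (C * T) + 2 * T * R) := by field_simp
      rw [e]
      refine le_trans (mul_le_mul_of_nonneg_left ?_ hδ0.le) (hδW.le.trans (min_le_right _ _))
      have h1 : 0 ≤ 2 * (1 + T) * Fb := by positivity
      rw [hW₀]
      nlinarith
    have c3 := (abs_le.1 (hsum m hmm₂ N hNN₂ ‖χ.val‖ (norm_nonneg _) (fun k => wavg (v k))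
      (fun k f c hc hf => abs_wavg_le (norm_nonneg _) hc (fun i => χ.val.norm_coe_le_norm _) hf))).2
    have c4 : ‖χ.val‖ * (u / ((‖χ.val‖ + 1) * T)) * T ≤ u := by
      have : ‖χ.val‖ * (u / ((‖χ.val‖ + 1) * T)) * T = u * (‖χ.val‖ / (‖χ.val‖ + 1)) := by
        field_simp
      rw [this]
      exact mul_le_of_le_one_right hu0.le ((div_le_one (by positivity)).2 (by linarith))
    have c5 := (abs_le.1 (hN2 (tT hT))).2
    have c6 := (abs_le.1 (hN2 (t0 hT))).1
    have c7 : ∑ k ∈ Finset.range m, T / m * (∫ x : I, dtB lam G (gridI hT m k, x)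
        * χ.val (gridI hT m k, x)) - T * η
        ≤ ∑ k ∈ Finset.range m, T / m * wavg (v k) (fun i => dtB lam G (gridI hT m k, node i)) := by
      have : T * η = ∑ k ∈ Finset.range m, T / m * η := by
        rw [Finset.sum_const, Finset.card_range, nsmul_eq_mul]; field_simp
      rw [this, ← Finset.sum_sub_distrib]
      refine Finset.sum_le_sum fun k _ => ?_
      rw [← mul_sub]
      refine mul_le_mul_of_nonneg_left ?_ (by positivity)
      linarith [(abs_le.1 (hN3 (gridI hT m k))).1]
    have c8 := (abs_le.1 (hgrid m hmm₃)).1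
    have c9 := (abs_le.1 (hN4 (t0 hT))).2
    have c10 := (abs_le.1 hN6).1
    -- the sign condition on the initial tilt
    have c11 : wavg w (fun i => H (node i))
        ≤ wavg (fun i : Fin N => χ.val (t0 hT, node i)) (fun i => H (node i)) := by
      rw [wavg_apply, wavg_apply]
      refine mul_le_mul_of_nonneg_left (Finset.sum_le_sum fun i _ => ?_) (by positivity)
      have h1 := hHs (node i)
      rw [sub_mul] at h1
      exact sub_nonpos.1 h1
    have hmin := min_le_left u (ε / 4 / Fb)
    simp only [costIni, costDyn] at hcost
    simp only [ContinuousMap.coe_mk] at c8 c9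
    have hm0 : mean lam φ H N G m 0 (fun i => H (node i)) = wavg w (fun i => H (node i)) := rfl
    rw [meanCost, hm0]
    change ∑ k ∈ Finset.range m, (mean lam φ H N G m (k + 1) (g (k + 1))
      - mean lam φ H N G m k (logStep lam N G m k)) ≤ _ at c1
    have e1 : gridI hT m m = tT hT := gridI_last hT hmpos
    have e2 : gridI hT m 0 = t0 hT := gridI_zero hT m
    simp only [hv, e1, e2] at c3
    have e3 : ∀ x : I, H x * χ.val.curry (t0 hT) x = H x * χ.val (t0 hT, x) := fun x => rfl
    simp only [e3] at hcost
    suffices hS : ∀ S₀, S₀ ≤ ∑ k ∈ Finset.range m, (wavg (v (k + 1)) (g (k + 1))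
        - wavg (v k) (logStep lam N G m k))
        + (m : ℝ) * (2 * δ * (1 + T) * (C * (T / m)) + 2 * δ * (T / m) * R) →
        wavg w (fun i => H (node i)) + S₀
          - 1 / (N : ℝ) * ∑ i : Fin N, φ (node i) * (Real.exp (H (node i)) - 1) ≤ a₁ + a₂ + gap from
      hS _ c1
    intro S₀ hS₀
    suffices hS1 : ∀ S₁, S₁ - (wavg (fun i : Fin N => χ.val (tT hT, node i))
          (fun i => G.val (tT hT, node i)) - wavg (fun i : Fin N => χ.val (t0 hT, node i))
          (fun i => G.val (t0 hT, node i)) - ∑ k ∈ Finset.range m, T / m * wavg (v k)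
          (fun i => dtB lam G (gridI hT m k, node i))) ≤
          ‖χ.val‖ * (u / ((‖χ.val‖ + 1) * T)) * T → S₀ ≤ S₁
        + (m : ℝ) * (2 * δ * (1 + T) * (C * (T / m)) + 2 * δ * (T / m) * R) →
        wavg w (fun i => H (node i)) + S₀
          - 1 / (N : ℝ) * ∑ i : Fin N, φ (node i) * (Real.exp (H (node i)) - 1) ≤ a₁ + a₂ + gap from
      hS1 _ c3 hS₀
    intro S₁ hS₁ hS₂
    linarith
  · have p1 := abs_wavg_kernIter_sub_le hpos hτ (b := fun k j => Real.exp (g k j))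
      (e₀ := 2 * δ) (e := 2 * δ * (T / m)) (fun k i => Real.exp_pos _) (by positivity)
      (by positivity) h0 h k hk (fun i => f (node i))
    have p2 : (2 * δ + k * (2 * δ * (T / m))) * ‖fun i : Fin N => f (node i)‖ ≤ ε / 4 := by
      have q1 : ‖fun i : Fin N => f (node i)‖ ≤ Fb :=
        (pi_norm_le_iff_of_nonneg hFb0.le).2 fun i => (f.norm_coe_le_norm _).trans (hsF f hf)
      have q2 : 2 * δ + k * (2 * δ * (T / m)) ≤ 2 * δ * (1 + T) := by
        rw [← hE]
        have : (k : ℝ) ≤ m := by exact_mod_cast hk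
        gcongr
      refine (mul_le_mul q2 q1 (norm_nonneg _) (by positivity)).trans ?_
      have e : 2 * δ * (1 + T) * Fb = δ * (2 * (1 + T) * Fb) := by ring
      rw [e]
      refine le_trans (mul_le_mul_of_nonneg_left ?_ hδ0.le) (hδW.le.trans (min_le_left _ _))
      have h1 : 0 ≤ 2 * (1 + T) * (C * T + R) := by positivity
      rw [hW₀]
      nlinarith
    have p3 := hN5 f hf (gridI hT m k)
    have p4 : |(∫ x : I, f x * χ.val (gridI hT m k, x)) - ∫ x : I, f x * ψ.val (gridI hT m k, x)|
        ≤ ε / 4 := by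
      rw [← integral_sub (integrable_of_continuous (by fun_prop))
        (integrable_of_continuous (by fun_prop))]
      refine abs_integral_unitInterval_le fun x => ?_
      rw [← mul_sub, abs_mul]
      refine (mul_le_mul ((f.norm_coe_le_norm x).trans (hsF f hf))
        ((hχψ _).trans (min_le_right _ _)) (abs_nonneg _) hFb0.le).trans (le_of_eq ?_)
      field_simp
    change |mean lam φ H N G m k (fun i => f (node i)) - _| ≤ _ at p1
    have p1' := abs_le.1 (p1.trans p2)
    have p3' := abs_le.1 p3
    have p4' := abs_le.1 p4
    simp only [hv] at p1'
    exact abs_le.2 ⟨by linarith, by linarith⟩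
  · have q1 := hκ' k
    have q2 : ‖g (k + 1)‖ ≤ R := (pi_norm_le_iff_of_nonneg hR).2 (hgR _)
    have q3 := norm_kern_le hpos (step_nonneg hτ k)
      (b := fun j => Real.exp (g (k + 1) j)) (fun j => Real.exp_pos _) (g (k + 1))
    have q4 : C * (T / m) ≤ C * T := by
      gcongr
      exact div_le_self hT.le (by exact_mod_cast hmpos)
    have q5 := norm_le_pi_norm (logStep lam N G m k) i
    have q6 := norm_sub_norm_le (logStep lam N G m k) (kern lam N (grid T m (k + 1) - grid T m k)
      (fun j => Real.exp (g (k + 1) j)) (g (k + 1)))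
    rw [norm_sub_rev] at q6
    rw [Real.norm_eq_abs] at q5
    linarith

end MeanControl

/-! ### Concentration under the tilted law -/

theorem kern_affine {lam : C(I × I, ℝ)} (hpos : ∀ p, 0 < lam p) {N : ℕ} {t : ℝ} (ht : 0 ≤ t)
    {b : Fin N → ℝ} (hb : ∀ i, 0 < b i) (c θ : ℝ) (f : Fin N → ℝ) :
    kern lam N t b (fun i => c + θ * f i) = fun i => c + θ * kern lam N t b f i := by
  have e : b * (fun i => c + θ * f i) = c • b + θ • (b * f) := by
    ext i
    simp only [Pi.mul_apply, Pi.add_apply, Pi.smul_apply, smul_eq_mul]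
    ring
  ext i
  have h := (semi_pos hpos ht hb i).ne'
  rw [kern, kern, e, map_add, map_smul, map_smul, Pi.div_apply, Pi.div_apply, Pi.add_apply,
    Pi.smul_apply, Pi.smul_apply, smul_eq_mul, smul_eq_mul]
  field_simp

section Iter

variable {lam : C(I × I, ℝ)} {N : ℕ} {τ : ℕ → ℝ≥0} {b : ℕ → Fin N → ℝ}

theorem kernIter_affine (hpos : ∀ p, 0 < lam p) (hτ : Monotone τ) (hb : ∀ k i, 0 < b k i)
    (n : ℕ) (c θ : ℝ) (f : Fin N → ℝ) :
    kernIter lam N τ b n (fun i => c + θ * f i) = fun i => c + θ * kernIter lam N τ b n f i := by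
  induction n generalizing f with
  | zero => rfl
  | succ n ih => rw [kernIter, kern_affine hpos (step_nonneg hτ n) (hb _), ih]; rfl

theorem kernIter_mono (hpos : ∀ p, 0 < lam p) (hτ : Monotone τ) (hb : ∀ k i, 0 < b k i)
    (n : ℕ) {f f' : Fin N → ℝ} (h : f ≤ f') :
    kernIter lam N τ b n f ≤ kernIter lam N τ b n f' := by
  induction n generalizing f f' with
  | zero => exact h
  | succ n ih => exact ih (kern_mono hpos (step_nonneg hτ n) (fun i => (hb _ i).le) h)

end Iter

theorem exp_avgc {N : ℕ} (hN : 0 < N) (x : Fin N → ℕ) (f : Fin N → ℝ) (θ : ℝ) :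
    Real.exp (N * (θ * avgc x f)) = mult (fun i => Real.exp (θ * f i)) x := by
  have hN' : (N : ℝ) ≠ 0 := by exact_mod_cast hN.ne'
  rw [mult_exp, avgc]
  congr 1
  rw [Finset.mul_sum, Finset.mul_sum, Finset.mul_sum]
  refine Finset.sum_congr rfl fun i _ => ?_
  field_simp

/-- The one-sided Chernoff bound under the tilted law, with a constant `c` that depends on the test
vector `f` only through its bound `B`. -/
theorem exists_setLIntegral_tilt_le {B M₀ ε : ℝ} (hB : 0 ≤ B) (hM₀ : 0 ≤ M₀) (hε : 0 < ε) :
    ∃ c > 0, ∀ (lam : C(I × I, ℝ)) (_ : ∀ p, 0 < lam p) (φ : C(I, ℝ)) (_ : ∀ x, 0 ≤ φ x) (N : ℕ)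
      (_ : 0 < N) (Ω : Type*) [m : MeasurableSpace Ω] (P : Measure Ω) [IsProbabilityMeasure P]
      (X : ℝ≥0 → Ω → Fin N → ℕ) (ℱ : Filtration ℝ≥0 m) (_ : IsUrnProcess lam N P X)
      (_ : SolvesMartingaleProblem lam P X ℱ) (_ : IsPoissonInitial φ N P (X 0)) (τ : ℕ → ℝ≥0)
      (_ : Monotone τ) (_ : τ 0 = 0) (H : Fin N → ℝ) (g : ℕ → Fin N → ℝ)
      (_ : ∀ i, φ (node i) * Real.exp (H i) ≤ M₀) (k n : ℕ) (_ : k ≤ n) (f : Fin N → ℝ)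
      (_ : ∀ i, |f i| ≤ B),
      ∫⁻ ω in {ω | ε ≤ avgc (X (τ k) ω) f - wavg (fun i => φ (node i) * Real.exp (H i))
          (kernIter lam N τ (fun k j => Real.exp (g k j)) k f)},
        ENNReal.ofReal (tilt lam X τ (fun i => Real.exp (H i)) (fun k j => Real.exp (g k j)) n ω) ∂P
      ≤ ENNReal.ofReal (Real.exp ((∑ i, φ (node i) * (Real.exp (H i) - 1)) - c * N)) := by
  -- the exponent is `N (- θ ε + θ ^ 2 B ^ 2 M₀)`, at most `- N θ ε / 2` for this choice
  set θ : ℝ := min (1 / (B + 1)) (ε / (2 * (B ^ 2 * M₀ + 1))) with hθ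
  have hθ0 : 0 < θ := by positivity
  have hθB : θ * B ≤ 1 := by
    have : θ * (B + 1) ≤ 1 := by
      rw [← le_div_iff₀ (by positivity)]
      exact min_le_left _ _
    nlinarith
  have hθε : θ * (B ^ 2 * M₀) ≤ ε / 2 := by
    have : θ * (2 * (B ^ 2 * M₀ + 1)) ≤ ε := by
      rw [← le_div_iff₀ (by positivity)]
      exact min_le_right _ _
    nlinarith
  refine ⟨θ * (ε / 2), by positivity, ?_⟩
  intro lam hpos φ hφ N hN Ω mΩ P _ X ℱ hX hM hX0 τ hτ hτ0 H g hHM k n hkn f hf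
  have hN' : (0 : ℝ) < N := by exact_mod_cast hN
  set a : Fin N → ℝ := fun i => Real.exp (H i) with ha
  set b : ℕ → Fin N → ℝ := fun k j => Real.exp (g k j) with hb
  have ha0 : ∀ i, 0 < a i := fun i => Real.exp_pos _
  have hb0 : ∀ k i, 0 < b k i := fun k i => Real.exp_pos _
  set w : Fin N → ℝ := fun i => φ (node i) * Real.exp (H i) with hw
  have hw0 : ∀ i, 0 ≤ w i := fun i => mul_nonneg (hφ _) (Real.exp_pos _).le
  set μ : ℝ := wavg w (kernIter lam N τ b k f) with hμ
  set csum : ℝ := ∑ i, φ (node i) * (Real.exp (H i) - 1) with hcsum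
  have hmeas : Measurable[ℱ (τ k)] fun ω => avgc (X (τ k) ω) f :=
    (measurable_of_countable fun x => avgc x f).comp (hM.1 (τ k))
  have hmeas' : Measurable fun ω => avgc (X (τ k) ω) f := hmeas.mono (ℱ.le _) le_rfl
  have hset : MeasurableSet {ω | ε ≤ avgc (X (τ k) ω) f - μ} :=
    measurableSet_le measurable_const (hmeas'.sub_const _)
  set V : Ω → ℝ≥0∞ := fun ω => ENNReal.ofReal (Real.exp (N * (θ * avgc (X (τ k) ω) f))) with hV
  have hVm : Measurable[ℱ (τ k)] V :=
    ENNReal.measurable_ofReal.comp (Real.measurable_exp.comp ((hmeas.const_mul _).const_mul _))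
  have h1 : ∫⁻ ω, V ω * ENNReal.ofReal (tilt lam X τ a b n ω) ∂P
      ≤ ENNReal.ofReal (Real.exp (csum + N * (θ * μ + θ ^ 2 * (B ^ 2 * M₀)))) := by
    rw [lintegral_tilt_mul hX hM hpos hτ ha0 hb0 hkn hVm]
    have e1 : ∀ ω, V ω * ENNReal.ofReal (tilt lam X τ a b k ω)
        = ENNReal.ofReal (tilt lam X τ a b k ω
          * mult (fun i => Real.exp (θ * f i)) (X (τ k) ω)) := fun ω => by
      simp only [hV]
      rw [exp_avgc hN, mul_comm, ← ENNReal.ofReal_mul (tilt_pos hpos hτ ha0 hb0 k ω).le]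
    simp_rw [e1]
    have hnn : (0 : Fin N → ℝ) ≤ kernIter lam N τ b k (fun i => Real.exp (θ * f i)) := by
      have := kernIter_mono hpos hτ hb0 k (f := fun _ => (0 : ℝ))
        (f' := fun i => Real.exp (θ * f i)) (fun i => (Real.exp_pos _).le)
      rwa [kernIter_const hpos hτ hb0] at this
    rw [lintegral_tilt_mul_mult hX hM hpos hτ ha0 hb0 k (fun i => (Real.exp_pos _).le), hτ0,
      lintegral_mult_initial hφ (hX.measurable 0) hX0 (mul_nonneg (fun i => (ha0 i).le) hnn)]
    refine ENNReal.ofReal_le_ofReal (Real.exp_le_exp.2 ?_)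
    have h2 : kernIter lam N τ b k (fun i => Real.exp (θ * f i))
        ≤ fun i => (1 + θ ^ 2 * B ^ 2) + θ * kernIter lam N τ b k f i := by
      rw [← kernIter_affine hpos hτ hb0]
      refine kernIter_mono hpos hτ hb0 k fun i => ?_
      have h3 : |θ * f i| ≤ θ * B := by
        rw [abs_mul, abs_of_pos hθ0]
        exact mul_le_mul_of_nonneg_left (hf i) hθ0.le
      have h4 := (abs_le.1 (Real.abs_exp_sub_one_sub_id_le (h3.trans hθB))).2
      have h5 : (θ * f i) ^ 2 ≤ θ ^ 2 * B ^ 2 := by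
        rw [← mul_pow, ← sq_abs]
        exact pow_le_pow_left₀ (abs_nonneg _) h3 2
      simp only
      linarith
    have h6 : ∀ i, φ (node i) * ((a * kernIter lam N τ b k fun i => Real.exp (θ * f i)) i - 1)
        ≤ φ (node i) * (Real.exp (H i) - 1) + θ * (w i * kernIter lam N τ b k f i)
          + θ ^ 2 * (B ^ 2 * M₀) := by
      intro i
      have h7 := mul_le_mul_of_nonneg_left (h2 i) (hw0 i)
      have h8 := mul_le_mul_of_nonneg_left (hHM i) (by positivity : 0 ≤ θ ^ 2 * B ^ 2)
      have e : φ (node i) * ((a * kernIter lam N τ b k fun i => Real.exp (θ * f i)) i - 1)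
          = w i * kernIter lam N τ b k (fun i => Real.exp (θ * f i)) i - φ (node i) := by
        simp only [hw, ha, Pi.mul_apply]; ring
      rw [e]
      change θ ^ 2 * B ^ 2 * w i ≤ _ at h8
      have e2 : φ (node i) * (Real.exp (H i) - 1) = w i - φ (node i) := by
        simp only [hw]; ring
      rw [e2]
      linarith
    refine (Finset.sum_le_sum fun i _ => h6 i).trans (le_of_eq ?_)
    rw [Finset.sum_add_distrib, Finset.sum_add_distrib, ← Finset.mul_sum, Finset.sum_const,
      Finset.card_univ, Fintype.card_fin, nsmul_eq_mul, hμ, wavg_apply, hcsum]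
    field_simp
    ring
  calc ∫⁻ ω in {ω | ε ≤ avgc (X (τ k) ω) f - μ}, ENNReal.ofReal (tilt lam X τ a b n ω) ∂P
      ≤ ∫⁻ ω in {ω | ε ≤ avgc (X (τ k) ω) f - μ}, ENNReal.ofReal (Real.exp (-(N * (θ * (μ + ε)))))
          * (V ω * ENNReal.ofReal (tilt lam X τ a b n ω)) ∂P := by
        refine setLIntegral_mono' hset fun ω hω => ?_
        rw [← mul_assoc]
        refine le_mul_of_one_le_left zero_le ?_
        simp only [hV]
        rw [← ENNReal.ofReal_mul (Real.exp_pos _).le, ← Real.exp_add, ENNReal.one_le_ofReal,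
          Real.one_le_exp_iff]
        have hω' : ε ≤ avgc (X (τ k) ω) f - μ := hω
        have : 0 ≤ N * (θ * (avgc (X (τ k) ω) f - μ - ε)) :=
          mul_nonneg hN'.le (mul_nonneg hθ0.le (by linarith))
        linarith
    _ ≤ ∫⁻ ω, ENNReal.ofReal (Real.exp (-(N * (θ * (μ + ε)))))
          * (V ω * ENNReal.ofReal (tilt lam X τ a b n ω)) ∂P := setLIntegral_le_lintegral _ _
    _ = ENNReal.ofReal (Real.exp (-(N * (θ * (μ + ε)))))
          * ∫⁻ ω, V ω * ENNReal.ofReal (tilt lam X τ a b n ω) ∂P :=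
        lintegral_const_mul' _ _ ENNReal.ofReal_ne_top
    _ ≤ ENNReal.ofReal (Real.exp (-(N * (θ * (μ + ε)))))
          * ENNReal.ofReal (Real.exp (csum + N * (θ * μ + θ ^ 2 * (B ^ 2 * M₀)))) := by gcongr
    _ ≤ _ := by
        rw [← ENNReal.ofReal_mul (Real.exp_pos _).le, ← Real.exp_add]
        refine ENNReal.ofReal_le_ofReal (Real.exp_le_exp.2 ?_)
        have h9 : N * (θ * (θ * (B ^ 2 * M₀))) ≤ N * (θ * (ε / 2)) := by gcongr
        nlinarith

theorem wavg_neg_kernIter {lam : C(I × I, ℝ)} (hpos : ∀ p, 0 < lam p) {N : ℕ} {τ : ℕ → ℝ≥0}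
    (hτ : Monotone τ) {b : ℕ → Fin N → ℝ} (hb : ∀ k i, 0 < b k i) (w f : Fin N → ℝ) (n : ℕ) :
    wavg w (kernIter lam N τ b n (-f)) = -wavg w (kernIter lam N τ b n f) := by
  have h := kernIter_affine hpos hτ hb n 0 (-1) f
  have e1 : (fun i => (0 : ℝ) + -1 * f i) = -f := by ext i; simp
  have e2 : (fun i => (0 : ℝ) + -1 * kernIter lam N τ b n f i) = -kernIter lam N τ b n f := by
    ext i; simp
  rw [e1, e2] at h
  rw [h, map_neg]

theorem avgc_neg {N : ℕ} (x : Fin N → ℕ) (f : Fin N → ℝ) : avgc x (-f) = -avgc x f := by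
  simp [avgc]

/-- The two-sided Chernoff bound under the tilted law. -/
theorem exists_setLIntegral_tilt_abs_le {B M₀ ε : ℝ} (hB : 0 ≤ B) (hM₀ : 0 ≤ M₀) (hε : 0 < ε) :
    ∃ c > 0, ∀ (lam : C(I × I, ℝ)) (_ : ∀ p, 0 < lam p) (φ : C(I, ℝ)) (_ : ∀ x, 0 ≤ φ x) (N : ℕ)
      (_ : 0 < N) (Ω : Type*) [m : MeasurableSpace Ω] (P : Measure Ω) [IsProbabilityMeasure P]
      (X : ℝ≥0 → Ω → Fin N → ℕ) (ℱ : Filtration ℝ≥0 m) (_ : IsUrnProcess lam N P X)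
      (_ : SolvesMartingaleProblem lam P X ℱ) (_ : IsPoissonInitial φ N P (X 0)) (τ : ℕ → ℝ≥0)
      (_ : Monotone τ) (_ : τ 0 = 0) (H : Fin N → ℝ) (g : ℕ → Fin N → ℝ)
      (_ : ∀ i, φ (node i) * Real.exp (H i) ≤ M₀) (k n : ℕ) (_ : k ≤ n) (f : Fin N → ℝ)
      (_ : ∀ i, |f i| ≤ B),
      ∫⁻ ω in {ω | ε ≤ |avgc (X (τ k) ω) f - wavg (fun i => φ (node i) * Real.exp (H i))
          (kernIter lam N τ (fun k j => Real.exp (g k j)) k f)|},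
        ENNReal.ofReal (tilt lam X τ (fun i => Real.exp (H i)) (fun k j => Real.exp (g k j)) n ω) ∂P
      ≤ ENNReal.ofReal (2 * Real.exp ((∑ i, φ (node i) * (Real.exp (H i) - 1)) - c * N)) := by
  obtain ⟨c, hc, h⟩ := exists_setLIntegral_tilt_le hB hM₀ hε
  refine ⟨c, hc, ?_⟩
  intro lam hpos φ hφ N hN Ω mΩ P _ X ℱ hX hM hX0 τ hτ hτ0 H g hHM k n hkn f hf
  have h1 := h lam hpos φ hφ N hN Ω P X ℱ hX hM hX0 τ hτ hτ0 H g hHM k n hkn f hf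
  have h2 := h lam hpos φ hφ N hN Ω P X ℱ hX hM hX0 τ hτ hτ0 H g hHM k n hkn (-f)
    (fun i => by rw [Pi.neg_apply, abs_neg]; exact hf i)
  rw [wavg_neg_kernIter hpos hτ (fun k i => Real.exp_pos _)] at h2
  simp only [avgc_neg] at h2
  have hsub : {ω | ε ≤ |avgc (X (τ k) ω) f - wavg (fun i => φ (node i) * Real.exp (H i))
        (kernIter lam N τ (fun k j => Real.exp (g k j)) k f)|}
      ⊆ {ω | ε ≤ avgc (X (τ k) ω) f - wavg (fun i => φ (node i) * Real.exp (H i))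
          (kernIter lam N τ (fun k j => Real.exp (g k j)) k f)}
        ∪ {ω | ε ≤ -avgc (X (τ k) ω) f - -wavg (fun i => φ (node i) * Real.exp (H i))
          (kernIter lam N τ (fun k j => Real.exp (g k j)) k f)} := by
    intro ω hω
    have hω' : ε ≤ |_| := hω
    rcases le_abs.1 hω' with h3 | h3
    · exact Or.inl h3
    · refine Or.inr ?_
      change ε ≤ _
      linarith
  refine (lintegral_mono_set hsub).trans ((lintegral_union_le _ _ _).trans ?_)
  refine (add_le_add h1 h2).trans (le_of_eq ?_)
  rw [← ENNReal.ofReal_add (Real.exp_pos _).le (Real.exp_pos _).le, two_mul]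

/-! ### The lower bound -/

theorem setLIntegral_le_mul_measure {Ω : Type*} [MeasurableSpace Ω] {P : Measure Ω} {Z : Ω → ℝ≥0∞}
    (hZ : Measurable Z) {A E : Set Ω} {c : ℝ≥0∞} (h : ∀ᵐ ω ∂P, ω ∈ A → Z ω ≤ c ∧ ω ∈ E) :
    ∫⁻ ω in A, Z ω ∂P ≤ c * P E := by
  have h1 : ∀ᵐ ω ∂(P.restrict A), Z ω ≤ c :=
    (ae_restrict_iff (measurableSet_le hZ measurable_const)).2 (h.mono fun ω hω hA => (hω hA).1)
  calc ∫⁻ ω in A, Z ω ∂P ≤ ∫⁻ _ in A, c ∂P := lintegral_mono_ae h1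
    _ = c * P A := by rw [setLIntegral_const]
    _ ≤ c * P E := mul_le_mul' le_rfl (measure_mono_ae (h.mono fun ω hω hA => (hω hA).2))

/-- The tilt is at most exponentially large on the event of at most `M N` balls. -/
theorem exists_tilt_le (lam : C(I × I, ℝ)) (hpos : ∀ p, 0 < lam p) {T : ℝ} {hT : 0 < T}
    (H : C(I, ℝ)) (G : C10 hT) {M : ℝ} (hM : 0 ≤ M) :
    ∃ (K : ℝ) (m₀ N₀ : ℕ), 0 < m₀ ∧ ∀ m ≥ m₀, ∀ N ≥ N₀, 0 < N → ∀ (Ω : Type*)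
      (X : ℝ≥0 → Ω → Fin N → ℕ) (ω : Ω), (∀ t, (mass (X t ω) : ℝ) ≤ M * N) →
      tilt lam X (grid T m) (fun i => Real.exp (H (node i)))
        (fun k j => Real.exp (G.val (gridI hT m k, node j))) m ω ≤ Real.exp (K * N) := by
  obtain ⟨m₀, N₀, hm₀, h⟩ := exists_sum_step_le lam G (ε := 1) one_pos
  refine ⟨M * (‖H‖ + 2 * ‖G.val‖ + T * ‖dtB lam G‖ + T), m₀, N₀, hm₀, ?_⟩
  intro m hm N hN hNpos Ω X ω hmass
  have hm' : (0 : ℝ) < m := by exact_mod_cast lt_of_lt_of_le hm₀ hm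
  rw [tilt_exp_eq hpos (grid_monotone hT m) hNpos (fun i => H (node i))
    (fun k j => G.val (gridI hT m k, node j)), mul_comm (N : ℝ)]
  refine Real.exp_le_exp.2 (mul_le_mul_of_nonneg_right ?_ (Nat.cast_nonneg N))
  have h1 := (abs_le.1 (h m hm N hN M hM (fun k => avgLin (X (grid T m k) ω))
    (fun k f c hc hf => abs_avgc_le hM hc (hmass _) hf))).2
  have hb : ∀ (t : ℝ≥0) (W : C(Icc (0 : ℝ) T × I, ℝ)) (r : Icc (0 : ℝ) T),
      |avgc (X t ω) (fun i => W (r, node i))| ≤ M * ‖W‖ := fun t W r =>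
    abs_avgc_le hM (norm_nonneg W) (hmass t) fun i => W.norm_coe_le_norm _
  have h2 := (abs_le.1 (hb (grid T m m) G.val (gridI hT m m))).2
  have h3 := (abs_le.1 (hb (grid T m 0) G.val (gridI hT m 0))).1
  have h4 : |avgc (X (grid T m 0) ω) (fun i => H (node i))| ≤ M * ‖H‖ :=
    abs_avgc_le hM (norm_nonneg H) (hmass _) fun i => H.norm_coe_le_norm _
  have h5 : -(T * (M * ‖dtB lam G‖)) ≤ ∑ k ∈ Finset.range m,
      T / m * avgc (X (grid T m k) ω) (fun i => dtB lam G (gridI hT m k, node i)) := by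
    have e : -(T * (M * ‖dtB lam G‖))
        = ∑ k ∈ Finset.range m, T / m * -(M * ‖dtB lam G‖) := by
      rw [Finset.sum_const, Finset.card_range, nsmul_eq_mul]; field_simp
    rw [e]
    refine Finset.sum_le_sum fun k _ => mul_le_mul_of_nonneg_left ?_ (by positivity)
    exact (abs_le.1 (hb (grid T m k) (dtB lam G) (gridI hT m k))).1
  have h6 := (abs_le.1 h4).2
  change _ - (avgc (X (grid T m m) ω) (fun i => G.val (gridI hT m m, node i))
    - avgc (X (grid T m 0) ω) (fun i => G.val (gridI hT m 0, node i))
    - ∑ k ∈ Finset.range m, T / m * avgc (X (grid T m k) ω)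
      (fun i => dtB lam G (gridI hT m k, node i))) ≤ _ at h1
  suffices hS : ∀ S, S - (avgc (X (grid T m m) ω) (fun i => G.val (gridI hT m m, node i))
    - avgc (X (grid T m 0) ω) (fun i => G.val (gridI hT m 0, node i))
    - ∑ k ∈ Finset.range m, T / m * avgc (X (grid T m k) ω)
      (fun i => dtB lam G (gridI hT m k, node i))) ≤ M * 1 * T →
      avgc (X (grid T m 0) ω) (fun i => H (node i)) + S
        ≤ M * (‖H‖ + 2 * ‖G.val‖ + T * ‖dtB lam G‖ + T) from hS _ h1
  intro S hS
  linarith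

section Lower

variable {T : ℝ} {lam : C(I × I, ℝ)} {φ : C(I, ℝ)} {Ω : ℕ → Type*}
  [∀ N, MeasurableSpace (Ω N)] {P : ∀ N, Measure (Ω N)} [∀ N, IsProbabilityMeasure (P N)]
  {X : ∀ N, ℝ≥0 → Ω N → Fin N → ℕ}

set_option maxHeartbeats 1000000 in
/-- The probability of following a density is at least exponential in its cost: under the law tilted
by nearly optimal controls the path follows the density, and there the tilt is at most the
exponential of `N` times the cost. -/
theorem eventually_le_measure_near (hT : 0 < T) (hpos : ∀ p, 0 < lam p) {lam₁ lam₂ : C(I, ℝ)}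
    (hprod : ∀ x y : I, lam (x, y) = lam₁ x * lam₂ y) (hφ : ∀ x, 0 ≤ φ x)
    (hX : ∀ N, IsUrnProcess lam N (P N) (X N)) (hX0 : ∀ N, IsPoissonInitial φ N (P N) (X N 0))
    (ψ : C10 hT) (hψ : ∀ p, 0 ≤ ψ.val p) (hdt : ∀ s : Icc (0 : ℝ) T, ∫ x : I, ψ.dt (s, x) = 0)
    {a₁ a₂ : ℝ} (ha₁ : ∀ H, costIni φ H (ψ.val.curry (t0 hT)) ≤ a₁)
    (ha₂ : ∀ G : C10 hT, costDyn lam G ψ.val ≤ a₂) (s : Finset C(I, ℝ)) {ε b : ℝ} (hε : 0 < ε)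
    (hb : a₁ + a₂ < b) :
    ∀ᶠ N : ℕ in atTop, ENNReal.ofReal (Real.exp (-b * N)) ≤
      P N {ω | ∀ t, ∀ f ∈ s, |empiricalPath T (fun t => X N t ω) ((hX N).cadlag ω) t f
        - ∫ x : I, f x * ψ.val (t, x)| < ε} := by
  classical
  set gap : ℝ := b - (a₁ + a₂) with hgap
  have hgap0 : 0 < gap := sub_pos.2 hb
  obtain ⟨H, G, B, m₁, hm₁, hctl⟩ := exists_mean_control hpos hprod hφ ψ hψ hdt ha₁ ha₂ s
    (ε := ε / 4) (gap := gap / 4) (by positivity) (by positivity)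
  set Fb : ℝ := 1 + ∑ f ∈ s, ‖f‖ with hFb
  have hFb0 : 0 < Fb := by positivity
  have hsF : ∀ f ∈ s, ‖f‖ ≤ Fb := fun f hf => by
    have := Finset.single_le_sum (f := fun f : C(I, ℝ) => ‖f‖) (fun _ _ => norm_nonneg _) hf
    linarith
  set M₀ : ℝ := ‖φ‖ * Real.exp ‖H‖ with hM₀
  have hM₀0 : 0 ≤ M₀ := by positivity
  have hφH : ∀ x, φ x * Real.exp (H x) ≤ M₀ := fun x =>
    mul_le_mul ((le_abs_self _).trans (φ.norm_coe_le_norm x))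
      (Real.exp_le_exp.2 ((le_abs_self _).trans (H.norm_coe_le_norm x))) (Real.exp_pos _).le
      (norm_nonneg _)
  set M : ℝ := M₀ + 1 with hM
  have hM0 : 0 ≤ M := by positivity
  -- the tilt is at most `exp (K N)`, so that oscillations whose probability is smaller than
  -- `exp (-(K + ‖φ‖ + 1) N)` are negligible under the tilted law as well
  obtain ⟨K, m₂, N₂, hm₂, htilt⟩ := exists_tilt_le lam hpos H G hM0
  obtain ⟨m₃, hm₃, hosc⟩ := exists_measure_osc_le hpos hT hM0 (ε := ε / 8 / Fb) (by positivity)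
    (K + ‖φ‖ + 1)
  obtain ⟨δ, hδ, hmod⟩ := exists_modulus ψ.val (ε := ε / 8 / Fb) (by positivity)
  obtain ⟨m₄, hm₄, hmesh⟩ := exists_mesh_lt T hδ
  set m : ℕ := max (max m₁ m₂) (max m₃ m₄) with hm
  have hmm₁ : m₁ ≤ m := (le_max_left _ _).trans (le_max_left _ _)
  have hmm₂ : m₂ ≤ m := (le_max_right _ _).trans (le_max_left _ _)
  have hmm₃ : m₃ ≤ m := (le_max_left _ _).trans (le_max_right _ _)
  have hmm₄ : m₄ ≤ m := (le_max_right _ _).trans (le_max_right _ _)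
  have hmpos : 0 < m := lt_of_lt_of_le hm₁ hmm₁
  clear_value m
  set ε₁ : ℝ := min 1 (min (ε / 8) (gap / 4 / (2 * m + 1))) with hε₁
  have hε₁0 : 0 < ε₁ := by positivity
  have hε₁1 : ε₁ ≤ 1 := min_le_left _ _
  have hε₁2 : ε₁ ≤ ε / 8 := (min_le_right _ _).trans (min_le_left _ _)
  have hε₁3 : (2 * m + 1) * ε₁ ≤ gap / 4 := by
    rw [mul_comm, ← le_div_iff₀ (by positivity)]
    exact (min_le_right _ _).trans (min_le_right _ _)
  set B' : ℝ := |B| + Fb + ‖H‖ + ‖G.val‖ + 1 with hB'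
  obtain ⟨c, hc, hcher⟩ := exists_setLIntegral_tilt_abs_le (B := B') (by positivity) hM₀0 hε₁0
  have hlim : ∀ a > 0, Tendsto (fun N : ℕ => Real.exp (-(a * N))) atTop (𝓝 0) := fun a ha =>
    Real.tendsto_exp_neg_atTop_nhds_zero.comp
      (tendsto_natCast_atTop_atTop.const_mul_atTop ha)
  have hlim1 : Tendsto (fun N : ℕ => ((m : ℝ) + 1) * (s.card + 4) * 2 * Real.exp (-(c * N))
      + m * Real.exp (-(1 * N))) atTop (𝓝 (((m : ℝ) + 1) * (s.card + 4) * 2 * 0 + m * 0)) :=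
    ((hlim c hc).const_mul _).add ((hlim 1 one_pos).const_mul _)
  rw [mul_zero, mul_zero, add_zero] at hlim1
  filter_upwards [hctl m hmm₁, eventually_ge_atTop N₂, eventually_gt_atTop 0,
    hlim1.eventually (gt_mem_nhds (by norm_num : (0 : ℝ) < 1 / 2)),
    (hlim (gap / 2) (by positivity)).eventually (gt_mem_nhds (by norm_num : (0 : ℝ) < 1 / 2))]
    with N hN hNN₂ hNpos hNs hNg
  obtain ⟨hcost, hmean, hlog⟩ := hN
  have hN' : (0 : ℝ) < N := by exact_mod_cast hNpos
  obtain ⟨ℱ, hℱ⟩ := (hX N).martingale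
  have hMP : SolvesMartingaleProblem lam (P N) (X N) ℱ := hℱ
  have hτ := grid_monotone hT m
  set Hv : Fin N → ℝ := fun i => H (node i) with hHv
  set g : ℕ → Fin N → ℝ := fun k i => G.val (gridI hT m k, node i) with hg
  set Z : Ω N → ℝ := tilt lam (X N) (grid T m) (fun i => Real.exp (Hv i))
    (fun k i => Real.exp (g k i)) m with hZ
  set csum : ℝ := ∑ i : Fin N, φ (node i) * (Real.exp (Hv i) - 1) with hcsum
  have hint : ∫⁻ ω, ENNReal.ofReal (Z ω) ∂(P N) = ENNReal.ofReal (Real.exp csum) :=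
    lintegral_tilt (hX N) hMP hpos hφ (hX0 N) hτ (grid_zero T m) (fun i => Real.exp_pos _)
      (fun k i => Real.exp_pos _) m
  have hZm : Measurable fun ω => ENNReal.ofReal (Z ω) :=
    ENNReal.measurable_ofReal.comp ((measurable_tilt hMP hτ m).mono (ℱ.le _) le_rfl)
  set μ : ℕ → (Fin N → ℝ) → ℝ := fun k f => mean lam φ H N G m k f with hμ
  -- the test vectors whose averages have to be close to their means: those of the neighbourhood, those
  -- of the exponent of the tilt, and the constant `1`, which controls the number of balls
  set V : ℕ → Finset (Fin N → ℝ) := fun k => s.image (fun f i => f (node i)) ∪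
    {g k, logStep lam N G m k, Hv, fun _ => 1} with hV
  have hVcard : ∀ k, ((V k).card : ℝ) ≤ s.card + 4 := fun k => by
    have h1 : (V k).card ≤ s.card + 4 := (Finset.card_union_le _ _).trans
      (add_le_add Finset.card_image_le Finset.card_le_four)
    exact_mod_cast h1
  have hVB : ∀ k, ∀ f ∈ V k, ∀ i, |f i| ≤ B' := by
    intro k f hf i
    have n1 := abs_nonneg B
    have n2 := norm_nonneg H
    have n3 := norm_nonneg G.val
    rw [hV, Finset.mem_union, Finset.mem_image] at hf
    simp only [Finset.mem_insert, Finset.mem_singleton] at hf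
    rcases hf with ⟨f, hfs, rfl⟩ | rfl | rfl | rfl | rfl
    · have := (f.norm_coe_le_norm (node i)).trans (hsF f hfs)
      rw [Real.norm_eq_abs] at this
      linarith
    · have := G.val.norm_coe_le_norm (gridI hT m k, node i)
      rw [Real.norm_eq_abs] at this
      simp only [hg]
      linarith
    · have := hlog k i
      linarith [le_abs_self B]
    · have := H.norm_coe_le_norm (node i)
      rw [Real.norm_eq_abs] at this
      simp only [hHv]
      linarith
    · rw [abs_one]; linarith
  -- the events on which the path leaves its mean, or oscillates
  set b₁ : ℕ → (Fin N → ℝ) → Set (Ω N) := fun k f =>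
    {ω | ε₁ ≤ |avgc (X N (grid T m k) ω) f - μ k f|} with hb₁
  set bad₁ : Set (Ω N) := ⋃ k ∈ Finset.range (m + 1), ⋃ f ∈ V k, b₁ k f with hbad₁
  set bad₂ : Set (Ω N) := {ω | (mass (X N 0 ω) : ℝ) ≤ M * N ∧ ∃ s t : ℝ≥0, s ≤ t ∧ (t : ℝ) ≤ T ∧
    (t : ℝ) ≤ s + T / m ∧ ε / 8 / Fb * N ≤ dist1 (X N s ω) (X N t ω)} with hbad₂
  set E : Set (Ω N) := {ω | ∀ t, ∀ f ∈ s, |empiricalPath T (fun t => X N t ω) ((hX N).cadlag ω) t f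
        - ∫ x : I, f x * ψ.val (t, x)| < ε} with hE
  have hi₁ : ∫⁻ ω in bad₁, ENNReal.ofReal (Z ω) ∂(P N)
      ≤ ENNReal.ofReal (((m : ℝ) + 1) * (s.card + 4) * 2 * Real.exp (-(c * N)) * Real.exp csum) := by
    have h1 : ∀ k ∈ Finset.range (m + 1), ∀ f ∈ V k,
        ∫⁻ ω in b₁ k f, ENNReal.ofReal (Z ω) ∂(P N)
          ≤ ENNReal.ofReal (2 * Real.exp (csum - c * N)) := fun k hk f hf =>
      hcher lam hpos φ hφ N hNpos (Ω N) (P N) (X N) ℱ (hX N) hMP (hX0 N) (grid T m) hτ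
        (grid_zero T m) Hv g (fun i => hφH _) k m (Nat.lt_succ_iff.1 (Finset.mem_range.1 hk)) f
        (hVB k f hf)
    have hun : ∀ {ι : Type} (F : Finset ι) (A : ι → Set (Ω N)),
        ∫⁻ ω in ⋃ i ∈ F, A i, ENNReal.ofReal (Z ω) ∂(P N)
          ≤ ∑ i ∈ F, ∫⁻ ω in A i, ENNReal.ofReal (Z ω) ∂(P N) := by
      intro ι F A
      induction F using Finset.induction_on with
      | empty => simp
      | insert i F hi ih =>
        rw [Finset.set_biUnion_insert, Finset.sum_insert hi]
        exact (lintegral_union_le _ _ _).trans (add_le_add le_rfl ih)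
    refine (hun _ _).trans ((Finset.sum_le_sum fun k hk => (hun _ _).trans
      (Finset.sum_le_sum fun f hf => h1 k hk f hf)).trans ?_)
    simp only [Finset.sum_const, nsmul_eq_mul]
    have h2 : ∀ k ∈ Finset.range (m + 1), ((V k).card : ℝ≥0∞)
        * ENNReal.ofReal (2 * Real.exp (csum - c * N))
        ≤ ENNReal.ofReal ((s.card + 4) * (2 * Real.exp (csum - c * N))) := fun k _ => by
      rw [← ENNReal.ofReal_natCast, ← ENNReal.ofReal_mul (Nat.cast_nonneg _)]
      exact ENNReal.ofReal_le_ofReal (mul_le_mul_of_nonneg_right (hVcard k) (by positivity))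
    refine (Finset.sum_le_sum h2).trans (le_of_eq ?_)
    rw [Finset.sum_const, Finset.card_range, nsmul_eq_mul, ← ENNReal.ofReal_natCast,
      ← ENNReal.ofReal_mul (Nat.cast_nonneg _), sub_eq_add_neg, Real.exp_add]
    congr 1
    push_cast
    ring
  have hi₂ : ∫⁻ ω in bad₂, ENNReal.ofReal (Z ω) ∂(P N)
      ≤ ENNReal.ofReal (m * Real.exp (-(1 * N)) * Real.exp csum) := by
    have h1 : ∫⁻ ω in bad₂, ENNReal.ofReal (Z ω) ∂(P N)
        ≤ ENNReal.ofReal (Real.exp (K * N)) * P N bad₂ := by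
      refine setLIntegral_le_mul_measure hZm ?_
      filter_upwards [ae_forall_mass_le (hX N) hMP] with ω hω hωb
      refine ⟨ENNReal.ofReal_le_ofReal (htilt m hmm₂ N hNN₂ hNpos (Ω N) (X N) ω fun t => ?_), hωb⟩
      exact le_trans (by exact_mod_cast hω t) hωb.1
    have h2 := hosc m hmm₃ N (Ω N) (P N) (X N) ℱ (hX N) hMP
    refine (h1.trans (mul_le_mul_right h2 _)).trans ?_
    rw [← ENNReal.ofReal_mul (Real.exp_pos _).le]
    refine ENNReal.ofReal_le_ofReal ?_
    have h3 : -(‖φ‖ * N) ≤ csum := by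
      have : -(‖φ‖ * N) = ∑ _i : Fin N, -‖φ‖ := by simp [mul_comm]
      rw [this]
      refine Finset.sum_le_sum fun i _ => ?_
      have e1 := mul_nonneg (hφ (node i)) (Real.exp_pos (Hv i)).le
      have e2 := (le_abs_self _).trans (φ.norm_coe_le_norm (node i))
      linarith
    have h4 : Real.exp (K * N) * (m * Real.exp (-((K + ‖φ‖ + 1) * N)))
        = m * Real.exp (-(1 * N)) * Real.exp (-(‖φ‖ * N)) := by
      have : Real.exp (-((K + ‖φ‖ + 1) * N))
          = Real.exp (-(K * N)) * (Real.exp (-(1 * N)) * Real.exp (-(‖φ‖ * N))) := by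
        rw [← Real.exp_add, ← Real.exp_add]; congr 1; ring
      rw [this, Real.exp_neg (K * N)]
      have := (Real.exp_pos (K * N)).ne'
      field_simp
    rw [h4]
    gcongr
  have hgood : ∫⁻ ω in (bad₁ ∪ bad₂)ᶜ, ENNReal.ofReal (Z ω) ∂(P N)
      ≤ ENNReal.ofReal (Real.exp (csum + (a₁ + a₂ + gap / 2) * N)) * P N E := by
    refine setLIntegral_le_mul_measure hZm ?_
    filter_upwards [ae_forall_mass_le (hX N) hMP] with ω hω hωg
    have hω₁ : ∀ k ≤ m, ∀ f ∈ V k, |avgc (X N (grid T m k) ω) f - μ k f| < ε₁ := by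
      intro k hk f hf
      by_contra! hcon
      exact hωg (Or.inl (mem_iUnion₂.2 ⟨k, Finset.mem_range.2 (by omega),
        mem_iUnion₂.2 ⟨f, hf, hcon⟩⟩))
    have hmem : ∀ k, g k ∈ V k ∧ logStep lam N G m k ∈ V k ∧ Hv ∈ V k ∧ (fun _ => (1 : ℝ)) ∈ V k :=
      fun k => by
        refine ⟨?_, ?_, ?_, ?_⟩ <;> refine Finset.mem_union_right _ ?_ <;> simp
    have hmass : (mass (X N 0 ω) : ℝ) ≤ M * N := by
      have h1 := (abs_lt.1 (hω₁ 0 (Nat.zero_le _) _ (hmem 0).2.2.2)).2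
      have h2 : μ 0 (fun _ => (1 : ℝ)) ≤ M₀ := by
        have : |wavg (fun i : Fin N => φ (node i) * Real.exp (H (node i))) (fun _ => (1 : ℝ))|
            ≤ M₀ * 1 := abs_wavg_le hM₀0 zero_le_one (fun i => by
          rw [abs_of_nonneg (mul_nonneg (hφ _) (Real.exp_pos _).le)]
          exact hφH _) (fun i => by rw [abs_one])
        rw [mul_one] at this
        exact (le_abs_self _).trans this
      have h3 : avgc (X N (grid T m 0) ω) (fun _ => (1 : ℝ)) = 1 / N * mass (X N 0 ω) := by
        rw [grid_zero]; simp [avgc, mass]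
      rw [h3] at h1
      have h4 : 1 / (N : ℝ) * mass (X N 0 ω) ≤ M := by linarith
      rwa [one_div, inv_mul_le_iff₀ hN', mul_comm] at h4
    refine ⟨ENNReal.ofReal_le_ofReal ?_, fun t f hf => ?_⟩
    · rw [hZ, tilt_exp_eq hpos hτ hNpos]
      refine Real.exp_le_exp.2 ?_
      have h1 := (abs_lt.1 (hω₁ 0 (Nat.zero_le _) _ (hmem 0).2.2.1)).2
      have h2 : ∑ k ∈ Finset.range m, (avgc (X N (grid T m (k + 1)) ω) (g (k + 1))
          - avgc (X N (grid T m k) ω) (logStep lam N G m k))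
          ≤ ∑ k ∈ Finset.range m, (μ (k + 1) (g (k + 1)) - μ k (logStep lam N G m k))
            + 2 * m * ε₁ := by
        have e : 2 * m * ε₁ = ∑ _k ∈ Finset.range m, 2 * ε₁ := by
          rw [Finset.sum_const, Finset.card_range, nsmul_eq_mul]; ring
        rw [e, ← Finset.sum_add_distrib]
        refine Finset.sum_le_sum fun k hk => ?_
        rw [Finset.mem_range] at hk
        have e1 := (abs_lt.1 (hω₁ (k + 1) hk _ (hmem (k + 1)).1)).2
        have e2 := (abs_lt.1 (hω₁ k hk.le _ (hmem k).2.1)).1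
        linarith
      have e1 : csum + (a₁ + a₂ + gap / 2) * N
          = N * (1 / (N : ℝ) * csum + (a₁ + a₂ + gap / 2)) := by field_simp
      rw [e1]
      refine mul_le_mul_of_nonneg_left ?_ hN'.le
      rw [meanCost] at hcost
      change μ 0 Hv + ∑ k ∈ Finset.range m, (μ (k + 1) (g (k + 1)) - μ k (logStep lam N G m k))
        - 1 / (N : ℝ) * csum ≤ _ at hcost
      change avgc (X N (grid T m 0) ω) Hv + ∑ k ∈ Finset.range m,
        (avgc (X N (grid T m (k + 1)) ω) (g (k + 1))
          - avgc (X N (grid T m k) ω) (logStep lam N G m k)) ≤ _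
      linarith
    · obtain ⟨k, hk, hk1, hk2⟩ := exists_grid_mem hT hmpos t.2.1 t.2.2
      have hstep := grid_step hT m k
      have e1 : (gridI hT m k : ℝ) = grid T m k := by
        rw [coe_gridI hT hmpos hk.le, coe_grid hT]
      have hnear : dist1 (X N (grid T m k) ω) (X N (t : ℝ).toNNReal ω) < ε / 8 / Fb * N := by
        by_contra! hcon
        refine hωg (Or.inr ⟨hmass, grid T m k, (t : ℝ).toNNReal, ?_, ?_, ?_, hcon⟩)
        · exact NNReal.coe_le_coe.1 (by rw [Real.coe_toNNReal _ t.2.1]; exact hk1)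
        · rw [Real.coe_toNNReal _ t.2.1]; exact t.2.2
        · rw [Real.coe_toNNReal _ t.2.1]; linarith
      have hfn := hsF f hf
      have d1 : |avgc (X N (grid T m k) ω) (fun i => f (node i))
          - empiricalPath T (fun t => X N t ω) ((hX N).cadlag ω) t f| ≤ ε / 8 := by
        have h1 := abs_avgc_sub_le (X N (grid T m k) ω) (X N (t : ℝ).toNNReal ω)
          (f := fun i => f (node i)) (c := Fb) (fun i => (f.norm_coe_le_norm _).trans hfn)
        rw [← empirical_eq_avgc (X N (t : ℝ).toNNReal ω)] at h1
        refine h1.trans ?_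
        have h2 : 1 / (N : ℝ) * dist1 (X N (grid T m k) ω) (X N (t : ℝ).toNNReal ω)
            ≤ ε / 8 / Fb := by
          rw [one_div, inv_mul_le_iff₀ hN', mul_comm]
          exact hnear.le
        refine (mul_le_mul_of_nonneg_right h2 hFb0.le).trans (le_of_eq ?_)
        field_simp
      have d2 := hω₁ k hk.le _ (Finset.mem_union_left _ (Finset.mem_image_of_mem _ hf))
      have d3 := hmean k hk.le f hf
      have d4 : |(∫ x : I, f x * ψ.val (gridI hT m k, x)) - ∫ x : I, f x * ψ.val (t, x)|
          ≤ ε / 8 := by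
        rw [← integral_sub (integrable_of_continuous (by fun_prop))
          (integrable_of_continuous (by fun_prop))]
        refine abs_integral_unitInterval_le fun x => ?_
        rw [← mul_sub, abs_mul]
        refine (mul_le_mul ((f.norm_coe_le_norm x).trans hfn) (hmod _ _ ?_ x) (abs_nonneg _)
          hFb0.le).trans (le_of_eq (by field_simp))
        rw [Subtype.dist_eq, Real.dist_eq, e1, abs_sub_comm, abs_of_nonneg (by linarith)]
        linarith [hmesh m hmm₄]
      have d1' := abs_le.1 d1
      have d2' := abs_lt.1 d2
      have d3' := abs_le.1 d3
      have d4' := abs_le.1 d4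
      simp only [hμ] at d2'
      exact abs_lt.2 ⟨by linarith, by linarith⟩
  -- the tilted law charges the complement of the bad events
  have htotal : ENNReal.ofReal (Real.exp csum)
      ≤ ENNReal.ofReal (Real.exp (csum + (a₁ + a₂ + gap / 2) * N)) * P N E
        + ENNReal.ofReal (Real.exp csum / 2) := by
    have h1 : ∫⁻ ω, ENNReal.ofReal (Z ω) ∂(P N)
        ≤ ∫⁻ ω in (bad₁ ∪ bad₂)ᶜ, ENNReal.ofReal (Z ω) ∂(P N)
          + (∫⁻ ω in bad₁, ENNReal.ofReal (Z ω) ∂(P N)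
            + ∫⁻ ω in bad₂, ENNReal.ofReal (Z ω) ∂(P N)) := by
      rw [← setLIntegral_univ, ← compl_union_self (bad₁ ∪ bad₂)]
      exact (lintegral_union_le _ _ _).trans (add_le_add le_rfl (lintegral_union_le _ _ _))
    rw [hint] at h1
    refine h1.trans (add_le_add hgood ((add_le_add hi₁ hi₂).trans ?_))
    rw [← ENNReal.ofReal_add (by positivity) (by positivity), ← add_mul]
    refine ENNReal.ofReal_le_ofReal ?_
    have := mul_le_mul_of_nonneg_right hNs.le (Real.exp_pos csum).le
    linarith
  have hhalf : ENNReal.ofReal (Real.exp csum / 2)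
      ≤ ENNReal.ofReal (Real.exp (csum + (a₁ + a₂ + gap / 2) * N)) * P N E := by
    have e : ENNReal.ofReal (Real.exp csum)
        = ENNReal.ofReal (Real.exp csum / 2) + ENNReal.ofReal (Real.exp csum / 2) := by
      rw [← ENNReal.ofReal_add (by positivity) (by positivity), add_halves]
    rw [e] at htotal
    exact (ENNReal.add_le_add_iff_right ENNReal.ofReal_ne_top).1 htotal
  have hne : ENNReal.ofReal (Real.exp (csum + (a₁ + a₂ + gap / 2) * N)) ≠ 0 := by
    simpa using Real.exp_pos _
  rw [← ENNReal.mul_le_mul_iff_right hne ENNReal.ofReal_ne_top]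
  refine le_trans ?_ hhalf
  rw [← ENNReal.ofReal_mul (Real.exp_pos _).le, ← Real.exp_add]
  refine ENNReal.ofReal_le_ofReal ?_
  have e : csum + (a₁ + a₂ + gap / 2) * N + -b * N = csum + -(gap / 2 * N) := by
    have : b = gap + (a₁ + a₂) := by rw [hgap]; ring
    rw [this]; ring
  rw [e, Real.exp_add]
  have := mul_le_mul_of_nonneg_left hNg.le (Real.exp_pos csum).le
  linarith

theorem le_log_div {p : ℝ≥0∞} {a : ℝ} {N : ℕ} (hN : 0 < N)
    (h : ENNReal.ofReal (Real.exp (a * N)) ≤ p) : (a : EReal) ≤ ENNReal.log p / (N : EReal) := by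
  have hN' : (0 : EReal) < N := by exact_mod_cast hN
  rw [EReal.le_div_iff_mul_le hN' (EReal.natCast_ne_top N)]
  refine le_trans (le_of_eq ?_) (ENNReal.log_monotone h)
  rw [ENNReal.log_ofReal_of_pos (Real.exp_pos _), Real.log_exp]
  norm_cast

/-- The lower bound of the large deviation principle. -/
theorem le_liminf_log_measure (hT : 0 < T) (hpos : ∀ p, 0 < lam p) {lam₁ lam₂ : C(I, ℝ)}
    (hprod : ∀ x y : I, lam (x, y) = lam₁ x * lam₂ y) (hφ : ∀ x, 0 ≤ φ x)
    (hX : ∀ N, IsUrnProcess lam N (P N) (X N)) (hX0 : ∀ N, IsPoissonInitial φ N (P N) (X N 0))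
    {O : Set (D T)} (hO : IsOpen O) :
    -(⨅ μ ∈ D0 hT ∩ O, (Iini φ (μ (t0 hT)) + Idyn lam hT μ))
      ≤ liminf (fun N : ℕ => ENNReal.log (P N {ω | empiricalPath T (fun t => X N t ω)
          ((hX N).cadlag ω) ∈ O}) / (N : EReal)) atTop := by
  rw [EReal.neg_le]
  refine le_iInf₂ fun μ hμ => ?_
  obtain ⟨⟨ψ, hψ, hμψ, hdt⟩, hμO⟩ := hμ
  rcases eq_or_ne (Iini φ (μ (t0 hT))) ⊤ with h1 | h1
  · rw [h1, EReal.top_add_of_ne_bot (ne_bot_of_le_ne_bot EReal.zero_ne_bot (Idyn_nonneg lam hT μ))]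
    exact le_top
  rcases eq_or_ne (Idyn lam hT μ) ⊤ with h2 | h2
  · rw [h2, EReal.add_top_of_ne_bot (ne_bot_of_le_ne_bot EReal.zero_ne_bot (Iini_nonneg φ _))]
    exact le_top
  have b1 := ne_bot_of_le_ne_bot EReal.zero_ne_bot (Iini_nonneg φ (μ (t0 hT)))
  have b2 := ne_bot_of_le_ne_bot EReal.zero_ne_bot (Idyn_nonneg lam hT μ)
  have ha₁ : ∀ H, costIni φ H (ψ.val.curry (t0 hT)) ≤ (Iini φ (μ (t0 hT))).toReal := fun H => by
    have h := Jini_le_Iini φ H (μ (t0 hT))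
    rw [Jini_eq_costIni (ψ₀ := ψ.val.curry (t0 hT)) (hμψ (t0 hT) H), ← EReal.coe_toReal h1 b1] at h
    exact EReal.coe_le_coe_iff.1 h
  have ha₂ : ∀ G : C10 hT, costDyn lam G ψ.val ≤ (Idyn lam hT μ).toReal := fun G => by
    have h := Jdyn_le_Idyn lam G μ
    rw [Jdyn_eq_costDyn hμψ, ← EReal.coe_toReal h2 b2] at h
    exact EReal.coe_le_coe_iff.1 h
  rw [← EReal.coe_toReal h1 b1, ← EReal.coe_toReal h2 b2, EReal.neg_le]
  refine le_of_forall_lt_imp_le_of_dense fun r hr => ?_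
  obtain ⟨r', hr1, hr2⟩ := EReal.lt_iff_exists_real_btwn.1 hr
  have hb : (Iini φ (μ (t0 hT))).toReal + (Idyn lam hT μ).toReal < -r' := by
    have h3 : (r' : EReal) < ((-((Iini φ (μ (t0 hT))).toReal + (Idyn lam hT μ).toReal) : ℝ) : EReal) := by
      rw [EReal.coe_neg, EReal.coe_add]
      exact hr2
    linarith [EReal.coe_lt_coe_iff.1 h3]
  have hopen : ∀ F ∈ O, ∃ s : Finset C(I, ℝ), ∃ ε > 0, skorokhodBall F s ε ⊆ O := hO
  obtain ⟨s, ε, hε, hs⟩ := hopen μ hμO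
  have hev := eventually_le_measure_near hT hpos hprod hφ hX hX0 ψ hψ hdt ha₁ ha₂ s hε hb
  refine hr1.le.trans (le_liminf_of_le (by isBoundedDefault) ?_)
  filter_upwards [hev, eventually_gt_atTop 0] with N hN hNpos
  refine le_log_div hNpos ?_
  rw [neg_neg] at hN
  refine hN.trans (measure_mono fun ω hω => hs ?_)
  refine ⟨OrderIso.refl _, fun t => by simpa using hε, fun t f hf => ?_⟩
  rw [hμψ]
  exact hω t f hf

end Lower

end Urn

end

theorem theorem2p3
    (T : ℝ) (hT : 0 < T)
    -- the rate function, positive and of class `C^{1,1}`, with the product form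
    (lam : C(I × I, ℝ)) (hlam_pos : ∀ p, 0 < lam p) (hlam_C11 : Urn.IsC11 lam)
    (lam₁ lam₂ : C(I, ℝ)) (hprod : ∀ x y : I, lam (x, y) = lam₁ x * lam₂ y)
    -- the urn processes, with independent Poisson initial contents
    (φ : C(I, ℝ)) (hφ : ∀ x, 0 ≤ φ x)
    (Ω : ℕ → Type*) [∀ N, MeasurableSpace (Ω N)]
    (P : ∀ N, Measure (Ω N)) [∀ N, IsProbabilityMeasure (P N)]
    (X : ∀ N, ℝ≥0 → Ω N → Fin N → ℕ)
    (hX : ∀ N, Urn.IsUrnProcess lam N (P N) (X N))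
    (hX0 : ∀ N, Urn.IsPoissonInitial φ N (P N) (X N 0)) :
    (∀ C : Set (Urn.D T), IsClosed C →
      limsup (fun N : ℕ => ENNReal.log (P N {ω | Urn.empiricalPath T (fun t => X N t ω)
          ((hX N).cadlag ω) ∈ C}) / (N : EReal)) atTop
        ≤ -(⨅ μ ∈ C, (Urn.Iini φ (μ (Urn.t0 hT)) + Urn.Idyn lam hT μ))) ∧
    (∀ O : Set (Urn.D T), IsOpen O →
      -(⨅ μ ∈ Urn.D0 hT ∩ O, (Urn.Iini φ (μ (Urn.t0 hT)) + Urn.Idyn lam hT μ))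
        ≤ liminf (fun N : ℕ => ENNReal.log (P N {ω | Urn.empiricalPath T (fun t => X N t ω)
          ((hX N).cadlag ω) ∈ O}) / (N : EReal)) atTop) := by
  refine ⟨fun C hC => Urn.limsup_log_measure_le hT hlam_pos hφ hX hX0 hC, fun O hO => ?_⟩
  exact Urn.le_liminf_log_measure hT hlam_pos hprod hφ hX hX0 hO
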